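/- **Setting.** Let $dg$ be the normalized Haar measure of $\mathrm{SU}(2)$, let $D^j$ be the irreducible representation of spin $j\in\{0,\tfrac12,1,\dots\}$, and for a cutoff $\Lambda\ge 1$ let $\delta_\Lambda(g)=\sum_{j\le\Lambda}(2j+1)\,\mathrm{tr}\,D^j(g)$. The covariance with cutoff is $$C_\Lambda(g_1,g_2,g_3;g_1',g_2',g_3')=\frac13\sum_{c}\int dh\ \prod_{i=1}^3\delta_\Lambda\bigl(g_{c(i)}\,h\,g_i'^{-1}\bigr),$$ where $c$ runs over the cyclic permutations of $\{1,2,3\}$. The Boulatov model has the interaction $\frac{\lambda}{8}T[\phi]$ with $$T[\phi]=\int\prod_{i=1}^6dg_i\ \phi(g_1,g_2,g_3)\phi(g_3,g_4,g_5)\phi(g_5,g_2,g_6)\phi(g_6,g_4,g_1).$$ The Boulatov–Freidel–Louapre (BFL) model, with a parameter $|\delta|\le1$, has the interaction $\frac{\lambda}{8}\langle S\phi\,|\,(1+\delta\mathcal T)S\phi\rangle_{L^2(\mathrm{SU}(2)^4)}$, where $S\phi(g_1,g_2,g_3,g_4)=\int dg\,\phi(g_1,g_2,g)\phi(g,g_3,g_4)$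 and $\mathcal T$ exchanges the two central arguments; its vertices are thus of two kinds, pillows $\langle S\phi|S\phi\rangle$ and tetrahedra $\delta\langle S\phi|\mathcal TS\phi\rangle$. A vacuum graph of order $n$ consists of $n$ vertices with four half-lines each (one for each field $\phi$ of the vertex, in the order in which the fields are written), together with a perfect matching of the half-lines into lines. The amplitude ${\cal A}_G$ is the product of the factors $-\frac18$ (or $-\frac\delta8$ for a BFL tetrahedron) of the vertices and of the integral, over the six group variables of each vertex, of the product over the lines of the covariances $C_\Lambda$ between the arguments of the two fields joined by the line. **The graphs.** Number the half-lines of a vertex $0,1,2,3$ and the vertices $0,\dots,n-1$. For even $n\ge2$, let $G'_n$ be the Boulatov graph which is the closed chain of $n/2$ pairs of vertices: the vertices $2k$ and $2k+1$ are joined by three lines, from half-line $l$ to half-line $l$ for $l=1,2,3$, and the vertices $2k+1$ and $2k+2$ (modulo $n$) are joined by one line between their half-lines $0$. For $n\ge1$, let $G_n$ be the BFL graph which is the open chain of $n$ pillows: the half-lines $1$ and $3$ of each pillow are joined to the half-lines $0$ and $2$, respectively, of the next pillow; at the ends, the half-lines $0$ and $2$ of the first pillow are joined to each other, and so are the half-lines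 $1$ and $3$ of the last pillow. **Theorem.** The bounds $|{\cal A}^B_G|\le K^n\Lambda^{6+3n/2}$ and $|{\cal A}^{BFL}_G|\le K^n\Lambda^{6+3n}$ on connected vacuum graphs of order $n$ are optimal, in the following sense. The graphs $G'_n$ and $G_n$ are connected, and there are constants $k,K>0$, independent of $n$, $\Lambda$ and $\delta$, such that for all $\Lambda\ge1$ and all $\delta$ with $|\delta|\le 1$ $$k^n\Lambda^{6+3n/2}\le\bigl|{\cal A}^B_{G'_n}\bigr|\le K^n\Lambda^{6+3n/2}\quad\text{for all even } n\ge2,$$ $$k^n\Lambda^{6+3n}\le\bigl|{\cal A}^{BFL}_{G_n}\bigr|\le K^n\Lambda^{6+3n}\quad\text{for all } n\ge1.$$ -/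

import Mathlib

open MeasureTheory

namespace GFT

/-! ### The group SU(2) and its Haar measure -/

/-- The compact group `SU(2)`. -/
abbrev SU2 : Type := Matrix.specialUnitaryGroup (Fin 2) ℂ

instance instIsTopologicalGroupSU2 : IsTopologicalGroup SU2 where
  continuous_mul := by
    refine Continuous.subtype_mk ?_ _
    exact (continuous_subtype_val.comp continuous_fst).matrix_mul
      (continuous_subtype_val.comp continuous_snd)
  continuous_inv := by
    refine Continuous.subtype_mk ?_ _
    exact continuous_subtype_val.matrix_conjTranspose

instance instCompactSpaceSU2 : CompactSpace SU2 := by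
  refine (isCompact_iff_compactSpace
    (s := (Matrix.specialUnitaryGroup (Fin 2) ℂ : Set (Matrix (Fin 2) (Fin 2) ℂ)))).1 ?_
  have hK : IsCompact (Set.univ.pi fun _ : Fin 2 => Set.univ.pi fun _ : Fin 2 =>
      Metric.closedBall (0 : ℂ) 1) :=
    isCompact_univ_pi fun _ => isCompact_univ_pi fun _ => isCompact_closedBall 0 1
  have hc1 : Continuous fun A : Matrix (Fin 2) (Fin 2) ℂ => A * star A :=
    continuous_id.matrix_mul continuous_id.matrix_conjTranspose
  have hc2 : Continuous fun A : Matrix (Fin 2) (Fin 2) ℂ => A.det :=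
    continuous_id.matrix_det
  have hcl : IsClosed {A : Matrix (Fin 2) (Fin 2) ℂ | A * star A = 1 ∧ A.det = 1} :=
    (isClosed_eq hc1 continuous_const).inter (isClosed_eq hc2 continuous_const)
  refine IsCompact.of_isClosed_subset hK ?_ ?_
  · convert hcl using 1
    ext A
    simp only [SetLike.mem_coe, Matrix.mem_specialUnitaryGroup_iff, Matrix.mem_unitaryGroup_iff,
      Set.mem_ofPred_eq]
  · intro A hA i _ j _
    have h : A ∈ Matrix.unitaryGroup (Fin 2) ℂ := (Matrix.mem_specialUnitaryGroup_iff.1 hA).1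
    simpa using entry_norm_bound_of_unitary h i j

noncomputable instance instMeasurableSpaceSU2 : MeasurableSpace SU2 := borel SU2

instance instBorelSpaceSU2 : BorelSpace SU2 := ⟨rfl⟩

/-- The normalized Haar measure of `SU(2)`. -/
noncomputable def haar : Measure SU2 := Measure.haarMeasure ⊤

/-! ### Representations and the cutoff -/

/-- The matrix `D^j(g)` of the irreducible representation of `SU(2)` of spin `j = k / 2` (dimension
`k + 1`): `(D^j(g) p)(x, y) = p((x, y) g)` on homogeneous polynomials `p` of degree `k`, in the
basis `x ^ i * y ^ (k - i)`, `0 ≤ i ≤ k`. The polynomials are written with `x = X` and `y = 1`. -/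
noncomputable def spinMatrix (k : ℕ) (g : SU2) : Matrix (Fin (k + 1)) (Fin (k + 1)) ℂ :=
  Matrix.of fun i j =>
    ((Polynomial.C (g.1 0 0) * Polynomial.X + Polynomial.C (g.1 1 0)) ^ (j : ℕ) *
      (Polynomial.C (g.1 0 1) * Polynomial.X + Polynomial.C (g.1 1 1)) ^ (k - (j : ℕ))).coeff i

/-- The character of the representation of spin `k / 2`. -/
noncomputable def character (k : ℕ) (g : SU2) : ℂ := (spinMatrix k g).trace

/-- The Dirac distribution on `SU(2)` with ultraviolet cutoff `Λ`:
`δ_Λ(g) = ∑_{j ≤ Λ} (2j + 1) tr D^j(g)`, over the spins `j = k / 2 ∈ {0, 1/2, 1, …}`. -/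
noncomputable def cutoffDelta (Λ : ℝ) (g : SU2) : ℂ :=
  ∑ k ∈ Finset.range (⌊2 * Λ⌋₊ + 1), ((k : ℂ) + 1) * character k g

/-- The kernel `C_Λ(g; g')` of the covariance with cutoff: the operator
`(C φ)(g₁, g₂, g₃) = 1/3 ∑_c ∫ dh φ(g_{c(1)} h, g_{c(2)} h, g_{c(3)} h)`, with `c` running over the
cyclic permutations, composed with the orthogonal projection of `L²(SU(2)³)` onto the span of the
matrix coefficients of spins `j₁, j₂, j₃ ≤ Λ`. -/
noncomputable def covariance (Λ : ℝ) (g g' : Fin 3 → SU2) : ℂ :=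
  (1 / 3) * ∑ c : Fin 3, ∫ h : SU2, ∏ i : Fin 3, cutoffDelta Λ (g (i + c) * h * (g' i)⁻¹) ∂haar

/-! ### Vertices, vacuum graphs and amplitudes -/

/-- A quartic interaction `∫ dg₀ ⋯ dg₅ ∏_{l < 4} φ(g_{s l 0}, g_{s l 1}, g_{s l 2})` is recorded by
its pattern `s`: `s l i` is the variable in the `i`-th argument of the `l`-th field. -/
abbrev Pattern : Type := Fin 4 → Fin 3 → Fin 6

/-- Boulatov's interaction
`T[φ] = ∫ φ(g₁, g₂, g₃) φ(g₃, g₄, g₅) φ(g₅, g₂, g₆) φ(g₆, g₄, g₁)`. -/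
def boulatovPattern : Pattern := ![![0, 1, 2], ![2, 3, 4], ![4, 1, 5], ![5, 3, 0]]

/-- The pillow `⟨Sφ | Sφ⟩`, where `Sφ(g₁, g₂, g₃, g₄) = ∫ dg φ(g₁, g₂, g) φ(g, g₃, g₄)`. The four
fields are, in this order, the two of the first factor and the two of the second factor. -/
def pillowPattern : Pattern := ![![0, 1, 2], ![2, 3, 4], ![0, 1, 5], ![5, 3, 4]]

/-- The tetrahedral part `⟨Sφ | 𝒯 Sφ⟩`, where
`𝒯 Sφ(g₁, g₂, g₃, g₄) = Sφ(g₁, g₃, g₂, g₄)`. -/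
def transposedPattern : Pattern := ![![0, 1, 2], ![2, 3, 4], ![0, 3, 5], ![5, 1, 4]]

/-- A vacuum Feynman graph of order `n` whose vertices are of the kinds `κ`: `n` vertices with four
half-lines each, and a perfect matching of the half-lines into lines. -/
structure VacuumGraph (κ : Type) (n : ℕ) where
  /-- The kind of each vertex. -/
  kind : Fin n → κ
  /-- The other half-line of the line to which a half-line belongs. -/
  pair : Fin n × Fin 4 → Fin n × Fin 4
  pair_pair : ∀ x, pair (pair x) = x
  pair_ne : ∀ x, pair x ≠ x

namespace VacuumGraph

variable {κ : Type} {n : ℕ}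

/-- The graph is nonempty and any two vertices are joined by a path of lines. -/
def IsConnected (G : VacuumGraph κ n) : Prop :=
  (SimpleGraph.fromRel fun v w : Fin n => ∃ i j : Fin 4, G.pair (v, i) = (w, j)).Connected

/-- The lines of the graph, each represented by its half-line that comes first in the
lexicographic order. The kernel of the covariance is symmetric, so that the choice is immaterial. -/
def lines (G : VacuumGraph κ n) : Finset (Fin n × Fin 4) :=
  Finset.univ.filter fun x => toLex x < toLex (G.pair x)

/-- The amplitude of a graph (without the power of the coupling constant): a factor `w` for each
vertex, the six group variables of each vertex integrated over, and a covariance for each line. -/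
noncomputable def amplitude (w : κ → ℝ) (s : κ → Pattern) (Λ : ℝ) (G : VacuumGraph κ n) : ℂ :=
  (∏ v : Fin n, (w (G.kind v) : ℂ)) *
    ∫ g : Fin n → Fin 6 → SU2,
      ∏ x ∈ G.lines, covariance Λ
        (fun i => g x.1 (s (G.kind x.1) x.2 i))
        (fun i => g (G.pair x).1 (s (G.kind (G.pair x).1) (G.pair x).2 i))
      ∂(Measure.pi fun _ : Fin n => Measure.pi fun _ : Fin 6 => haar)

end VacuumGraph

/-- The vacuum graphs of the Boulatov model, with interaction `λ/8 T[φ]`. -/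
abbrev BoulatovGraph (n : ℕ) : Type := VacuumGraph Unit n

/-- The amplitude of a vacuum graph of the Boulatov model. -/
noncomputable def boulatovAmplitude {n : ℕ} (Λ : ℝ) (G : BoulatovGraph n) : ℂ :=
  G.amplitude (fun _ => -(1 / 8)) (fun _ => boulatovPattern) Λ

/-- The two kinds of vertices of the Boulatov-Freidel-Louapre model. -/
inductive BFLVertex : Type
  | pillow
  | tetrahedron

/-- The factor of a vertex: the interaction is `λ/8 (⟨Sφ | Sφ⟩ + δ ⟨Sφ | 𝒯 Sφ⟩)`. -/
noncomputable def BFLVertex.weight (δ : ℝ) : BFLVertex → ℝ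
  | pillow => -(1 / 8)
  | tetrahedron => -(δ / 8)

/-- The pattern of a vertex. -/
def BFLVertex.pattern : BFLVertex → Pattern
  | pillow => pillowPattern
  | tetrahedron => transposedPattern

/-- The vacuum graphs of the Boulatov-Freidel-Louapre model. -/
abbrev BFLGraph (n : ℕ) : Type := VacuumGraph BFLVertex n

/-- The amplitude of a vacuum graph of the Boulatov-Freidel-Louapre model. -/
noncomputable def bflAmplitude {n : ℕ} (δ Λ : ℝ) (G : BFLGraph n) : ℂ :=
  G.amplitude (BFLVertex.weight δ) BFLVertex.pattern Λ

/-! ### The chains -/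

/-- For even `n` the cyclic shift of `Fin n` exchanges the even and the odd numbers. -/
theorem finRotate_parity (n : ℕ) (hn : Even n) (v : Fin n) :
    (finRotate n v : ℕ) % 2 = 0 ↔ ¬ (v : ℕ) % 2 = 0 := by
  obtain ⟨m, hm⟩ := hn
  rcases n with _ | n
  · exact v.elim0
  · rw [coe_finRotate]
    split_ifs with h
    · have hv : (v : ℕ) = n := by rw [h, Fin.val_last]
      rw [hv]
      omega
    · omega

/-- The closed chain of `m` pairs of vertices, of order `n = 2 m`: the vertices `2 k` and `2 k + 1`
are joined by three lines, from the half-line `l` to the half-line `l` for `l = 1, 2, 3`, and the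
vertices `2 k + 1` and `2 k + 2` (modulo `n`) by one line, from the half-line `0` to the
half-line `0`. -/
def boulatovChain (n : ℕ) (hn : Even n) : BoulatovGraph n where
  kind _ := ()
  pair x :=
    (if (x.1 : ℕ) % 2 = 0 ↔ x.2 ≠ 0 then finRotate n x.1 else (finRotate n).symm x.1, x.2)
  pair_pair := by
    have hpar := finRotate_parity n hn
    have hpar' : ∀ v : Fin n, ((finRotate n).symm v : ℕ) % 2 = 0 ↔ ¬ (v : ℕ) % 2 = 0 := by
      intro v
      have h := hpar ((finRotate n).symm v)
      rw [Equiv.apply_symm_apply] at h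
      tauto
    rintro ⟨v, l⟩
    have h1 := hpar v
    have h2 := hpar' v
    by_cases h : ((v : ℕ) % 2 = 0 ↔ l ≠ 0)
    · have h3 : ¬ ((finRotate n v : ℕ) % 2 = 0 ↔ l ≠ 0) := by tauto
      simp only [if_pos h, if_neg h3, Equiv.symm_apply_apply]
    · have h3 : ((finRotate n).symm v : ℕ) % 2 = 0 ↔ l ≠ 0 := by tauto
      simp only [if_neg h, if_pos h3, Equiv.apply_symm_apply]
  pair_ne := by
    have hpar := finRotate_parity n hn
    rintro ⟨v, l⟩ h
    have h1 := hpar v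
    have h2 := hpar ((finRotate n).symm v)
    rw [Equiv.apply_symm_apply] at h2
    have h0 := congrArg Prod.fst h
    dsimp only at h0
    split_ifs at h0
    · rw [h0] at h1
      tauto
    · rw [h0] at h2
      tauto

/-- The open chain of `n` pillows: each pillow is joined to the next one by two lines, from the
fields `1` and `3` (which share two variables) to the fields `0` and `2` (which share two
variables). At the two ends of the chain the remaining pairs of fields, `0` and `2` of the first
pillow and `1` and `3` of the last one, are joined by one line each. -/
def bflChain (n : ℕ) : BFLGraph n where
  kind _ := BFLVertex.pillow
  pair x :=
    if x.2 = 1 ∨ x.2 = 3 then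
      if h : (x.1 : ℕ) + 1 < n then (⟨x.1 + 1, h⟩, x.2 - 1) else (x.1, x.2 + 2)
    else
      if 0 < (x.1 : ℕ) then (⟨x.1 - 1, by omega⟩, x.2 + 1) else (x.1, x.2 + 2)
  pair_pair := by
    rintro ⟨⟨v, hv⟩, l⟩
    fin_cases l <;> by_cases h : v + 1 < n <;> by_cases h' : 0 < v <;>
      simp [h, h', Nat.sub_add_cancel, Nat.succ_le_of_lt, hv]
  pair_ne := by
    rintro ⟨⟨v, hv⟩, l⟩
    fin_cases l <;> by_cases h : v + 1 < n <;> by_cases h' : 0 < v <;>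
      simp [h, h']

end GFT

/-!
The covariance is, for each spin window `S`, a symmetric idempotent kernel on `SU(2)³` (Schur
orthogonality), so that it is the kernel of the projection onto a finite-dimensional space of
functions, with an orthonormal basis `F` (`exists_covarianceBasis`). Inserting
`C(g, g') = ∑ α, F α g * F α g'` in every line turns an amplitude into the contraction of a tensor
network (`VacuumGraph.amplitude_eq`), and along the chains this contraction is a power of a
symmetric positive semidefinite matrix. With `D = δ_Λ(1)`, of order `Λ³`, and `d` the dimension of
the basis,

* the Boulatov chain of order `2 M` has the amplitude `8 ^ (-2 M) * tr X ^ M`, where `X` is the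
  operator of two vertices joined by three lines (`norm_boulatovAmplitude_chain`);
* the chain of `n` pillows has the amplitude `± 8 ^ (-n) * ⟨u, Y ^ n u⟩`, where `Y` is a single
  pillow and `u`, with `⟨u, u⟩ = d`, joins two half-lines (`norm_bflAmplitude_chain`).

Upper bounds. Both matrices are at most `D`: after the Cauchy-Schwarz inequality, identifying two
arguments of the fields is free once for each field, since the fields are invariant under right
translations, and costs a factor `D` the next time, since they are band-limited
(`dotProduct_doubleVertexMatrix_mulVec_le`, `dotProduct_pillowMatrix_mulVec_le`). Moreover
`d ≤ D ^ 2`, because `d` is the integral of `C(g, g)` and `|C| ≤ D ^ 2`.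

Lower bounds. By the power mean inequalities `tr X ^ M ≥ (tr X) ^ M / d ^ (M - 1)` and
`⟨u, Y ^ n u⟩ ≥ ⟨u, Y u⟩ ^ n / d ^ (n - 1)`, it is enough to bound `tr X`, `d` and `⟨u, Y u⟩` from
below. One has `d ≥ tr X / D`, and `⟨u, Y u⟩ ≥ d ^ 2 / D` by the Cauchy-Schwarz inequality
(`sq_card_le_dotProduct_pillowMatrix`). The main point is `tr X ≥ c Λ ^ 9`. This trace is the
square norm of the vertex tensor, and it is bounded from below by testing the tensor against the
same vertex with its six spins restricted to pairwise disjoint windows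
(`vertexOverlap_le_trace`): the disjointness removes the cyclic permutations in the covariance. What
remains is the integral of six windowed delta functions along the edges of a tetrahedron over the
group elements at its vertices. The windows have a length of order `Λ` and are chosen such that one
of them contains all the spins that the Clebsch-Gordan rule allows, and the integral is then
computed in closed form (`vertexOverlap_zero_eq`), from the Clebsch-Gordan rule for characters and their
convolution.
-/

namespace GFT

/-! ### Symmetric powers and characters -/

open Polynomial in
/-- The column polynomials of the `k`-th symmetric power of `M`, as in `spinMatrix`. -/
noncomputable def symPowerColumn (k : ℕ) (M : Matrix (Fin 2) (Fin 2) ℂ) (j : ℕ) : ℂ[X] :=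
  (C (M 0 0) * X + C (M 1 0)) ^ j * (C (M 0 1) * X + C (M 1 1)) ^ (k - j)

/-- The `k`-th symmetric power of a `2 × 2` matrix, in the monomial basis; `spinMatrix` is its
restriction to `SU(2)`. -/
noncomputable def symPower (k : ℕ) (M : Matrix (Fin 2) (Fin 2) ℂ) :
    Matrix (Fin (k + 1)) (Fin (k + 1)) ℂ :=
  Matrix.of fun i j => (symPowerColumn k M j).coeff i

theorem spinMatrix_eq_symPower (k : ℕ) (g : SU2) : spinMatrix k g = symPower k g.1 := rfl

open Polynomial in
theorem natDegree_linear_pow_le (a b : ℂ) (j : ℕ) :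
    ((C a * X + C b) ^ j : ℂ[X]).natDegree ≤ j := by
  refine natDegree_pow_le.trans ?_
  have := natDegree_linear_le (a := a) (b := b)
  nlinarith

open Polynomial in
/-- Homogenization of a polynomial of degree at most `m`, evaluated at `(A, B)`. -/
noncomputable def homogEval (A B : ℂ[X]) (m : ℕ) (p : ℂ[X]) : ℂ[X] :=
  ∑ l ∈ Finset.range (m + 1), C (p.coeff l) * (A ^ l * B ^ (m - l))

theorem sum_homog_mul_linear {R : Type*} [CommRing R] (A B a b : R) (c : ℕ → R) (m : ℕ)
    (hc : c (m + 1) = 0) :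
    ∑ l ∈ Finset.range (m + 1), (a * c l + b * c (l + 1)) * (A ^ (l + 1) * B ^ (m + 1 - (l + 1)))
      + b * c 0 * (A ^ 0 * B ^ (m + 1 - 0))
      = (a * A + b * B) * ∑ l ∈ Finset.range (m + 1), c l * (A ^ l * B ^ (m - l)) := by
  have e1 : ∑ l ∈ Finset.range (m + 1), b * c (l + 1) * (A ^ (l + 1) * B ^ (m + 1 - (l + 1)))
      + b * c 0 * (A ^ 0 * B ^ (m + 1 - 0))
      = b * B * ∑ l ∈ Finset.range (m + 1), c l * (A ^ l * B ^ (m - l)) := by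
    rw [Finset.sum_range_succ, hc, Finset.sum_range_succ' _ m, mul_add, Finset.mul_sum]
    simp only [mul_zero, zero_mul, add_zero, Nat.sub_zero]
    congr 1
    · refine Finset.sum_congr rfl fun l hl => ?_
      rw [show m + 1 - (l + 1) = m - (l + 1) + 1 by have := Finset.mem_range.1 hl; omega, pow_succ]
      ring
    · rw [pow_succ]; ring
  rw [add_mul, ← e1, ← add_assoc, Finset.mul_sum, ← Finset.sum_add_distrib]
  congr 1
  refine Finset.sum_congr rfl fun l _ => ?_
  rw [Nat.add_sub_add_right, pow_succ]
  ring

open Polynomial in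
theorem homogEval_mul_linear (A B : ℂ[X]) (m : ℕ) (p : ℂ[X]) (hp : p.natDegree ≤ m) (a b : ℂ) :
    homogEval A B (m + 1) ((C a * X + C b) * p) = (C a * A + C b * B) * homogEval A B m p := by
  have h0 : p.coeff (m + 1) = 0 := coeff_eq_zero_of_natDegree_lt (by omega)
  have hc : ∀ l, ((C a * X + C b) * p).coeff (l + 1) = a * p.coeff l + b * p.coeff (l + 1) := by
    intro l
    rw [add_mul, mul_assoc, coeff_add, coeff_C_mul, coeff_X_mul, coeff_C_mul]
  have hc0 : ((C a * X + C b) * p).coeff 0 = b * p.coeff 0 := by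
    simp [add_mul, mul_assoc]
  have h := sum_homog_mul_linear A B (C a) (C b) (fun l => C (p.coeff l)) m (by simp [h0])
  unfold homogEval
  rw [Finset.sum_range_succ', hc0]
  simp only [hc]
  simp only [C_add, C_mul]
  exact h

open Polynomial in
theorem homogEval_mul_linear_pow (A B : ℂ[X]) (m : ℕ) (p : ℂ[X]) (hp : p.natDegree ≤ m) (a b : ℂ)
    (j : ℕ) : homogEval A B (j + m) ((C a * X + C b) ^ j * p)
      = (C a * A + C b * B) ^ j * homogEval A B m p := by
  induction j with
  | zero => simp
  | succ j ih =>
    have hd : ((C a * X + C b) ^ j * p).natDegree ≤ j + m :=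
      natDegree_mul_le.trans (add_le_add (natDegree_linear_pow_le a b j) hp)
    rw [show j + 1 + m = j + m + 1 by ring, pow_succ', mul_assoc, homogEval_mul_linear _ _ _ _ hd,
      ih, pow_succ', mul_assoc]

open Polynomial in
theorem homogEval_symPowerColumn (A B : ℂ[X]) (k : ℕ) (M : Matrix (Fin 2) (Fin 2) ℂ) (j : ℕ)
    (hj : j ≤ k) : homogEval A B k (symPowerColumn k M j)
      = (C (M 0 0) * A + C (M 1 0) * B) ^ j * (C (M 0 1) * A + C (M 1 1) * B) ^ (k - j) := by
  have h1 : homogEval A B 0 1 = 1 := by simp [homogEval]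
  have h2 := homogEval_mul_linear_pow A B 0 1 (by simp) (M 0 1) (M 1 1) (k - j)
  have h3 := homogEval_mul_linear_pow A B (k - j) _ (natDegree_linear_pow_le (M 0 1) (M 1 1) (k - j))
    (M 0 0) (M 1 0) j
  rw [add_zero, mul_one, h1, mul_one] at h2
  rw [Nat.add_sub_cancel' hj, h2] at h3
  exact h3

open Polynomial in
/-- The product is computed column by column, by substituting linear forms for the variables of the
homogenized column polynomials. -/
theorem symPower_mul (k : ℕ) (M N : Matrix (Fin 2) (Fin 2) ℂ) :
    symPower k (M * N) = symPower k M * symPower k N := by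
  ext i j
  have hj : (j : ℕ) ≤ k := Nat.lt_succ_iff.1 j.2
  have h := homogEval_symPowerColumn (C (M 0 0) * X + C (M 1 0)) (C (M 0 1) * X + C (M 1 1)) k N j hj
  have h2 : symPowerColumn k (M * N) j = homogEval (C (M 0 0) * X + C (M 1 0))
      (C (M 0 1) * X + C (M 1 1)) k (symPowerColumn k N j) := by
    rw [h]
    simp only [symPowerColumn, Matrix.mul_apply, Fin.sum_univ_two, C_add, C_mul]
    congr 2 <;> ring
  rw [Matrix.mul_apply]
  simp only [symPower, Matrix.of_apply]
  rw [h2, homogEval, finsetSum_coeff, Finset.sum_range]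
  refine Finset.sum_congr rfl fun l _ => ?_
  rw [coeff_C_mul, mul_comm]; rfl

open Polynomial in
theorem symPower_triangular_diag (k : ℕ) (M : Matrix (Fin 2) (Fin 2) ℂ) (h : M 1 0 = 0)
    (j : Fin (k + 1)) : symPower k M j j = M 0 0 ^ (j : ℕ) * M 1 1 ^ (k - (j : ℕ)) := by
  simp only [symPower, symPowerColumn, Matrix.of_apply, h, map_zero, add_zero, mul_pow]
  rw [← C_pow, mul_assoc, coeff_C_mul, coeff_X_pow_mul', if_pos le_rfl, Nat.sub_self,
    coeff_zero_eq_eval_zero]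
  simp

theorem symPower_one (k : ℕ) : symPower k 1 = 1 := by
  ext i j
  simp only [symPower, symPowerColumn, Matrix.of_apply]
  simp [Polynomial.coeff_X_pow, Matrix.one_apply, Fin.ext_iff]

theorem symPower_diagonal (k : ℕ) (z w : ℂ) :
    symPower k !![z, 0; 0, w]
      = Matrix.diagonal fun j : Fin (k + 1) => z ^ (j : ℕ) * w ^ (k - (j : ℕ)) := by
  ext i j
  have h : symPowerColumn k !![z, 0; 0, w] j
      = Polynomial.C (z ^ (j : ℕ) * w ^ (k - (j : ℕ))) * Polynomial.X ^ (j : ℕ) := by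
    simp [symPowerColumn, mul_pow]
    ring
  rw [symPower, Matrix.of_apply, h, Polynomial.coeff_C_mul, Polynomial.coeff_X_pow,
    Matrix.diagonal_apply]
  by_cases hij : i = j
  · simp [hij]
  · simp [hij, Fin.val_inj]

theorem symPower_zero_row (k : ℕ) (M : Matrix (Fin 2) (Fin 2) ℂ) (j : Fin (k + 1)) :
    symPower k M 0 j = M 1 0 ^ (j : ℕ) * M 1 1 ^ (k - (j : ℕ)) := by
  simp [symPower, symPowerColumn, Polynomial.coeff_zero_eq_eval_zero]

/-- Over `ℂ` every `2 × 2` matrix is similar to an upper triangular one. -/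
theorem exists_similar_triangular (M : Matrix (Fin 2) (Fin 2) ℂ) :
    ∃ P Q : Matrix (Fin 2) (Fin 2) ℂ, P * Q = 1 ∧ Q * P = 1 ∧ (Q * M * P) 1 0 = 0 := by
  by_cases h : M 1 0 = 0
  · exact ⟨1, 1, by simp, by simp, by simpa using h⟩
  · obtain ⟨s, hs⟩ := IsAlgClosed.exists_pow_nat_eq
      ((M 1 1 - M 0 0) ^ 2 + 4 * M 1 0 * M 0 1) (n := 2) (by norm_num)
    -- `(p, 1)` is an eigenvector
    obtain ⟨p, hp⟩ : ∃ p : ℂ, M 1 0 * p ^ 2 + (M 1 1 - M 0 0) * p - M 0 1 = 0 := by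
      refine ⟨(-(M 1 1 - M 0 0) + s) / (2 * M 1 0), ?_⟩
      field_simp
      linear_combination hs
    refine ⟨!![p, -1; 1, 0], !![0, 1; -1, p], ?_, ?_, ?_⟩
    · ext i j; fin_cases i <;> fin_cases j <;> simp
    · ext i j; fin_cases i <;> fin_cases j <;> simp
    · simp [Matrix.mul_apply, Fin.sum_univ_two, Matrix.vecMul, dotProduct]
      linear_combination hp

theorem trace_symPower_conj (k : ℕ) (P Q M : Matrix (Fin 2) (Fin 2) ℂ) (h : P * Q = 1) :
    (symPower k (Q * M * P)).trace = (symPower k M).trace := by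
  rw [symPower_mul, Matrix.trace_mul_comm, ← symPower_mul, ← mul_assoc, h, one_mul]

theorem trace_symPower_triangular (k : ℕ) (M : Matrix (Fin 2) (Fin 2) ℂ) (h : M 1 0 = 0) :
    (symPower k M).trace = ∑ j ∈ Finset.range (k + 1), M 0 0 ^ j * M 1 1 ^ (k - j) := by
  rw [Matrix.trace, Finset.sum_range]
  exact Finset.sum_congr rfl fun j _ => symPower_triangular_diag k M h j

/-- The traces of the symmetric powers satisfy the recurrence of the Chebyshev polynomials. -/
theorem trace_symPower_succ_succ (k : ℕ) (M : Matrix (Fin 2) (Fin 2) ℂ) (hM : M.det = 1) :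
    (symPower (k + 2) M).trace = M.trace * (symPower (k + 1) M).trace - (symPower k M).trace := by
  obtain ⟨P, Q, hPQ, hQP, h⟩ := exists_similar_triangular M
  have hdet : (Q * M * P).det = 1 := by
    rw [Matrix.det_mul, Matrix.det_mul, hM, mul_one, ← Matrix.det_mul, hQP, Matrix.det_one]
  have htr : (Q * M * P).trace = M.trace := by
    rw [Matrix.trace_mul_comm, ← mul_assoc, hPQ, one_mul]
  rw [← trace_symPower_conj k P Q M hPQ, ← trace_symPower_conj (k + 1) P Q M hPQ,
    ← trace_symPower_conj (k + 2) P Q M hPQ, ← htr]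
  generalize Q * M * P = T at h hdet
  rw [trace_symPower_triangular _ _ h, trace_symPower_triangular _ _ h,
    trace_symPower_triangular _ _ h, Matrix.trace_fin_two]
  rw [Matrix.det_fin_two, h, mul_zero, sub_zero] at hdet
  generalize T 0 0 = z at hdet
  generalize T 1 1 = w at hdet
  have hs : ∀ k, ∑ j ∈ Finset.range (k + 2), z ^ j * w ^ (k + 1 - j)
      = w ^ (k + 1) + z * ∑ j ∈ Finset.range (k + 1), z ^ j * w ^ (k - j) := by
    intro k
    rw [Finset.sum_range_succ', Finset.mul_sum, add_comm]
    congr 1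
    · simp
    · refine Finset.sum_congr rfl fun l _ => ?_
      rw [Nat.add_sub_add_right, pow_succ]; ring
  have h1 := hs k
  have h2 := hs (k + 1)
  rw [h2, h1]
  linear_combination (-(∑ j ∈ Finset.range (k + 1), z ^ j * w ^ (k - j))) * hdet

theorem character_zero (g : SU2) : character 0 g = 1 := by
  simp [character, spinMatrix, Matrix.trace]

theorem character_one (g : SU2) : character 1 g = g.1.trace := by
  simp [character, spinMatrix, Matrix.trace, Fin.sum_univ_two, add_comm]

theorem SU2.det_eq_one (g : SU2) : g.1.det = 1 :=
  (Matrix.mem_specialUnitaryGroup_iff.1 g.2).2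

theorem character_succ_succ (k : ℕ) (g : SU2) :
    character (k + 2) g = g.1.trace * character (k + 1) g - character k g :=
  trace_symPower_succ_succ k g.1 g.det_eq_one

theorem SU2.trace_inv (g : SU2) : (g⁻¹).1.trace = g.1.trace := by
  have h1 : (g⁻¹).1 * g.1 = 1 := by
    rw [← Submonoid.coe_mul, inv_mul_cancel]; rfl
  have h2 : (g⁻¹).1 = g.1.adjugate := by
    have := Matrix.mul_adjugate g.1
    rw [g.det_eq_one, one_smul] at this
    calc (g⁻¹).1 = (g⁻¹).1 * (g.1 * g.1.adjugate) := by rw [this, mul_one]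
      _ = g.1.adjugate := by rw [← mul_assoc, h1, one_mul]
  rw [h2, Matrix.adjugate_fin_two, Matrix.trace_fin_two, Matrix.trace_fin_two]
  simp [add_comm]

theorem SU2.trace_im (g : SU2) : g.1.trace.im = 0 := by
  have h : (g⁻¹).1 = star g.1 := rfl
  have h2 := g.trace_inv
  rw [h, Matrix.star_eq_conjTranspose, Matrix.trace_conjTranspose] at h2
  exact Complex.conj_eq_iff_im.1 h2

/-- The character of spin `k / 2` as a real function. -/
noncomputable def realCharacter (k : ℕ) (g : SU2) : ℝ := (character k g).re

theorem character_eq_ofReal (k : ℕ) (g : SU2) : character k g = (realCharacter k g : ℂ) := by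
  suffices h : (character k g).im = 0 ∧ (character (k + 1) g).im = 0 from
    Complex.ext rfl (by simp [h.1])
  induction k with
  | zero => simp [character_zero, character_one, g.trace_im]
  | succ k ih => exact ⟨ih.2, by simp [character_succ_succ, ih.1, ih.2, g.trace_im]⟩

theorem realCharacter_zero (g : SU2) : realCharacter 0 g = 1 := by
  simp [realCharacter, character_zero]

theorem realCharacter_one (g : SU2) : realCharacter 1 g = g.1.trace.re := by
  simp [realCharacter, character_one]

theorem realCharacter_succ_succ (k : ℕ) (g : SU2) :
    realCharacter (k + 2) g
      = realCharacter 1 g * realCharacter (k + 1) g - realCharacter k g := by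
  have := character_succ_succ k g
  rw [← character_one] at this
  simp only [character_eq_ofReal] at this
  exact_mod_cast this

/-- Characters depend only on the trace. -/
theorem realCharacter_congr (k : ℕ) {g h : SU2} (hgh : g.1.trace = h.1.trace) :
    realCharacter k g = realCharacter k h := by
  suffices H : realCharacter k g = realCharacter k h
      ∧ realCharacter (k + 1) g = realCharacter (k + 1) h from H.1
  induction k with
  | zero => simp [realCharacter_zero, realCharacter_one, hgh]
  | succ k ih =>
    exact ⟨ih.2, by
      rw [realCharacter_succ_succ, realCharacter_succ_succ, ih.1, ih.2, realCharacter_one,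
        realCharacter_one, hgh]⟩

theorem realCharacter_inv (k : ℕ) (g : SU2) : realCharacter k g⁻¹ = realCharacter k g :=
  realCharacter_congr k g.trace_inv

theorem realCharacter_mul_comm (k : ℕ) (g h : SU2) :
    realCharacter k (g * h) = realCharacter k (h * g) :=
  realCharacter_congr k (by rw [Submonoid.coe_mul, Submonoid.coe_mul, Matrix.trace_mul_comm])

theorem realCharacter_apply_one (k : ℕ) : realCharacter k 1 = k + 1 := by
  have h : spinMatrix k 1 = 1 := symPower_one k
  simp [realCharacter, character, h]

theorem continuous_realCharacter (k : ℕ) : Continuous (realCharacter k) := by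
  suffices H : Continuous (realCharacter k) ∧ Continuous (realCharacter (k + 1)) from H.1
  have h1 : Continuous (realCharacter 1) := by
    simp only [funext realCharacter_one]
    exact Complex.continuous_re.comp (continuous_subtype_val.matrix_trace)
  induction k with
  | zero => exact ⟨by simp only [funext realCharacter_zero]; fun_prop, h1⟩
  | succ k ih =>
    exact ⟨ih.2, by simp only [funext (realCharacter_succ_succ k)]; exact (h1.mul ih.2).sub ih.1⟩

/-- The Clebsch-Gordan rule for characters. -/
theorem realCharacter_mul (a b : ℕ) (g : SU2) :
    realCharacter (a + b) g * realCharacter b g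
      = ∑ i ∈ Finset.range (b + 1), realCharacter (a + 2 * i) g := by
  have key : ∀ b, (∀ a, realCharacter (a + b) g * realCharacter b g
      = ∑ i ∈ Finset.range (b + 1), realCharacter (a + 2 * i) g) ∧
      (∀ a, realCharacter (a + (b + 1)) g * realCharacter (b + 1) g
      = ∑ i ∈ Finset.range (b + 2), realCharacter (a + 2 * i) g) := by
    intro b
    -- the Chebyshev recurrence, which calls for an induction with two hypotheses
    have hrec : ∀ k, realCharacter 1 g * realCharacter (k + 1) g
        = realCharacter (k + 2) g + realCharacter k g := by
      intro k; rw [realCharacter_succ_succ]; ring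
    induction b with
    | zero =>
      refine ⟨fun a => by simp [realCharacter_zero], fun a => ?_⟩
      simp only [Finset.sum_range_succ, Finset.sum_range_zero, zero_add, mul_zero, add_zero, mul_one]
      rw [mul_comm, hrec, add_comm]
    | succ b ih =>
      refine ⟨ih.2, fun a => ?_⟩
      have h1 := ih.2 (a + 1)
      have h2 := ih.1 (a + 2)
      rw [show a + 1 + (b + 1) = a + (b + 1 + 1) by ring] at h1
      rw [show a + 2 + b = a + (b + 1 + 1) by ring] at h2
      rw [show b + 1 + 1 = b + 2 by ring] at *
      rw [realCharacter_succ_succ b, mul_sub, h2, mul_left_comm, h1, Finset.mul_sum]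
      have h3 : ∀ i, realCharacter 1 g * realCharacter (a + 1 + 2 * i) g
          = realCharacter (a + 2 * (i + 1)) g + realCharacter (a + 2 * i) g := by
        intro i
        rw [show a + 1 + 2 * i = a + 2 * i + 1 by ring, hrec]
        congr 2
      simp only [h3, Finset.sum_add_distrib]
      rw [Finset.sum_range_succ (fun i => realCharacter (a + 2 * (i + 1)) g) (b + 1),
        Finset.sum_range_succ (fun i => realCharacter (a + 2 * i) g) (b + 2)]
      have h4 : ∀ i, realCharacter (a + 2 + 2 * i) g = realCharacter (a + 2 * (i + 1)) g := by
        intro i; congr 1; ring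
      simp only [h4]
      rw [show b + 1 + 1 = b + 2 by ring]
      ring
  exact (key b).1 a

/-! ### Haar measure and integrals of continuous functions on compact spaces -/

instance instSecondCountableTopologySU2 : SecondCountableTopology SU2 :=
  haveI : SecondCountableTopology (Matrix (Fin 2) (Fin 2) ℂ) :=
    inferInstanceAs (SecondCountableTopology (Fin 2 → Fin 2 → ℂ))
  TopologicalSpace.Subtype.secondCountableTopology _

instance instIsHaarMeasureHaar : haar.IsHaarMeasure := by unfold haar; infer_instance

instance instIsProbabilityMeasureHaar : IsProbabilityMeasure haar :=
  ⟨by unfold haar; simpa using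
    Measure.haarMeasure_self (K₀ := (⊤ : TopologicalSpace.PositiveCompacts SU2))⟩

instance instIsMulRightInvariantHaar : haar.IsMulRightInvariant where
  map_mul_right_eq_self g := by
    have : IsProbabilityMeasure (haar.map (· * g)) :=
      Measure.isProbabilityMeasure_map (measurable_mul_const g).aemeasurable
    exact Measure.isHaarMeasure_eq_of_isProbabilityMeasure _ _

instance instIsInvInvariantHaar : haar.IsInvInvariant where
  inv_eq_self := by
    have : IsProbabilityMeasure haar.inv :=
      Measure.isProbabilityMeasure_map measurable_inv.aemeasurable
    have : haar.inv.IsHaarMeasure := by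
      refine Measure.isHaarMeasure_of_isCompact_nonempty_interior _ Set.univ isCompact_univ ?_ ?_ ?_
      · simp
      · simp
      · simp
    exact Measure.isHaarMeasure_eq_of_isProbabilityMeasure _ _

section Tools

variable {X : Type*} [TopologicalSpace X] [CompactSpace X] [SecondCountableTopology X]
  [MeasurableSpace X] [BorelSpace X] {μ : Measure X} [IsFiniteMeasure μ]
  {Y : Type*} [TopologicalSpace Y] [CompactSpace Y]
  [SecondCountableTopology Y] [MeasurableSpace Y] [BorelSpace Y]
  {ν : Measure Y} [IsFiniteMeasure ν]
  {E : Type*} [NormedAddCommGroup E] [NormedSpace ℝ E]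

omit [SecondCountableTopology X] [NormedSpace ℝ E] in
theorem integrable_of_continuous {f : X → E} (hf : Continuous f) : Integrable f μ :=
  hf.integrable_of_hasCompactSupport (HasCompactSupport.of_compactSpace f)

theorem integral_swap {f : X → Y → E} (hf : Continuous fun p : X × Y => f p.1 p.2) :
    ∫ x, ∫ y, f x y ∂ν ∂μ = ∫ y, ∫ x, f x y ∂μ ∂ν :=
  integral_integral_swap (integrable_of_continuous (μ := μ.prod ν) hf)

theorem continuous_integral_of_continuous {Z : Type*} [TopologicalSpace Z]
    [FirstCountableTopology Z] [LocallyCompactSpace Z] {f : Z → Y → E}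
    (hf : Continuous fun p : Z × Y => f p.1 p.2) : Continuous fun z => ∫ y, f z y ∂ν := by
  have h := continuous_parametric_integral_of_continuous (μ := ν) (f := f) hf
    (s := Set.univ) isCompact_univ
  simpa using h

omit [SecondCountableTopology X] in
/-- The Cauchy-Schwarz inequality. -/
theorem sq_integral_mul_le {f g : X → ℝ} (hf : Continuous f) (hg : Continuous g) :
    (∫ x, f x * g x ∂μ) ^ 2 ≤ (∫ x, f x ^ 2 ∂μ) * ∫ x, g x ^ 2 ∂μ := by
  have h : ∀ t : ℝ, 0 ≤ (∫ x, f x ^ 2 ∂μ) * (t * t) + (-2 * ∫ x, f x * g x ∂μ) * t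
      + ∫ x, g x ^ 2 ∂μ := by
    intro t
    have h0 : 0 ≤ ∫ x, (t * f x - g x) ^ 2 ∂μ := integral_nonneg fun x => sq_nonneg _
    have h1 : ∫ x, (t * f x - g x) ^ 2 ∂μ
        = ∫ x, ((t * t) * f x ^ 2 + ((-2 * t) * (f x * g x) + g x ^ 2)) ∂μ := by
      congr 1; ext x; ring
    rw [h1, integral_add (integrable_of_continuous (by fun_prop))
      (integrable_of_continuous (by fun_prop)), integral_add
      (integrable_of_continuous (by fun_prop)) (integrable_of_continuous (by fun_prop)),
      integral_const_mul, integral_const_mul] at h0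
    linarith
  have := discrim_le_zero h
  unfold discrim at this
  nlinarith

omit [SecondCountableTopology X] in
theorem sq_integral_le [IsProbabilityMeasure μ] {f : X → ℝ} (hf : Continuous f) :
    (∫ x, f x ∂μ) ^ 2 ≤ ∫ x, f x ^ 2 ∂μ := by
  simpa using sq_integral_mul_le (μ := μ) hf (continuous_const (y := (1 : ℝ)))

end Tools

/-- Haar measure on a power of `SU(2)`. -/
noncomputable abbrev haarPow (ι : Type*) [Fintype ι] : Measure (ι → SU2) :=
  Measure.pi fun _ => haar

theorem integral_haarPow_succ {n : ℕ} {E : Type*} [NormedAddCommGroup E] [NormedSpace ℝ E]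
    {f : (Fin (n + 1) → SU2) → E} (hf : Continuous f) :
    ∫ g, f g ∂haarPow (Fin (n + 1)) = ∫ x, ∫ g, f (Fin.cons x g) ∂haarPow (Fin n) ∂haar := by
  have h := measurePreserving_piFinSuccAbove (fun _ : Fin (n + 1) => haar) 0
  have h2 := h.symm.integral_comp (MeasurableEquiv.measurableEmbedding _) f
  have h3 : ∀ p : SU2 × (Fin n → SU2),
      (MeasurableEquiv.piFinSuccAbove (fun _ => SU2) 0).symm p = Fin.cons p.1 p.2 :=
    fun p => Fin.insertNth_zero' p.1 p.2
  have h4 : Continuous fun p : SU2 × (Fin n → SU2) => (Fin.cons p.1 p.2 : Fin (n + 1) → SU2) :=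
    Continuous.finCons continuous_fst continuous_snd
  simp only [h3] at h2
  have h5 := integrable_of_continuous (μ := haar.prod (haarPow (Fin n))) (hf.comp h4)
  rw [← h2]
  exact integral_prod _ h5

theorem integral_haarPow_three {f : (Fin 3 → SU2) → ℝ} (hf : Continuous f) :
    ∫ g, f g ∂haarPow (Fin 3) = ∫ x, ∫ y, ∫ z, f ![x, y, z] ∂haar ∂haar ∂haar := by
  rw [integral_haarPow_succ hf]
  congr 1; ext x
  rw [integral_haarPow_succ (by fun_prop)]
  congr 1; ext y
  rw [integral_haarPow_succ (by fun_prop)]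
  congr 1; ext z
  have h : ∀ g : Fin 0 → SU2,
      (Fin.cons x (Fin.cons y (Fin.cons z g : Fin 1 → SU2) : Fin 2 → SU2) : Fin 3 → SU2)
        = ![x, y, z] := fun g => by rw [Subsingleton.elim g ![]]; rfl
  simp [h]

theorem integral_haarPow_six {f : (Fin 6 → SU2) → ℝ} (hf : Continuous f) :
    ∫ g, f g ∂haarPow (Fin 6) = ∫ a, ∫ b, ∫ c, ∫ x, ∫ y, ∫ z, f ![a, b, c, x, y, z]
      ∂haar ∂haar ∂haar ∂haar ∂haar ∂haar := by
  rw [integral_haarPow_succ hf]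
  congr 1; ext a
  rw [integral_haarPow_succ (by fun_prop)]
  congr 1; ext b
  rw [integral_haarPow_succ (by fun_prop)]
  congr 1; ext c
  rw [integral_haarPow_three (by fun_prop)]
  rfl

/-! ### Schur orthogonality -/

theorem spinMatrix_mul (k : ℕ) (g h : SU2) :
    spinMatrix k (g * h) = spinMatrix k g * spinMatrix k h :=
  symPower_mul k g.1 h.1

theorem spinMatrix_one (k : ℕ) : spinMatrix k 1 = 1 := symPower_one k

open Polynomial in
theorem continuous_spinMatrix_apply (k : ℕ) (i j : Fin (k + 1)) :
    Continuous fun g : SU2 => spinMatrix k g i j := by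
  have hent : ∀ a b : Fin 2, Continuous fun g : SU2 => g.1 a b := fun a b =>
    continuous_subtype_val.matrix_elem a b
  have hmul : ∀ p q : SU2 → ℂ[X], (∀ l, Continuous fun g => (p g).coeff l) →
      (∀ l, Continuous fun g => (q g).coeff l) → ∀ l, Continuous fun g => (p g * q g).coeff l := by
    intro p q hp hq l
    simp only [coeff_mul]
    exact continuous_finsetSum _ fun x _ => (hp _).mul (hq _)
  have hpow : ∀ (p : SU2 → ℂ[X]) (m : ℕ), (∀ l, Continuous fun g => (p g).coeff l) →
      ∀ l, Continuous fun g => (p g ^ m).coeff l := by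
    intro p m hp
    induction m with
    | zero => intro l; simp only [pow_zero]; fun_prop
    | succ m ih => simp only [pow_succ]; exact hmul _ _ ih hp
  have hlin : ∀ a b : Fin 2, ∀ l, Continuous fun g : SU2 =>
      (C (g.1 0 a) * X + C (g.1 1 b)).coeff l := by
    intro a b l
    simp only [coeff_add, coeff_C_mul]
    refine ((hent 0 a).mul continuous_const).add ?_
    rcases l with _ | l
    · simpa using hent 1 b
    · simp only [coeff_C_succ]; fun_prop
  exact hmul _ _ (hpow _ _ (hlin 0 0)) (hpow _ _ (hlin 1 1)) i

/-- A diagonal element of `SU(2)` generating a dense subgroup of a maximal torus. -/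
noncomputable def torusElement : SU2 :=
  ⟨!![Complex.exp Complex.I, 0; 0, Complex.exp (-Complex.I)], by
    rw [Matrix.mem_specialUnitaryGroup_iff, Matrix.mem_unitaryGroup_iff]
    constructor
    · ext i j
      fin_cases i <;> fin_cases j <;>
        simp [Matrix.star_eq_conjTranspose, Matrix.vecMul, dotProduct, ← Complex.exp_conj,
          ← Complex.exp_add]
    · simp [Matrix.det_fin_two, ← Complex.exp_add]⟩

/-- An element of `SU(2)` without zero entries. -/
noncomputable def rotationElement : SU2 :=
  ⟨!![3 / 5, -(4 / 5); 4 / 5, 3 / 5], by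
    rw [Matrix.mem_specialUnitaryGroup_iff, Matrix.mem_unitaryGroup_iff]
    constructor
    · ext i j
      fin_cases i <;> fin_cases j <;>
        simp [Matrix.star_eq_conjTranspose, Matrix.vecMul, dotProduct, map_ofNat] <;> norm_num
    · simp [Matrix.det_fin_two]; norm_num⟩

theorem exp_int_mul_I_injective {m n : ℤ}
    (h : Complex.exp (m * Complex.I) = Complex.exp (n * Complex.I)) : m = n := by
  rw [Complex.exp_eq_exp_iff_exists_int] at h
  obtain ⟨l, hl⟩ := h
  have h1 : (m : ℂ) = n + l * (2 * Real.pi) := by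
    have hI := Complex.I_ne_zero
    apply mul_right_cancel₀ hI
    rw [hl]; ring
  have h2 : (m : ℝ) = n + l * (2 * Real.pi) := by exact_mod_cast h1
  by_cases hl0 : l = 0
  · rw [hl0] at h2; simp at h2; exact_mod_cast h2
  · exfalso
    have := irrational_pi
    apply this
    refine ⟨((m - n : ℤ) : ℚ) / (2 * l), ?_⟩
    have : (l : ℝ) ≠ 0 := by exact_mod_cast hl0
    push_cast
    field_simp
    linarith

theorem spinMatrix_torusElement (k : ℕ) : spinMatrix k torusElement
    = Matrix.diagonal fun i : Fin (k + 1) =>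
      Complex.exp (((2 * (i : ℕ) - k : ℤ) : ℂ) * Complex.I) := by
  rw [spinMatrix_eq_symPower]
  simp only [torusElement]
  rw [symPower_diagonal]
  congr 1; ext i
  have hi : (i : ℕ) ≤ k := Nat.lt_succ_iff.1 i.2
  rw [← Complex.exp_nat_mul, ← Complex.exp_nat_mul, ← Complex.exp_add]
  push_cast [Nat.cast_sub hi]
  congr 1; ring

theorem spinMatrix_rotationElement_ne_zero (k : ℕ) (j : Fin (k + 1)) :
    spinMatrix k rotationElement 0 j ≠ 0 := by
  rw [spinMatrix_eq_symPower, symPower_zero_row]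
  simp [rotationElement]

section Intertwiner

variable {k j : ℕ} {A : Matrix (Fin (k + 1)) (Fin (j + 1)) ℂ}

/-- An intertwiner preserves the weights, that is, the eigenvalues of `torusElement`. -/
theorem intertwiner_weight (hA : ∀ g, spinMatrix k g * A = A * spinMatrix j g)
    {a : Fin (k + 1)} {b : Fin (j + 1)} (hab : A a b ≠ 0) :
    (2 * (a : ℕ) - k : ℤ) = 2 * (b : ℕ) - j := by
  have h := congrFun (congrFun (hA torusElement) a) b
  rw [spinMatrix_torusElement, spinMatrix_torusElement, Matrix.diagonal_mul,
    Matrix.mul_diagonal, mul_comm] at h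
  exact exp_int_mul_I_injective (mul_left_cancel₀ hab h)

/-- Schur's lemma for inequivalent spins. Weight preservation determines the zero pattern of `A`, and
`rotationElement` mixes all the weights. -/
theorem intertwiner_eq_zero (hjk : j < k) (hA : ∀ g, spinMatrix k g * A = A * spinMatrix j g) :
    A = 0 := by
  ext x b
  by_contra hx
  -- the lowest weight of spin `k / 2` does not occur in spin `j / 2`
  have h0 : ∀ c, A 0 c = 0 := by
    intro c; by_contra hc
    have := intertwiner_weight hA hc
    simp at this; omega
  have h := congrFun (congrFun (hA rotationElement) 0) b
  rw [Matrix.mul_apply, Matrix.mul_apply] at h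
  simp only [h0, zero_mul, Finset.sum_const_zero] at h
  rw [Finset.sum_eq_single x] at h
  · exact (mul_ne_zero (spinMatrix_rotationElement_ne_zero k x) hx) h
  · intro y _ hy
    have : A y b = 0 := by
      by_contra hc
      have h1 := intertwiner_weight hA hc
      have h2 := intertwiner_weight hA hx
      exact hy (Fin.ext (by omega))
    rw [this, mul_zero]
  · simp

/-- Schur's lemma for equal spins. -/
theorem intertwiner_eq_scalar {A : Matrix (Fin (k + 1)) (Fin (k + 1)) ℂ}
    (hA : ∀ g, spinMatrix k g * A = A * spinMatrix k g) : A = A 0 0 • 1 := by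
  have hd : ∀ a b, a ≠ b → A a b = 0 := by
    intro a b hab; by_contra hc
    have := intertwiner_weight hA hc
    exact hab (Fin.ext (by omega))
  ext a b
  by_cases hab : a = b
  · subst hab
    have h := congrFun (congrFun (hA rotationElement) 0) a
    rw [Matrix.mul_apply, Matrix.mul_apply, Finset.sum_eq_single a, Finset.sum_eq_single 0] at h
    · rw [mul_comm] at h
      simpa using mul_right_cancel₀ (spinMatrix_rotationElement_ne_zero k a) h
    · intro y _ hy; rw [hd 0 y hy.symm, zero_mul]
    · simp
    · intro y _ hy; rw [hd y a hy, mul_zero]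
    · simp
  · simp [hd a b hab, hab]

end Intertwiner

/-- The average of `D^k(h) E D^j(h⁻¹)` over the group. -/
noncomputable def averagedMatrix {k j : ℕ} (E : Matrix (Fin (k + 1)) (Fin (j + 1)) ℂ) :
    Matrix (Fin (k + 1)) (Fin (j + 1)) ℂ :=
  Matrix.of fun a b => ∫ h, (spinMatrix k h * E * spinMatrix j h⁻¹) a b ∂haar

theorem continuous_conj_apply {k j : ℕ} (E : Matrix (Fin (k + 1)) (Fin (j + 1)) ℂ)
    (a : Fin (k + 1)) (b : Fin (j + 1)) :
    Continuous fun h : SU2 => (spinMatrix k h * E * spinMatrix j h⁻¹) a b := by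
  simp only [Matrix.mul_apply]
  have h1 := continuous_spinMatrix_apply k
  have h2 : ∀ i l, Continuous fun h : SU2 => spinMatrix j h⁻¹ i l := fun i l =>
    (continuous_spinMatrix_apply j i l).comp continuous_inv
  exact continuous_finsetSum _ fun x _ =>
    (continuous_finsetSum _ fun y _ => (h1 a y).mul continuous_const).mul (h2 x b)

theorem averagedMatrix_intertwines {k j : ℕ} (E : Matrix (Fin (k + 1)) (Fin (j + 1)) ℂ)
    (g : SU2) : spinMatrix k g * averagedMatrix E = averagedMatrix E * spinMatrix j g := by
  ext a b
  have hc := continuous_conj_apply E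
  have e1 : (spinMatrix k g * averagedMatrix E) a b
      = ∫ h, (spinMatrix k (g * h) * E * spinMatrix j h⁻¹) a b ∂haar := by
    have h1 : ∀ h, (spinMatrix k (g * h) * E * spinMatrix j h⁻¹) a b
        = ∑ i, spinMatrix k g a i * (spinMatrix k h * E * spinMatrix j h⁻¹) i b := by
      intro h
      rw [spinMatrix_mul, Matrix.mul_assoc, Matrix.mul_assoc, Matrix.mul_apply,
        Matrix.mul_assoc]
    simp only [h1]
    rw [integral_finsetSum _ fun i _ => (integrable_of_continuous (hc i b)).const_mul _]
    simp only [integral_const_mul, Matrix.mul_apply (M := spinMatrix k g), averagedMatrix,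
      Matrix.of_apply]
  have e2 : (averagedMatrix E * spinMatrix j g) a b
      = ∫ h, (spinMatrix k h * E * spinMatrix j (h⁻¹ * g)) a b ∂haar := by
    have h1 : ∀ h, (spinMatrix k h * E * spinMatrix j (h⁻¹ * g)) a b
        = ∑ i, (spinMatrix k h * E * spinMatrix j h⁻¹) a i * spinMatrix j g i b := by
      intro h
      rw [spinMatrix_mul, ← Matrix.mul_assoc, Matrix.mul_apply]
    simp only [h1]
    rw [integral_finsetSum _ fun i _ => (integrable_of_continuous (hc a i)).mul_const _]
    simp only [integral_mul_const, Matrix.mul_apply (N := spinMatrix j g), averagedMatrix,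
      Matrix.of_apply]
  rw [e1, e2, ← integral_mul_left_eq_self
    (fun h => (spinMatrix k h * E * spinMatrix j (h⁻¹ * g)) a b) g]
  simp

theorem conj_single_apply {k j : ℕ} (h : SU2) (c d : Fin (k + 1)) (a b : Fin (j + 1)) :
    (spinMatrix k h * Matrix.single c b (1 : ℂ) * spinMatrix j h⁻¹) d a
      = spinMatrix k h d c * spinMatrix j h⁻¹ b a := by
  rw [Matrix.mul_apply, Finset.sum_eq_single b]
  · rw [Matrix.mul_single_apply_same, mul_one]
  · intro x _ hx
    rw [Matrix.mul_single_apply_of_ne _ _ _ _ _ hx, zero_mul]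
  · simp

/-- Schur orthogonality for inequivalent spins. -/
theorem integral_spinMatrix_of_lt {k j : ℕ} (hjk : j < k) (c d : Fin (k + 1))
    (a b : Fin (j + 1)) : ∫ h, spinMatrix k h d c * spinMatrix j h⁻¹ b a ∂haar = 0 := by
  have h := intertwiner_eq_zero hjk
    (averagedMatrix_intertwines (Matrix.single c b (1 : ℂ)))
  have h2 := congrFun (congrFun h d) a
  simpa [averagedMatrix, conj_single_apply] using h2

theorem integral_spinMatrix_of_ne {k j : ℕ} (hjk : k ≠ j) (c d : Fin (k + 1))
    (a b : Fin (j + 1)) : ∫ h, spinMatrix k h d c * spinMatrix j h⁻¹ b a ∂haar = 0 := by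
  rcases lt_or_gt_of_ne hjk with h | h
  · rw [← integral_inv_eq_self, ← integral_spinMatrix_of_lt h a b c d]
    simp [mul_comm]
  · exact integral_spinMatrix_of_lt h c d a b

/-- Schur orthogonality for equal spins. -/
theorem integral_spinMatrix_self (k : ℕ) (c d a b : Fin (k + 1)) :
    ∫ h, spinMatrix k h d c * spinMatrix k h⁻¹ b a ∂haar
      = if d = a ∧ c = b then 1 / ((k : ℂ) + 1) else 0 := by
  set E : Matrix (Fin (k + 1)) (Fin (k + 1)) ℂ := Matrix.single c b 1 with hE
  have h := intertwiner_eq_scalar (averagedMatrix_intertwines E)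
  set lam := averagedMatrix E 0 0 with hlam
  have htr : (averagedMatrix E).trace = E.trace := by
    have hc := continuous_conj_apply E
    simp only [Matrix.trace, Matrix.diag, averagedMatrix, Matrix.of_apply]
    rw [← integral_finsetSum _ fun i _ => integrable_of_continuous (hc i i)]
    have : ∀ h : SU2, ∑ i, (spinMatrix k h * E * spinMatrix k h⁻¹) i i = ∑ i, E i i := by
      intro h
      change (spinMatrix k h * E * spinMatrix k h⁻¹).trace = E.trace
      rw [Matrix.trace_mul_comm, ← Matrix.mul_assoc, ← spinMatrix_mul, inv_mul_cancel,
        spinMatrix_one, Matrix.one_mul]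
    simp [this]
  rw [h] at htr
  have hE2 : E.trace = if c = b then 1 else 0 := by
    rw [hE]
    by_cases hcb : c = b
    · subst hcb; simp
    · simp [hcb, Matrix.trace_single_eq_of_ne]
  rw [hE2, Matrix.trace_smul, Matrix.trace_one, Fintype.card_fin, smul_eq_mul] at htr
  have h2 := congrFun (congrFun h d) a
  have h3 : averagedMatrix E d a = ∫ h, spinMatrix k h d c * spinMatrix k h⁻¹ b a ∂haar := by
    simp only [averagedMatrix, Matrix.of_apply, hE, conj_single_apply]
  rw [← h3, h2]
  have hk : ((k : ℂ) + 1) ≠ 0 := by exact_mod_cast Nat.succ_ne_zero k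
  push_cast at htr
  have hl : lam = (if c = b then 1 else 0) / ((k : ℂ) + 1) := by
    rw [eq_div_iff hk, htr]
  by_cases hda : d = a <;> by_cases hcb : c = b <;> simp [hl, hda, hcb]

theorem character_mul_eq_sum (k : ℕ) (x h : SU2) :
    character k (x * h) = ∑ p : Fin (k + 1) × Fin (k + 1),
      spinMatrix k x p.1 p.2 * spinMatrix k h p.2 p.1 := by
  rw [character, spinMatrix_mul, Matrix.trace, Fintype.sum_prod_type]
  simp [Matrix.mul_apply]

theorem integral_character_conv (k j : ℕ) (x y : SU2) :
    ∫ h, character k (x * h) * character j (h⁻¹ * y) ∂haar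
      = if k = j then character k (x * y) / ((k : ℂ) + 1) else 0 := by
  have hx : ∀ h, character k (x * h) * character j (h⁻¹ * y)
      = ∑ p : Fin (k + 1) × Fin (k + 1), ∑ q : Fin (j + 1) × Fin (j + 1),
        (spinMatrix k x p.1 p.2 * spinMatrix j y q.2 q.1)
          * (spinMatrix k h p.2 p.1 * spinMatrix j h⁻¹ q.1 q.2) := by
    intro h
    rw [character_mul_eq_sum, character_mul_eq_sum, Finset.sum_mul_sum]
    refine Finset.sum_congr rfl fun p _ => Finset.sum_congr rfl fun q _ => by ring
  have hc : ∀ (p : Fin (k + 1) × Fin (k + 1)) (q : Fin (j + 1) × Fin (j + 1)),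
      Continuous fun h : SU2 => (spinMatrix k x p.1 p.2 * spinMatrix j y q.2 q.1)
          * (spinMatrix k h p.2 p.1 * spinMatrix j h⁻¹ q.1 q.2) := fun p q =>
    continuous_const.mul ((continuous_spinMatrix_apply k _ _).mul
      ((continuous_spinMatrix_apply j _ _).comp continuous_inv))
  simp only [hx]
  rw [integral_finsetSum _ fun p _ => integrable_of_continuous
    (continuous_finsetSum _ fun q _ => hc p q)]
  simp only [integral_finsetSum _ fun q _ => integrable_of_continuous (hc _ q),
    integral_const_mul]
  split_ifs with hkj
  · subst hkj
    rw [character_mul_eq_sum, Finset.sum_div]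
    refine Finset.sum_congr rfl fun p _ => ?_
    rw [Finset.sum_eq_single (p.1, p.2)]
    · rw [integral_spinMatrix_self]; simp [div_eq_mul_inv]
    · intro q _ hq
      rw [integral_spinMatrix_self, if_neg, mul_zero]
      rintro ⟨h1, h2⟩
      exact hq (Prod.ext h2.symm h1.symm)
    · simp
  · refine Finset.sum_eq_zero fun p _ => Finset.sum_eq_zero fun q _ => ?_
    rw [integral_spinMatrix_of_ne hkj, mul_zero]

theorem integral_realCharacter_conv (k j : ℕ) (x y : SU2) :
    ∫ h, realCharacter k (x * h) * realCharacter j (h⁻¹ * y) ∂haar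
      = if k = j then realCharacter k (x * y) / ((k : ℝ) + 1) else 0 := by
  have h := integral_character_conv k j x y
  simp only [character_eq_ofReal] at h
  simp only [← Complex.ofReal_mul, integral_complex_ofReal] at h
  split_ifs at h ⊢ with hkj
  · exact_mod_cast h
  · exact_mod_cast h

/-! ### Spin windows and the covariance kernel -/

/-- The kernel of the orthogonal projection of `L²(SU(2))` onto the matrix coefficients whose
spins `k / 2` satisfy `k ∈ S`. -/
noncomputable def windowDelta (S : Finset ℕ) (g : SU2) : ℝ :=
  ∑ k ∈ S, ((k : ℝ) + 1) * realCharacter k g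

theorem cutoffDelta_eq_ofReal (Λ : ℝ) (g : SU2) :
    cutoffDelta Λ g = (windowDelta (Finset.range (⌊2 * Λ⌋₊ + 1)) g : ℂ) := by
  simp [cutoffDelta, windowDelta, character_eq_ofReal]

@[fun_prop]
theorem continuous_windowDelta (S : Finset ℕ) : Continuous (windowDelta S) :=
  continuous_finsetSum _ fun k _ => continuous_const.mul (continuous_realCharacter k)

theorem windowDelta_inv (S : Finset ℕ) (g : SU2) : windowDelta S g⁻¹ = windowDelta S g := by
  simp [windowDelta, realCharacter_inv]

theorem windowDelta_mul_comm (S : Finset ℕ) (g h : SU2) :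
    windowDelta S (g * h) = windowDelta S (h * g) := by
  simp [windowDelta, realCharacter_mul_comm _ g h]

theorem windowDelta_one (S : Finset ℕ) : windowDelta S 1 = ∑ k ∈ S, ((k : ℝ) + 1) ^ 2 := by
  simp [windowDelta, realCharacter_apply_one, sq]

theorem windowDelta_empty (g : SU2) : windowDelta ∅ g = 0 := by simp [windowDelta]

/-- The windows are convolution idempotents. -/
theorem integral_windowDelta_conv (S T : Finset ℕ) (x y : SU2) :
    ∫ h, windowDelta S (x * h) * windowDelta T (h⁻¹ * y) ∂haar = windowDelta (S ∩ T) (x * y) := by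
  have hc : ∀ k j : ℕ, Continuous fun h : SU2 => (((k : ℝ) + 1) * ((j : ℝ) + 1)) *
      (realCharacter k (x * h) * realCharacter j (h⁻¹ * y)) := by
    intro k j
    have h1 := continuous_realCharacter k
    have h2 := continuous_realCharacter j
    fun_prop
  have hx : ∀ h, windowDelta S (x * h) * windowDelta T (h⁻¹ * y)
      = ∑ k ∈ S, ∑ j ∈ T, (((k : ℝ) + 1) * ((j : ℝ) + 1)) *
        (realCharacter k (x * h) * realCharacter j (h⁻¹ * y)) := by
    intro h
    rw [windowDelta, windowDelta, Finset.sum_mul_sum]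
    exact Finset.sum_congr rfl fun k _ => Finset.sum_congr rfl fun j _ => by ring
  simp only [hx]
  rw [integral_finsetSum _ fun k _ => integrable_of_continuous
    (continuous_finsetSum _ fun j _ => hc k j)]
  simp only [integral_finsetSum _ fun j _ => integrable_of_continuous (hc _ j),
    integral_const_mul, integral_realCharacter_conv]
  rw [windowDelta, ← Finset.filter_mem_eq_inter, Finset.sum_filter]
  refine Finset.sum_congr rfl fun k _ => ?_
  have hk : ((k : ℝ) + 1) ≠ 0 := by positivity
  simp only [mul_ite, mul_zero, Finset.sum_ite_eq]
  split_ifs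
  · field_simp
  · rfl

theorem integral_windowDelta_conv' (S T : Finset ℕ) (x y : SU2) :
    ∫ h, windowDelta S (x * h⁻¹) * windowDelta T (h * y) ∂haar = windowDelta (S ∩ T) (x * y) := by
  rw [← integral_windowDelta_conv, ← integral_inv_eq_self]
  simp

/-- Two occurrences of the same integration variable are glued. -/
theorem integral_windowDelta_mul (S T : Finset ℕ) (x y : SU2) :
    ∫ h, windowDelta S (h * x) * windowDelta T (h * y) ∂haar = windowDelta (S ∩ T) (x⁻¹ * y) := by
  rw [← integral_windowDelta_conv']
  refine integral_congr_ae (.of_forall fun h => ?_)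
  beta_reduce
  rw [← windowDelta_inv S, mul_inv_rev]

theorem integral_windowDelta_sq (S : Finset ℕ) (x y : SU2) :
    ∫ h, windowDelta S (x * h * y) ^ 2 ∂haar = windowDelta S 1 := by
  have := integral_windowDelta_mul S S (y * x) (y * x)
  rw [Finset.inter_self, inv_mul_cancel] at this
  rw [← this]
  refine integral_congr_ae (.of_forall fun h => ?_)
  beta_reduce
  rw [mul_assoc, windowDelta_mul_comm, sq, mul_assoc]

theorem windowDelta_one_nonneg (S : Finset ℕ) : 0 ≤ windowDelta S 1 := by
  rw [windowDelta_one]; positivity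

-- from here on the kernel is used only through the lemmas above; unification need not see the sum
attribute [irreducible] windowDelta

theorem abs_integral_mul_le {X : Type*} [TopologicalSpace X] [CompactSpace X] [MeasurableSpace X]
    [BorelSpace X] {μ : Measure X} [IsFiniteMeasure μ] {f g : X → ℝ} (hf : Continuous f)
    (hg : Continuous g) {c : ℝ} (hc : 0 ≤ c) (h1 : ∫ x, f x ^ 2 ∂μ ≤ c) (h2 : ∫ x, g x ^ 2 ∂μ ≤ c) :
    |∫ x, f x * g x ∂μ| ≤ c := by
  apply abs_le_of_sq_le_sq _ hc
  calc _ ≤ _ := sq_integral_mul_le hf hg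
    _ ≤ c * c := mul_le_mul h1 h2 (integral_nonneg fun _ => sq_nonneg _) hc
    _ = c ^ 2 := by ring

theorem abs_windowDelta_le (S : Finset ℕ) (g : SU2) : |windowDelta S g| ≤ windowDelta S 1 := by
  have h := integral_windowDelta_conv S S g 1
  rw [Finset.inter_self, mul_one] at h
  rw [← h]
  refine abs_integral_mul_le (by fun_prop) (by fun_prop) (windowDelta_one_nonneg S) (le_of_eq ?_)
    (le_of_eq ?_)
  · simpa using integral_windowDelta_sq S g 1
  · rw [← integral_windowDelta_sq S 1 1, ← integral_inv_eq_self]; simp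

/-- The kernel of the projection of `L²(SU(2)³)` onto the functions invariant under the diagonal
right translations, with the spin of the `i`-th argument in the window `A i`. -/
noncomputable def invKernel (A : Fin 3 → Finset ℕ) (g g' : Fin 3 → SU2) : ℝ :=
  ∫ h, ∏ i, windowDelta (A i) (g i * h * (g' i)⁻¹) ∂haar

section invKernel

variable (A B : Fin 3 → Finset ℕ)

@[fun_prop]
theorem continuous_invKernel {X : Type*} [TopologicalSpace X] [FirstCountableTopology X]
    [LocallyCompactSpace X] {f f' : X → Fin 3 → SU2} (hf : Continuous f) (hf' : Continuous f') :
    Continuous fun x => invKernel A (f x) (f' x) := by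
  unfold invKernel
  refine continuous_integral_of_continuous ?_
  fun_prop

theorem invKernel_comm (g g' : Fin 3 → SU2) : invKernel A g g' = invKernel A g' g := by
  unfold invKernel
  rw [← integral_inv_eq_self]
  refine integral_congr_ae (.of_forall fun h => Finset.prod_congr rfl fun i _ => ?_)
  rw [← windowDelta_inv]
  congr 1
  group

theorem invKernel_mul_right (g g' : Fin 3 → SU2) (x : SU2) :
    invKernel A (fun i => g i * x) g' = invKernel A g g' := by
  unfold invKernel
  rw [← integral_mul_left_eq_self (fun h => ∏ i, windowDelta (A i) (g i * h * (g' i)⁻¹)) x]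
  simp only [mul_assoc]

theorem invKernel_shift (g g' : Fin 3 → SU2) (c : Fin 3) :
    invKernel (fun i => A (i + c)) (fun i => g (i + c)) (fun i => g' (i + c))
      = invKernel A g g' := by
  unfold invKernel
  refine integral_congr_ae (.of_forall fun h => ?_)
  exact Equiv.prod_comp (Equiv.addRight c) fun i => windowDelta (A i) (g i * h * (g' i)⁻¹)

/-- The projections onto two families of windows commute with each other and multiply to the projection
onto the intersections. -/
theorem integral_invKernel_mul (g g' : Fin 3 → SU2) :
    ∫ k, invKernel A g k * invKernel B k g' ∂haarPow (Fin 3)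
      = invKernel (fun i => A i ∩ B i) g g' := by
  have h1 : ∀ k, invKernel A g k * invKernel B k g'
      = ∫ h, ∫ h', ∏ i, (windowDelta (A i) (g i * h * (k i)⁻¹)
        * windowDelta (B i) (k i * h' * (g' i)⁻¹)) ∂haar ∂haar := by
    intro k
    simp only [Finset.prod_mul_distrib, integral_const_mul, integral_mul_const, invKernel]
  simp only [h1]
  rw [integral_swap]
  swap
  · refine continuous_integral_of_continuous ?_
    fun_prop
  have h2 : ∀ h, ∫ k, ∫ h', ∏ i, (windowDelta (A i) (g i * h * (k i)⁻¹)
        * windowDelta (B i) (k i * h' * (g' i)⁻¹)) ∂haar ∂haarPow (Fin 3)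
      = invKernel (fun i => A i ∩ B i) g g' := by
    intro h
    rw [integral_swap (by fun_prop)]
    have h3 : ∀ h', ∫ k, ∏ i, (windowDelta (A i) (g i * h * (k i)⁻¹)
        * windowDelta (B i) (k i * h' * (g' i)⁻¹)) ∂haarPow (Fin 3)
        = ∏ i, windowDelta (A i ∩ B i) (g i * (h * h') * (g' i)⁻¹) := by
      intro h'
      rw [integral_fintype_prod_eq_prod (f := fun i (k : SU2) =>
        windowDelta (A i) (g i * h * k⁻¹) * windowDelta (B i) (k * h' * (g' i)⁻¹))]
      refine Finset.prod_congr rfl fun i _ => ?_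
      have := integral_windowDelta_conv' (A i) (B i) (g i * h) (h' * (g' i)⁻¹)
      simp only [← mul_assoc] at this ⊢
      exact this
    simp only [h3]
    exact integral_mul_left_eq_self
      (fun h' => ∏ i, windowDelta (A i ∩ B i) (g i * h' * (g' i)⁻¹)) h
  simp [h2]

theorem invKernel_eq_zero {i : Fin 3} (hi : A i = ∅) (g g' : Fin 3 → SU2) :
    invKernel A g g' = 0 := by
  unfold invKernel
  have : ∀ h, ∏ i, windowDelta (A i) (g i * h * (g' i)⁻¹) = 0 := fun h =>
    Finset.prod_eq_zero (Finset.mem_univ i) (by rw [hi, windowDelta_empty])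
  simp [this]

/-- Functions in the range of the projection are reproduced by the windows in each variable. -/
theorem integral_windowDelta_mul_invKernel (g g' : Fin 3 → SU2) (i : Fin 3) :
    ∫ s, windowDelta (A i) (g i * s⁻¹) * invKernel A (Function.update g i s) g' ∂haar
      = invKernel A g g' := by
  simp only [invKernel, ← integral_const_mul]
  rw [integral_swap (by fun_prop)]
  refine integral_congr_ae (.of_forall fun h => ?_)
  beta_reduce
  have h1 : ∀ s, windowDelta (A i) (g i * s⁻¹)
      * ∏ j, windowDelta (A j) (Function.update g i s j * h * (g' j)⁻¹)
      = (windowDelta (A i) (g i * s⁻¹) * windowDelta (A i) (s * (h * (g' i)⁻¹)))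
        * ∏ j ∈ Finset.univ.erase i, windowDelta (A j) (g j * h * (g' j)⁻¹) := by
    intro s
    rw [← Finset.mul_prod_erase _ _ (Finset.mem_univ i), ← mul_assoc]
    congr 1
    · simp [mul_assoc]
    · refine Finset.prod_congr rfl fun j hj => ?_
      rw [Function.update_of_ne (Finset.ne_of_mem_erase hj)]
  simp only [h1, integral_mul_const, integral_windowDelta_conv', Finset.inter_self]
  rw [← Finset.mul_prod_erase _ _ (Finset.mem_univ i), mul_assoc (g i)]

theorem abs_integral_mul_mul_le {f₀ f₁ f₂ : SU2 → ℝ} (h₁ : Continuous f₁)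
    (h₂ : Continuous f₂) {D : ℝ} (hD : ∀ x, |f₀ x| ≤ D) (e₁ : ∫ x, f₁ x ^ 2 ∂haar = D)
    (e₂ : ∫ x, f₂ x ^ 2 ∂haar = D) : |∫ x, f₀ x * f₁ x * f₂ x ∂haar| ≤ D ^ 2 := by
  have hD0 : 0 ≤ D := (abs_nonneg _).trans (hD 1)
  have h : ∀ x, ‖f₀ x * f₁ x * f₂ x‖ ≤ D * (2⁻¹ * (f₁ x ^ 2 + f₂ x ^ 2)) := by
    intro x
    rw [Real.norm_eq_abs, mul_assoc, abs_mul]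
    refine mul_le_mul (hD x) ?_ (abs_nonneg _) hD0
    rw [abs_le]
    constructor <;> nlinarith [sq_nonneg (f₁ x - f₂ x), sq_nonneg (f₁ x + f₂ x)]
  have i₁ : Integrable (fun x => f₁ x ^ 2) haar := integrable_of_continuous (h₁.pow 2)
  have i₂ : Integrable (fun x => f₂ x ^ 2) haar := integrable_of_continuous (h₂.pow 2)
  refine (norm_integral_le_of_norm_le (((i₁.add i₂).const_mul 2⁻¹).const_mul D)
    (.of_forall h)).trans_eq ?_
  rw [integral_const_mul, integral_const_mul, integral_add' i₁ i₂, e₁, e₂]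
  ring

theorem continuous_windowDelta_mul_mul (S : Finset ℕ) (x y : SU2) :
    Continuous fun h => windowDelta S (x * h * y) := by fun_prop

theorem abs_invKernel_le (S : Finset ℕ) (g g' : Fin 3 → SU2) :
    |invKernel (fun _ => S) g g'| ≤ windowDelta S 1 ^ 2 := by
  have h := abs_integral_mul_mul_le
    (continuous_windowDelta_mul_mul S (g 1) (g' 1)⁻¹)
    (continuous_windowDelta_mul_mul S (g 2) (g' 2)⁻¹)
    (fun x => abs_windowDelta_le S (g 0 * x * (g' 0)⁻¹))
    (integral_windowDelta_sq S (g 1) (g' 1)⁻¹) (integral_windowDelta_sq S (g 2) (g' 2)⁻¹)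
  simpa only [invKernel, Fin.prod_univ_three] using h

end invKernel

attribute [irreducible] invKernel

/-- The covariance as a real kernel, for an arbitrary spin window in place of the cutoff. -/
noncomputable def realCovariance (S : Finset ℕ) (g g' : Fin 3 → SU2) : ℝ :=
  (1 / 3) * ∑ c : Fin 3, invKernel (fun _ => S) (fun i => g (i + c)) g'

theorem covariance_eq_ofReal (Λ : ℝ) (g g' : Fin 3 → SU2) :
    covariance Λ g g' = (realCovariance (Finset.range (⌊2 * Λ⌋₊ + 1)) g g' : ℂ) := by
  simp only [covariance, realCovariance, invKernel, cutoffDelta_eq_ofReal, ← Complex.ofReal_prod,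
    integral_complex_ofReal, ← Complex.ofReal_sum]
  push_cast
  rfl

section realCovariance

variable (S : Finset ℕ)

@[fun_prop]
theorem continuous_realCovariance {X : Type*} [TopologicalSpace X] [FirstCountableTopology X]
    [LocallyCompactSpace X] {f f' : X → Fin 3 → SU2} (hf : Continuous f) (hf' : Continuous f') :
    Continuous fun x => realCovariance S (f x) (f' x) := by
  unfold realCovariance
  fun_prop

theorem invKernel_shift_left (A : Fin 3 → Finset ℕ) (g g' : Fin 3 → SU2) (c : Fin 3) :
    invKernel A (fun i => g (i + c)) g'
      = invKernel (fun i => A (i - c)) g (fun i => g' (i - c)) := by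
  rw [← invKernel_shift (fun i => A (i - c)) _ _ c]
  simp

theorem realCovariance_comm (g g' : Fin 3 → SU2) :
    realCovariance S g g' = realCovariance S g' g := by
  unfold realCovariance
  congr 1
  refine Fintype.sum_equiv (Equiv.neg _) _ _ fun c => ?_
  rw [invKernel_shift_left, invKernel_comm]
  simp [sub_eq_add_neg]

theorem realCovariance_shift (g g' : Fin 3 → SU2) (c : Fin 3) :
    realCovariance S (fun i => g (i + c)) g' = realCovariance S g g' := by
  unfold realCovariance
  congr 1
  refine Fintype.sum_equiv (Equiv.addRight c) _ _ fun b => ?_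
  simp only [Equiv.coe_addRight, add_assoc]

theorem realCovariance_mul_right (g g' : Fin 3 → SU2) (x : SU2) :
    realCovariance S (fun i => g i * x) g' = realCovariance S g g' := by
  unfold realCovariance
  congr 1
  refine Finset.sum_congr rfl fun c _ => ?_
  exact invKernel_mul_right _ (fun i => g (i + c)) g' x

/-- The covariance is averaged over the cyclic permutations when composed with a windowed kernel. -/
theorem integral_invKernel_mul_realCovariance (A : Fin 3 → Finset ℕ) (hA : ∀ i, A i ⊆ S)
    (g g' : Fin 3 → SU2) :
    ∫ k, invKernel A g k * realCovariance S k g' ∂haarPow (Fin 3)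
      = (1 / 3) * ∑ c : Fin 3, invKernel A g (fun i => g' (i + c)) := by
  have h : ∀ k, invKernel A g k * realCovariance S k g'
      = (1 / 3) * ∑ c : Fin 3, invKernel A g k * invKernel (fun _ => S) k fun i => g' (i - c) := by
    intro k
    rw [realCovariance, ← Finset.mul_sum]
    simp only [invKernel_shift_left]
    ring
  simp only [h]
  rw [integral_const_mul, integral_finsetSum _ fun c _ => integrable_of_continuous (by fun_prop)]
  simp only [integral_invKernel_mul, Finset.inter_eq_left.2 (hA _)]
  congr 1
  refine Fintype.sum_equiv (Equiv.neg _) _ _ fun c => ?_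
  simp [sub_eq_add_neg]

theorem integral_realCovariance_mul (g g' : Fin 3 → SU2) :
    ∫ k, realCovariance S g k * realCovariance S k g' ∂haarPow (Fin 3)
      = realCovariance S g g' := by
  have h : ∀ k, realCovariance S g k * realCovariance S k g'
      = (1 / 3) * ∑ c : Fin 3, invKernel (fun _ => S) (fun i => g (i + c)) k
        * realCovariance S k g' := by
    intro k
    rw [realCovariance, ← Finset.sum_mul]
    ring
  simp only [h]
  rw [integral_const_mul, integral_finsetSum _ fun c _ => integrable_of_continuous (by fun_prop)]
  have h2 : ∀ c : Fin 3, ∫ k, invKernel (fun _ => S) (fun i => g (i + c)) k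
      * realCovariance S k g' ∂haarPow (Fin 3) = realCovariance S g g' := by
    intro c
    rw [integral_invKernel_mul_realCovariance S _ fun _ => subset_rfl,
      ← realCovariance_shift S g g' c, realCovariance_comm]
    unfold realCovariance
    simp only [invKernel_comm _ (fun i => g (i + c))]
  simp only [h2]
  simp

theorem integral_windowDelta_mul_realCovariance (g g' : Fin 3 → SU2) (i : Fin 3) :
    ∫ s, windowDelta S (g i * s⁻¹) * realCovariance S (Function.update g i s) g' ∂haar
      = realCovariance S g g' := by
  have h : ∀ s, windowDelta S (g i * s⁻¹) * realCovariance S (Function.update g i s) g'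
      = (1 / 3) * ∑ c : Fin 3, windowDelta S (g i * s⁻¹)
        * invKernel (fun _ => S) (fun j => Function.update g i s (j + c)) g' := by
    intro s
    rw [realCovariance, ← Finset.mul_sum]
    ring
  simp only [h]
  rw [integral_const_mul, integral_finsetSum _ fun c _ => integrable_of_continuous (by fun_prop),
    realCovariance]
  congr 1
  refine Finset.sum_congr rfl fun c _ => ?_
  rw [← integral_windowDelta_mul_invKernel (fun _ => S) (fun j => g (j + c)) g' (i - c)]
  refine integral_congr_ae (.of_forall fun s => ?_)
  beta_reduce
  congr 2
  · simp
  · funext j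
    by_cases hj : j = i - c
    · subst hj; simp
    · rw [Function.update_of_ne hj, Function.update_of_ne]
      intro h; exact hj (eq_sub_of_add_eq h)

theorem abs_realCovariance_le (g g' : Fin 3 → SU2) :
    |realCovariance S g g'| ≤ windowDelta S 1 ^ 2 := by
  have h : ∀ c : Fin 3, |invKernel (fun _ => S) (fun i => g (i + c)) g'| ≤ windowDelta S 1 ^ 2 :=
    fun c => abs_invKernel_le S _ _
  have h2 := (Finset.abs_sum_le_sum_abs (fun c : Fin 3 =>
    invKernel (fun _ => S) (fun i => g (i + c)) g') Finset.univ).trans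
    (Finset.sum_le_sum fun c _ => h c)
  rw [realCovariance, abs_mul, abs_of_pos (by norm_num : (0 : ℝ) < 1 / 3)]
  simp at h2
  linarith

end realCovariance

/-! ### Orthonormal bases of reproducing kernel spaces -/

section Kernel

variable {X : Type*} [TopologicalSpace X] [CompactSpace X] [SecondCountableTopology X]
  [MeasurableSpace X] [BorelSpace X] {μ : Measure X} [IsProbabilityMeasure μ]
  [μ.IsOpenPosMeasure] {C : X → X → ℝ}

/-- The family `F` is orthonormal in `L²(μ)` and reproduced by the kernel `C`. -/
structure IsReproducedFamily (μ : Measure X) (C : X → X → ℝ) {m : ℕ} (F : Fin m → X → ℝ) :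
    Prop where
  continuous : ∀ a, Continuous (F a)
  integral_mul : ∀ a b, ∫ x, F a x * F b x ∂μ = if a = b then 1 else 0
  integral_kernel : ∀ a x, ∫ y, C x y * F a y ∂μ = F a x

omit [SecondCountableTopology X] [μ.IsOpenPosMeasure] in
/-- Bessel's identity for the functions `C x ·`. -/
theorem IsReproducedFamily.integral_residual_sq (hC : Continuous fun p : X × X => C p.1 p.2)
    (hs : ∀ x y, C x y = C y x) (hi : ∀ x y, ∫ z, C x z * C z y ∂μ = C x y) {m : ℕ}
    {F : Fin m → X → ℝ} (hF : IsReproducedFamily μ C F) (x : X) :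
    ∫ y, (C x y - ∑ a, F a x * F a y) ^ 2 ∂μ = C x x - ∑ a, F a x ^ 2 := by
  have c1 : Continuous fun y => C x y := hC.comp (by fun_prop : Continuous fun y => (x, y))
  have c2 := hF.continuous
  have h : ∀ y, (C x y - ∑ a, F a x * F a y) ^ 2
      = C x y * C y x - 2 * ∑ a, F a x * (C x y * F a y)
        + ∑ a, ∑ b, F a x * F b x * (F a y * F b y) := by
    intro y
    have e1 : (∑ a, F a x * F a y) ^ 2 = ∑ a, ∑ b, F a x * F b x * (F a y * F b y) := by
      rw [sq, Finset.sum_mul_sum]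
      exact Finset.sum_congr rfl fun a _ => Finset.sum_congr rfl fun b _ => by ring
    have e2 : ∑ a, F a x * (C x y * F a y) = C x y * ∑ a, F a x * F a y := by
      rw [Finset.mul_sum]
      exact Finset.sum_congr rfl fun a _ => by ring
    rw [← e1, e2, hs y x]
    ring
  have i1 : Integrable (fun y => C x y * C y x) μ := integrable_of_continuous (by
    simp only [hs _ x]; fun_prop)
  have i2 : ∀ a, Integrable (fun y => F a x * (C x y * F a y)) μ := fun a =>
    integrable_of_continuous (by fun_prop)
  have i3 : ∀ a b, Integrable (fun y => F a x * F b x * (F a y * F b y)) μ := fun a b =>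
    integrable_of_continuous (by fun_prop)
  have i4 : Integrable (fun y => 2 * ∑ a, F a x * (C x y * F a y)) μ :=
    (integrable_finsetSum _ fun a _ => i2 a).const_mul 2
  have i5 : Integrable (fun y => C x y * C y x - 2 * ∑ a, F a x * (C x y * F a y)) μ := i1.sub i4
  simp only [h]
  rw [integral_add i5
    (integrable_finsetSum _ fun a _ => integrable_finsetSum _ fun b _ => i3 a b),
    integral_sub i1 i4, hi,
    integral_const_mul, integral_finsetSum _ fun a _ => i2 a,
    integral_finsetSum _ fun a _ => integrable_finsetSum _ fun b _ => i3 a b]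
  simp only [integral_finsetSum _ fun b _ => i3 _ b, integral_const_mul, hF.integral_kernel,
    hF.integral_mul]
  simp only [mul_ite, mul_one, mul_zero, Finset.sum_ite_eq, Finset.mem_univ, if_true, ← sq]
  ring

theorem IsReproducedFamily.card_le (hC : Continuous fun p : X × X => C p.1 p.2)
    (hs : ∀ x y, C x y = C y x) (hi : ∀ x y, ∫ z, C x z * C z y ∂μ = C x y) {m : ℕ}
    {F : Fin m → X → ℝ} (hF : IsReproducedFamily μ C F) : (m : ℝ) ≤ ∫ x, C x x ∂μ := by
  have c1 : Continuous fun y => C y y := hC.comp (by fun_prop : Continuous fun y => (y, y))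
  have c2 : ∀ a, Continuous fun x => F a x ^ 2 := fun a => (hF.continuous a).pow 2
  have h : ∀ x, ∑ a, F a x ^ 2 ≤ C x x := by
    intro x
    have h0 : 0 ≤ ∫ y, (C x y - ∑ a, F a x * F a y) ^ 2 ∂μ := integral_nonneg fun y => sq_nonneg _
    rw [hF.integral_residual_sq hC hs hi] at h0
    linarith
  have h2 := integral_mono (μ := μ) (integrable_of_continuous (continuous_finsetSum _ fun a _ => c2 a))
    (integrable_of_continuous c1) h
  rw [integral_finsetSum _ fun a _ => integrable_of_continuous (c2 a)] at h2
  simpa [sq, hF.integral_mul] using h2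

/-- A symmetric idempotent continuous kernel is the kernel of the projection onto the span of a
finite orthonormal family of continuous functions. The family is chosen of maximal size, so that
nothing is left of the kernel after subtracting its contribution. -/
theorem exists_reproducedFamily (hC : Continuous fun p : X × X => C p.1 p.2)
    (hs : ∀ x y, C x y = C y x) (hi : ∀ x y, ∫ z, C x z * C z y ∂μ = C x y) :
    ∃ (m : ℕ) (F : Fin m → X → ℝ), IsReproducedFamily μ C F ∧
      ∀ x y, C x y = ∑ a, F a x * F a y := by
  classical
  let P : ℕ → Prop := fun m => ∃ F : Fin m → X → ℝ, IsReproducedFamily μ C F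
  have hP0 : P 0 := ⟨fun a => a.elim0, fun a => a.elim0, fun a => a.elim0, fun a => a.elim0⟩
  have hb : ∀ m, P m → m ≤ ⌊∫ x, C x x ∂μ⌋₊ := fun m ⟨F, hF⟩ =>
    Nat.le_floor (hF.card_le hC hs hi)
  set m := Nat.findGreatest P ⌊∫ x, C x x ∂μ⌋₊ with hm
  obtain ⟨F, hF⟩ : P m := Nat.findGreatest_spec (Nat.zero_le _) hP0
  refine ⟨m, F, hF, ?_⟩
  have c1 : ∀ x, Continuous fun y => C x y := fun x =>
    hC.comp (by fun_prop : Continuous fun y => (x, y))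
  have c2 := hF.continuous
  have hres : ∀ x, ∫ y, (C x y - ∑ a, F a x * F a y) ^ 2 ∂μ = 0 := by
    intro x
    -- otherwise the family could be extended by the normalized residual
    by_contra hne
    set ρ := ∫ y, (C x y - ∑ a, F a x * F a y) ^ 2 ∂μ with hρ
    have hρ0 : 0 < ρ := lt_of_le_of_ne (integral_nonneg fun y => sq_nonneg _) (Ne.symm hne)
    set r : X → ℝ := fun y => C x y - ∑ a, F a x * F a y with hr
    have cr : Continuous r := by
      have := c1 x
      fun_prop
    have hsq : √ρ ≠ 0 := (Real.sqrt_pos.2 hρ0).ne'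
    have hrF : ∀ a, ∫ y, r y * F a y ∂μ = 0 := by
      intro a
      have e : ∀ y, r y * F a y = C x y * F a y - ∑ b, F b x * (F b y * F a y) := by
        intro y
        rw [hr, sub_mul, Finset.sum_mul]
        simp only [mul_assoc]
      have := c1 x
      simp only [e]
      rw [integral_sub (integrable_of_continuous (by fun_prop))
        (integrable_of_continuous (by fun_prop)), hF.integral_kernel,
        integral_finsetSum _ fun b _ => integrable_of_continuous (by fun_prop)]
      simp only [integral_const_mul, hF.integral_mul]
      simp
    have hrC : ∀ z, ∫ y, C z y * r y ∂μ = r z := by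
      intro z
      have e : ∀ y, C z y * r y = C z y * C y x - ∑ b, F b x * (C z y * F b y) := by
        intro y
        rw [hr, hs y x, mul_sub, Finset.mul_sum]
        simp only [mul_left_comm]
      have h1 := c1 x
      have h2 := c1 z
      have h3 : Continuous fun y => C y x := by simp only [hs _ x]; exact h1
      simp only [e]
      rw [integral_sub (integrable_of_continuous (by fun_prop))
        (integrable_of_continuous (by fun_prop)), hi,
        integral_finsetSum _ fun b _ => integrable_of_continuous (by fun_prop)]
      simp only [integral_const_mul, hF.integral_kernel, hr, hs z x]
    have hP : P (m + 1) := by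
      refine ⟨Fin.cons (fun y => (√ρ)⁻¹ * r y) F, ?_, ?_, ?_⟩
      · intro a
        refine Fin.cases ?_ (fun a => ?_) a
        · exact continuous_const.mul cr
        · exact c2 a
      · intro a b
        refine Fin.cases ?_ (fun a => ?_) a <;> refine Fin.cases ?_ (fun b => ?_) b
        · have e : ∀ y, (√ρ)⁻¹ * r y * ((√ρ)⁻¹ * r y) = ρ⁻¹ * r y ^ 2 := by
            intro y
            have : (√ρ)⁻¹ * (√ρ)⁻¹ = ρ⁻¹ := by
              rw [← mul_inv, Real.mul_self_sqrt hρ0.le]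
            rw [← this]; ring
          simp only [Fin.cons_zero, e, integral_const_mul, if_true]
          exact inv_mul_cancel₀ hne
        · simp only [Fin.cons_zero, Fin.cons_succ, mul_assoc, integral_const_mul, hrF, mul_zero]
          rw [if_neg (Fin.succ_ne_zero b).symm]
        · simp only [Fin.cons_zero, Fin.cons_succ, mul_comm (F a _), mul_assoc,
            integral_const_mul, hrF, mul_zero]
          rw [if_neg (Fin.succ_ne_zero a)]
        · simp only [Fin.cons_succ, hF.integral_mul, Fin.succ_inj]
      · intro a z
        refine Fin.cases ?_ (fun a => ?_) a
        · simp only [Fin.cons_zero, mul_left_comm _ (√ρ)⁻¹, integral_const_mul, hrC]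
        · simp only [Fin.cons_succ, hF.integral_kernel]
    have := Nat.le_findGreatest (hb _ hP) hP
    omega
  intro x y
  have h1 := c1 x
  have cr : Continuous fun y => C x y - ∑ a, F a x * F a y := by fun_prop
  have h2 := (integral_eq_zero_iff_of_nonneg (fun y => sq_nonneg _)
    (integrable_of_continuous (μ := μ) (cr.pow 2))).1 (hres x)
  have h3 := (Continuous.ae_eq_iff_eq μ (cr.pow 2) continuous_zero).1 h2
  have h4 := congrFun h3 y
  simp only [Pi.pow_apply, Pi.zero_apply] at h4
  exact sub_eq_zero.1 (pow_eq_zero_iff two_ne_zero |>.1 h4)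

end Kernel

/-- An orthonormal family `F` of functions on `SU(2)³` whose span is the range of the covariance
with spin window `S`. -/
structure CovarianceBasis (S : Finset ℕ) (m : ℕ) where
  /-- The functions of the family. -/
  toFun : Fin m → (Fin 3 → SU2) → ℝ
  continuous_toFun : ∀ a, Continuous (toFun a)
  integral_mul : ∀ a b, ∫ x, toFun a x * toFun b x ∂haarPow (Fin 3) = if a = b then 1 else 0
  kernel_eq : ∀ g g', realCovariance S g g' = ∑ a, toFun a g * toFun a g'

theorem exists_covarianceBasis (S : Finset ℕ) : ∃ m, Nonempty (CovarianceBasis S m) := by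
  obtain ⟨m, F, hF, h⟩ := exists_reproducedFamily (μ := haarPow (Fin 3))
    (C := realCovariance S) (continuous_realCovariance S continuous_fst continuous_snd)
    (realCovariance_comm S) (integral_realCovariance_mul S)
  exact ⟨m, ⟨F, hF.continuous, hF.integral_mul, h⟩⟩

namespace CovarianceBasis

attribute [fun_prop] continuous_toFun

variable {S : Finset ℕ} {m : ℕ}

theorem integral_kernel_mul (F : CovarianceBasis S m) (a : Fin m) (g : Fin 3 → SU2) :
    ∫ k, realCovariance S g k * F.toFun a k ∂haarPow (Fin 3) = F.toFun a g := by
  simp only [F.kernel_eq, Finset.sum_mul, mul_assoc]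
  rw [integral_finsetSum _ fun b _ => integrable_of_continuous (by fun_prop)]
  simp [integral_const_mul, F.integral_mul]

theorem toFun_shift (F : CovarianceBasis S m) (a : Fin m) (g : Fin 3 → SU2) (c : Fin 3) :
    F.toFun a (fun i => g (i + c)) = F.toFun a g := by
  rw [← F.integral_kernel_mul, ← F.integral_kernel_mul a g]
  simp only [realCovariance_shift]

theorem toFun_mul_right (F : CovarianceBasis S m) (a : Fin m) (g : Fin 3 → SU2) (x : SU2) :
    F.toFun a (fun i => g i * x) = F.toFun a g := by
  rw [← F.integral_kernel_mul, ← F.integral_kernel_mul a g]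
  simp only [realCovariance_mul_right]

/-- Each function of the family is band-limited in each variable. -/
theorem integral_windowDelta_mul_toFun (F : CovarianceBasis S m) (a : Fin m) (g : Fin 3 → SU2)
    (i : Fin 3) :
    ∫ s, windowDelta S (g i * s⁻¹) * F.toFun a (Function.update g i s) ∂haar = F.toFun a g := by
  have h : ∀ s, F.toFun a (Function.update g i s) = ∫ k, realCovariance S (Function.update g i s) k
      * F.toFun a k ∂haarPow (Fin 3) := fun s => (F.integral_kernel_mul a _).symm
  simp only [h, ← integral_const_mul]
  rw [integral_swap (by fun_prop), ← F.integral_kernel_mul a g]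
  simp only [← mul_assoc, integral_mul_const, integral_windowDelta_mul_realCovariance]

/-- The dimension is the trace of the projection. -/
theorem card_eq (F : CovarianceBasis S m) :
    (m : ℝ) = ∫ g, realCovariance S g g ∂haarPow (Fin 3) := by
  simp only [F.kernel_eq]
  rw [integral_finsetSum _ fun b _ => integrable_of_continuous (by fun_prop)]
  simp [F.integral_mul]

theorem card_le (F : CovarianceBasis S m) : (m : ℝ) ≤ windowDelta S 1 ^ 2 := by
  rw [F.card_eq]
  calc _ ≤ ∫ _, windowDelta S 1 ^ 2 ∂haarPow (Fin 3) :=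
        integral_mono (integrable_of_continuous (by fun_prop)) (integrable_const _)
          fun g => (le_abs_self _).trans (abs_realCovariance_le S g g)
    _ = _ := by simp

end CovarianceBasis

/-! ### Amplitudes as tensor networks -/

namespace VacuumGraph

variable {κ : Type} {n : ℕ} (G : VacuumGraph κ n)

theorem mem_lines_iff (x : Fin n × Fin 4) : x ∈ G.lines ↔ toLex x < toLex (G.pair x) := by
  simp [lines]

theorem pair_mem_lines_iff (x : Fin n × Fin 4) : G.pair x ∈ G.lines ↔ x ∉ G.lines := by
  rw [mem_lines_iff, mem_lines_iff, G.pair_pair, not_lt]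
  exact ⟨le_of_lt, fun h => lt_of_le_of_ne h fun h' => G.pair_ne x (toLex_inj.1 h')⟩

/-- The labelings of the half-lines which are constant on the lines. -/
def labelings (m : ℕ) : Finset (Fin n × Fin 4 → Fin m) :=
  Finset.univ.filter fun a => ∀ x, a (G.pair x) = a x

theorem mem_labelings {m : ℕ} {a : Fin n × Fin 4 → Fin m} :
    a ∈ G.labelings m ↔ ∀ x, a (G.pair x) = a x := by simp [labelings]

theorem prod_lines_mul_pair (f : Fin n × Fin 4 → ℝ) :
    ∏ x ∈ G.lines, f x * f (G.pair x) = ∏ x, f x := by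
  rw [Finset.prod_mul_distrib, ← Finset.prod_mul_prod_compl G.lines f]
  congr 1
  refine Finset.prod_nbij' G.pair G.pair ?_ ?_ ?_ ?_ ?_
  · intro x hx
    rw [Finset.mem_compl, pair_mem_lines_iff, not_not]; exact hx
  · intro x hx
    rw [pair_mem_lines_iff]; exact Finset.mem_compl.1 hx
  · intro x _; exact G.pair_pair x
  · intro x _; exact G.pair_pair x
  · intro x _; rfl

/-- Expanding a product of sums over the lines amounts to summing over the labelings. -/
theorem prod_lines_sum {m : ℕ} (f : Fin n × Fin 4 → Fin m → ℝ) :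
    ∏ x ∈ G.lines, ∑ α, f x α * f (G.pair x) α = ∑ a ∈ G.labelings m, ∏ x, f x (a x) := by
  rw [← Finset.prod_coe_sort, Fintype.prod_sum]
  have hp : ∀ x, x ∉ G.lines → G.pair x ∈ G.lines := fun x hx => (G.pair_mem_lines_iff x).2 hx
  refine Finset.sum_bij'
    (fun b _ x => if h : x ∈ G.lines then b ⟨x, h⟩ else b ⟨G.pair x, hp x h⟩)
    (fun a _ x => a x) ?_ ?_ ?_ ?_ ?_
  · intro b _
    rw [mem_labelings]
    intro x
    by_cases hx : x ∈ G.lines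
    · have h2 : G.pair x ∉ G.lines := fun h => (G.pair_mem_lines_iff x).1 h hx
      simp only [hx, h2, dif_pos, dif_neg, not_false_eq_true, G.pair_pair]
    · simp only [hx, hp x hx, dif_pos, dif_neg, not_false_eq_true]
  · intro a _; exact Finset.mem_univ _
  · intro b _
    funext x
    simp
  · intro a ha
    rw [mem_labelings] at ha
    funext x
    by_cases hx : x ∈ G.lines
    · simp [hx]
    · simp [hx, ha]
  · intro b hb
    set a : Fin n × Fin 4 → Fin m :=
      fun x => if h : x ∈ G.lines then b ⟨x, h⟩ else b ⟨G.pair x, hp x h⟩ with ha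
    rw [← G.prod_lines_mul_pair, ← Finset.prod_coe_sort G.lines]
    refine Finset.prod_congr rfl fun x _ => ?_
    have h2 : G.pair x.1 ∉ G.lines := fun h => (G.pair_mem_lines_iff x).1 h x.2
    have e1 : a x = b x := by simp [ha]
    have e2 : a (G.pair x) = b x := by simp [ha, h2, G.pair_pair]
    rw [e1, e2]

end VacuumGraph

/-- The vertex with pattern `s`, with its four fields in the states `a 0, …, a 3` of a basis of the
range of the covariance. -/
noncomputable def vertexTensor {S : Finset ℕ} {m : ℕ} (F : CovarianceBasis S m) (s : Pattern)
    (a : Fin 4 → Fin m) : ℝ :=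
  ∫ g, ∏ l, F.toFun (a l) (fun i => g (s l i)) ∂haarPow (Fin 6)

/-- With the covariances expanded in the basis, the group integrals factorize over the vertices and
the amplitude becomes the contraction of a tensor network. -/
theorem VacuumGraph.amplitude_eq {κ : Type} {n m : ℕ} (G : VacuumGraph κ n) (w : κ → ℝ)
    (s : κ → Pattern) (Λ : ℝ) (F : CovarianceBasis (Finset.range (⌊2 * Λ⌋₊ + 1)) m) :
    G.amplitude w s Λ = (((∏ v, w (G.kind v)) * ∑ a ∈ G.labelings m,
      ∏ v, vertexTensor F (s (G.kind v)) fun l => a (v, l) : ℝ) : ℂ) := by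
  simp only [amplitude, covariance_eq_ofReal, ← Complex.ofReal_prod, integral_complex_ofReal,
    ← Complex.ofReal_mul]
  congr 2
  simp only [F.kernel_eq]
  have h : ∀ g : Fin n → Fin 6 → SU2, ∏ x ∈ G.lines, ∑ α,
      F.toFun α (fun i => g x.1 (s (G.kind x.1) x.2 i))
        * F.toFun α (fun i => g (G.pair x).1 (s (G.kind (G.pair x).1) (G.pair x).2 i))
      = ∑ a ∈ G.labelings m, ∏ v, ∏ l, F.toFun (a (v, l)) fun i => g v (s (G.kind v) l i) := by
    intro g
    rw [G.prod_lines_sum fun x α => F.toFun α (fun i => g x.1 (s (G.kind x.1) x.2 i))]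
    simp only [Fintype.prod_prod_type]
  simp only [h]
  rw [integral_finsetSum _ fun a _ => integrable_of_continuous (by fun_prop)]
  refine Finset.sum_congr rfl fun a _ => ?_
  exact integral_fintype_prod_eq_prod (f := fun v (g : Fin 6 → SU2) =>
    ∏ l, F.toFun (a (v, l)) fun i => g (s (G.kind v) l i))

/-! ### Sums over chains of labels -/

section Chains

variable {ι : Type*} [Fintype ι] [DecidableEq ι]

theorem pow_succ_apply_eq_sum (X : Matrix ι ι ℝ) (n : ℕ) (i j : ι) :
    (X ^ (n + 1)) i j = ∑ p : Fin n → ι,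
      ∏ k : Fin (n + 1), X ((Fin.cons i p : Fin (n + 1) → ι) k) ((Fin.snoc p j : Fin (n + 1) → ι) k) := by
  induction n generalizing i with
  | zero => simp [Fin.snoc]
  | succ n ih =>
    rw [pow_succ', Matrix.mul_apply, ← (Fin.consEquiv fun _ => ι).sum_comp, Fintype.sum_prod_type]
    refine Finset.sum_congr rfl fun a _ => ?_
    rw [ih, Finset.mul_sum]
    refine Finset.sum_congr rfl fun p _ => ?_
    rw [Fin.prod_univ_succ (n := n + 1)]
    simp only [Fin.consEquiv, Equiv.coe_fn_mk, Fin.cons_zero, Fin.cons_succ,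
      ← Fin.cons_snoc_eq_snoc_cons]

/-- The trace of a power as a sum over closed walks. -/
theorem trace_pow_succ_eq_sum (X : Matrix ι ι ℝ) (n : ℕ) :
    (X ^ (n + 1)).trace = ∑ p : Fin (n + 1) → ι, ∏ k, X (p k) (p (finRotate (n + 1) k)) := by
  rw [← (Fin.consEquiv fun _ => ι).sum_comp, Fintype.sum_prod_type, Matrix.trace]
  refine Finset.sum_congr rfl fun i _ => ?_
  rw [Matrix.diag, pow_succ_apply_eq_sum]
  refine Finset.sum_congr rfl fun p _ => Finset.prod_congr rfl fun k _ => ?_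
  congr 1
  refine Fin.lastCases ?_ (fun k => ?_) k
  · simp [Fin.consEquiv]
  · simp [Fin.consEquiv, Fin.coeSucc_eq_succ]

/-- The quadratic form of a power as a sum over walks. -/
theorem dotProduct_pow_mulVec_eq_sum (Y : Matrix ι ι ℝ) (n : ℕ) (u : ι → ℝ) :
    u ⬝ᵥ (Y ^ n).mulVec u = ∑ q : Fin (n + 1) → ι,
      u (q 0) * (∏ k : Fin n, Y (q k.castSucc) (q k.succ)) * u (q (Fin.last n)) := by
  have h : ∀ (n : ℕ) (i : ι), (Y ^ n).mulVec u i = ∑ p : Fin n → ι,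
      (∏ k : Fin n, Y ((Fin.cons i p : Fin (n + 1) → ι) k.castSucc)
        ((Fin.cons i p : Fin (n + 1) → ι) k.succ))
        * u ((Fin.cons i p : Fin (n + 1) → ι) (Fin.last n)) := by
    intro n
    induction n with
    | zero => intro i; simp
    | succ n ih =>
      intro i
      rw [pow_succ', ← Matrix.mulVec_mulVec, ← (Fin.consEquiv fun _ => ι).sum_comp,
        Fintype.sum_prod_type, Matrix.mulVec, dotProduct]
      refine Finset.sum_congr rfl fun a _ => ?_
      rw [ih, Finset.mul_sum]
      refine Finset.sum_congr rfl fun p _ => ?_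
      rw [Fin.prod_univ_succ (n := n)]
      simp only [Fin.consEquiv, Equiv.coe_fn_mk, Fin.castSucc_zero, Fin.cons_zero, Fin.cons_succ,
        ← Fin.succ_castSucc, ← Fin.succ_last, mul_assoc]
  rw [← (Fin.consEquiv fun _ => ι).sum_comp, Fintype.sum_prod_type, dotProduct]
  refine Finset.sum_congr rfl fun i _ => ?_
  rw [h, Finset.mul_sum]
  refine Finset.sum_congr rfl fun p _ => ?_
  simp [Fin.consEquiv, mul_assoc]

end Chains

/-! ### The closed Boulatov chain -/

theorem val_finRotate {n : ℕ} (v : Fin n) :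
    (finRotate n v : ℕ) = if (v : ℕ) + 1 = n then 0 else (v : ℕ) + 1 := by
  rcases n with _ | n
  · exact v.elim0
  · rw [coe_finRotate]
    simp only [Fin.ext_iff, Fin.val_last, Nat.succ_inj]

-- the vertices `2 k` and `2 k + 1` are written as `finProdFinEquiv (k, 0)` and
-- `finProdFinEquiv (k, 1)`
section BoulatovChain

variable {M d : ℕ}

theorem finRotate_finProdFinEquiv_zero (k : Fin M) :
    finRotate (M * 2) (finProdFinEquiv (k, 0)) = finProdFinEquiv (k, 1) := by
  have hk := k.2
  apply Fin.ext
  rw [val_finRotate]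
  simp only [finProdFinEquiv_apply_val, Fin.val_zero, Fin.val_one]
  split_ifs <;> omega

theorem finRotate_finProdFinEquiv_one (k : Fin M) :
    finRotate (M * 2) (finProdFinEquiv (k, 1)) = finProdFinEquiv (finRotate M k, 0) := by
  have hk := k.2
  apply Fin.ext
  rw [val_finRotate]
  simp only [finProdFinEquiv_apply_val, Fin.val_zero, Fin.val_one, val_finRotate]
  split_ifs <;> omega

theorem boulatovChain_pair_succ (hn : Even (M * 2)) (k : Fin M) (l : Fin 3) :
    (boulatovChain (M * 2) hn).pair (finProdFinEquiv (k, 0), l.succ)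
      = (finProdFinEquiv (k, 1), l.succ) := by
  simp only [boulatovChain]
  rw [if_pos, finRotate_finProdFinEquiv_zero]
  simp [Fin.succ_ne_zero]

theorem boulatovChain_pair_zero (hn : Even (M * 2)) (k : Fin M) :
    (boulatovChain (M * 2) hn).pair (finProdFinEquiv (k, 1), 0)
      = (finProdFinEquiv (finRotate M k, 0), 0) := by
  simp only [boulatovChain]
  rw [if_pos, finRotate_finProdFinEquiv_one]
  simp [Nat.add_mod]

theorem mem_labelings_boulatovChain (hn : Even (M * 2)) (a : Fin (M * 2) × Fin 4 → Fin d) :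
    a ∈ (boulatovChain (M * 2) hn).labelings d ↔
      (∀ (k : Fin M) (l : Fin 3),
        a (finProdFinEquiv (k, 1), l.succ) = a (finProdFinEquiv (k, 0), l.succ)) ∧
      ∀ k : Fin M, a (finProdFinEquiv (finRotate M k, 0), 0) = a (finProdFinEquiv (k, 1), 0) := by
  rw [VacuumGraph.mem_labelings]
  constructor
  · intro h
    refine ⟨fun k l => ?_, fun k => ?_⟩
    · rw [← boulatovChain_pair_succ hn, h]
    · rw [← boulatovChain_pair_zero hn, h]
  · rintro ⟨h1, h2⟩ ⟨v, l⟩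
    obtain ⟨⟨k, b⟩, rfl⟩ := finProdFinEquiv.surjective v
    have hpp := (boulatovChain (M * 2) hn).pair_pair
    refine Fin.cases ?_ (fun l => ?_) l
    · by_cases hb : b = 0
      · subst hb
        obtain ⟨k, rfl⟩ := (finRotate M).surjective k
        rw [h2, ← boulatovChain_pair_zero hn, hpp]
      · obtain rfl : b = 1 := by omega
        rw [boulatovChain_pair_zero, h2]
    · by_cases hb : b = 0
      · subst hb
        rw [boulatovChain_pair_succ, h1]
      · obtain rfl : b = 1 := by omega
        rw [h1, ← boulatovChain_pair_succ hn, hpp]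

/-- Two vertices joined by three lines, from the half-line `l` to the half-line `l` for `l = 1, 2, 3`,
as a matrix between their half-lines `0`. -/
def doubleVertexMatrix (V : (Fin 4 → Fin d) → ℝ) : Matrix (Fin d) (Fin d) ℝ :=
  Matrix.of fun α β => ∑ t : Fin 3 → Fin d, V (Fin.cons α t) * V (Fin.cons β t)

theorem sum_labelings_boulatovChain (hn : Even (M * 2)) (hM : 0 < M) (V : (Fin 4 → Fin d) → ℝ) :
    ∑ a ∈ (boulatovChain (M * 2) hn).labelings d, ∏ v, V (fun l => a (v, l))
      = (doubleVertexMatrix V ^ M).trace := by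
  obtain ⟨N, rfl⟩ : ∃ N, M = N + 1 := ⟨M - 1, by omega⟩
  rw [trace_pow_succ_eq_sum]
  have h1 : ∀ α : Fin (N + 1) → Fin d,
      ∏ k, doubleVertexMatrix V (α k) (α (finRotate (N + 1) k))
      = ∑ t : Fin (N + 1) → Fin 3 → Fin d,
        ∏ k, (V (Fin.cons (α k) (t k)) * V (Fin.cons (α (finRotate (N + 1) k)) (t k))) := by
    intro α
    simp only [doubleVertexMatrix, Matrix.of_apply]
    rw [Fintype.prod_sum]
  simp only [h1]
  rw [← Fintype.sum_prod_type']
  refine Finset.sum_bij'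
    (fun a _ => (fun k => a (finProdFinEquiv (k, 0), 0),
      fun k l => a (finProdFinEquiv (k, 0), Fin.succ l)))
    (fun p _ x => (Fin.cons (if (finProdFinEquiv.symm x.1).2 = 0
        then p.1 (finProdFinEquiv.symm x.1).1
        else p.1 (finRotate (N + 1) (finProdFinEquiv.symm x.1).1))
      (p.2 (finProdFinEquiv.symm x.1).1) : Fin 4 → Fin d) x.2) ?_ ?_ ?_ ?_ ?_
  · intro a _; exact Finset.mem_univ _
  · intro p _
    rw [mem_labelings_boulatovChain]
    constructor
    · intro k l
      simp only [Equiv.symm_apply_apply, Fin.cons_succ]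
    · intro k
      simp
  · intro a ha
    rw [mem_labelings_boulatovChain] at ha
    funext x
    obtain ⟨v, l⟩ := x
    obtain ⟨⟨k, b⟩, rfl⟩ := finProdFinEquiv.surjective v
    simp only [Equiv.symm_apply_apply]
    refine Fin.cases ?_ (fun l => ?_) l
    · by_cases hb : b = 0
      · subst hb; simp
      · obtain rfl : b = 1 := by omega
        simp [ha.2, -finRotate_apply]
    · by_cases hb : b = 0
      · subst hb; simp
      · obtain rfl : b = 1 := by omega
        simp [ha.1]
  · intro p _
    refine Prod.ext ?_ ?_
    · funext k; simp
    · funext k l; simp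
  · intro a ha
    rw [mem_labelings_boulatovChain] at ha
    rw [← finProdFinEquiv.prod_comp, Fintype.prod_prod_type]
    refine Finset.prod_congr rfl fun k _ => ?_
    rw [Fin.prod_univ_two]
    congr 2
    · funext l
      refine Fin.cases ?_ (fun l => ?_) l <;> simp
    · funext l
      refine Fin.cases ?_ (fun l => ?_) l
      · simp [ha.2, -finRotate_apply]
      · simp [ha.1]

theorem boulatovChain_isConnected {n : ℕ} (hn : Even n) (h0 : 0 < n) :
    (boulatovChain n hn).IsConnected := by
  unfold VacuumGraph.IsConnected
  have : Nonempty (Fin n) := ⟨⟨0, h0⟩⟩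
  rw [SimpleGraph.connected_iff_exists_forall_reachable]
  refine ⟨⟨0, h0⟩, fun v => ?_⟩
  obtain ⟨v, hv⟩ := v
  induction v with
  | zero => rfl
  | succ v ih =>
    refine (ih (by omega)).trans (SimpleGraph.Adj.reachable ?_)
    rw [SimpleGraph.fromRel_adj]
    refine ⟨by simp, Or.inl ?_⟩
    have hr : finRotate n ⟨v, by omega⟩ = ⟨v + 1, hv⟩ := by
      apply Fin.ext
      rw [val_finRotate, if_neg]
      simp only; omega
    by_cases hp : v % 2 = 0
    · exact ⟨1, 1, by simp [boulatovChain, hp, hr, -finRotate_apply]⟩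
    · exact ⟨0, 0, by simp [boulatovChain, hp, hr, -finRotate_apply]⟩

end BoulatovChain

/-! ### The open chain of pillows -/

section BFLChain

variable {N d : ℕ}

theorem bflChain_isConnected {n : ℕ} (h0 : 0 < n) : (bflChain n).IsConnected := by
  unfold VacuumGraph.IsConnected
  have : Nonempty (Fin n) := ⟨⟨0, h0⟩⟩
  rw [SimpleGraph.connected_iff_exists_forall_reachable]
  refine ⟨⟨0, h0⟩, fun v => ?_⟩
  obtain ⟨v, hv⟩ := v
  induction v with
  | zero => rfl
  | succ v ih =>
    refine (ih (by omega)).trans (SimpleGraph.Adj.reachable ?_)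
    rw [SimpleGraph.fromRel_adj]
    exact ⟨by simp, Or.inl ⟨1, 0, by simp [bflChain, hv]⟩⟩

/-- A pillow as a matrix from its pair of half-lines `(0, 2)` to its pair of half-lines `(1, 3)`. -/
def pillowMatrix (V : (Fin 4 → Fin d) → ℝ) : Matrix (Fin d × Fin d) (Fin d × Fin d) ℝ :=
  Matrix.of fun p q => V ![p.1, q.1, p.2, q.2]

/-- The line joining the two half-lines of a pair, at an end of the chain of pillows, as a vector. -/
def diagonalVector (d : ℕ) (p : Fin d × Fin d) : ℝ := if p.1 = p.2 then 1 else 0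

theorem mem_labelings_bflChain (a : Fin (N + 1) × Fin 4 → Fin d) :
    a ∈ (bflChain (N + 1)).labelings d ↔
      (∀ v : Fin N, a (v.castSucc, 1) = a (v.succ, 0) ∧ a (v.castSucc, 3) = a (v.succ, 2)) ∧
      a (0, 0) = a (0, 2) ∧ a (Fin.last N, 1) = a (Fin.last N, 3) := by
  rw [VacuumGraph.mem_labelings]
  have p1 : ∀ v : Fin N, (bflChain (N + 1)).pair (v.castSucc, 1) = (v.succ, 0) := by
    intro v; simp [bflChain, Fin.ext_iff]
  have p3 : ∀ v : Fin N, (bflChain (N + 1)).pair (v.castSucc, 3) = (v.succ, 2) := by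
    intro v; simp [bflChain, Fin.ext_iff]
  have p0 : (bflChain (N + 1)).pair (0, 0) = (0, 2) := by simp [bflChain]
  have pl : (bflChain (N + 1)).pair (Fin.last N, 1) = (Fin.last N, 3) := by simp [bflChain]
  have hpp := (bflChain (N + 1)).pair_pair
  constructor
  · intro h
    refine ⟨fun v => ⟨?_, ?_⟩, ?_, ?_⟩
    · rw [← h, p1]
    · rw [← h, p3]
    · rw [← h, p0]
    · rw [← h, pl]
  · rintro ⟨h1, h2, h3⟩ ⟨v, l⟩
    have hl : l = 0 ∨ l = 1 ∨ l = 2 ∨ l = 3 := by omega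
    rcases hl with rfl | rfl | rfl | rfl
    · refine Fin.cases ?_ (fun v => ?_) v
      · rw [p0, h2]
      · rw [← p1, hpp, (h1 v).1, p1]
    · refine Fin.lastCases ?_ (fun v => ?_) v
      · rw [pl, h3]
      · rw [p1, (h1 v).1]
    · refine Fin.cases ?_ (fun v => ?_) v
      · rw [← p0, hpp, h2, p0]
      · rw [← p3, hpp, (h1 v).2, p3]
    · refine Fin.lastCases ?_ (fun v => ?_) v
      · rw [← pl, hpp, h3, pl]
      · rw [p3, (h1 v).2]

theorem sum_labelings_bflChain (V : (Fin 4 → Fin d) → ℝ) :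
    ∑ a ∈ (bflChain (N + 1)).labelings d, ∏ v, V (fun l => a (v, l))
      = diagonalVector d ⬝ᵥ ((pillowMatrix V) ^ (N + 1)).mulVec (diagonalVector d) := by
  rw [dotProduct_pow_mulVec_eq_sum]
  have h1 : ∀ q : Fin (N + 2) → Fin d × Fin d, diagonalVector d (q 0)
      * (∏ k : Fin (N + 1), pillowMatrix V (q k.castSucc) (q k.succ))
        * diagonalVector d (q (Fin.last (N + 1)))
      = if (q 0).1 = (q 0).2 ∧ (q (Fin.last (N + 1))).1 = (q (Fin.last (N + 1))).2 then
        ∏ k : Fin (N + 1), pillowMatrix V (q k.castSucc) (q k.succ) else 0 := by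
    intro q
    unfold diagonalVector
    split_ifs <;> simp_all
  simp only [h1]
  rw [← Finset.sum_filter]
  have hs : ∀ (a : Fin (N + 1) × Fin 4 → Fin d) (v : Fin N),
      (Fin.snoc (fun v => (a (v, 0), a (v, 2))) (a (Fin.last N, 1), a (Fin.last N, 3)) :
        Fin (N + 2) → Fin d × Fin d) v.castSucc.succ = (a (v.succ, 0), a (v.succ, 2)) := by
    intro a v
    rw [Fin.succ_castSucc]
    exact Fin.snoc_castSucc (α := fun _ : Fin (N + 2) => Fin d × Fin d) _ _ _
  refine Finset.sum_bij'
    (fun a _ => (Fin.snoc (fun v => (a (v, 0), a (v, 2))) (a (Fin.last N, 1), a (Fin.last N, 3)) :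
      Fin (N + 2) → Fin d × Fin d))
    (fun q _ x => ![(q x.1.castSucc).1, (q x.1.succ).1, (q x.1.castSucc).2, (q x.1.succ).2] x.2)
    ?_ ?_ ?_ ?_ ?_
  · intro a ha
    rw [mem_labelings_bflChain] at ha
    simp only [Finset.mem_filter, Finset.mem_univ, true_and, Fin.snoc_last]
    refine ⟨?_, ha.2.2⟩
    have h0 := Fin.snoc_castSucc (α := fun _ : Fin (N + 2) => Fin d × Fin d)
      (a (Fin.last N, 1), a (Fin.last N, 3)) (fun v => (a (v, 0), a (v, 2))) 0
    rw [Fin.castSucc_zero] at h0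
    rw [h0]
    exact ha.2.1
  · intro q hq
    simp only [Finset.mem_filter, Finset.mem_univ, true_and] at hq
    rw [mem_labelings_bflChain]
    simp only [Fin.succ_castSucc]
    simpa using hq
  · intro a ha
    rw [mem_labelings_bflChain] at ha
    funext x
    obtain ⟨v, l⟩ := x
    have hl : l = 0 ∨ l = 1 ∨ l = 2 ∨ l = 3 := by omega
    rcases hl with rfl | rfl | rfl | rfl
    · simp
    · refine Fin.lastCases ?_ (fun v => ?_) v
      · simp
      · exact (congrArg Prod.fst (hs a v)).trans (ha.1 v).1.symm
    · simp
    · refine Fin.lastCases ?_ (fun v => ?_) v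
      · simp
      · exact (congrArg Prod.snd (hs a v)).trans (ha.1 v).2.symm
  · intro q hq
    funext k
    refine Fin.lastCases ?_ (fun k => ?_) k
    · simp
    · simp
  · intro a ha
    rw [mem_labelings_bflChain] at ha
    refine Finset.prod_congr rfl fun v _ => ?_
    rw [pillowMatrix, Matrix.of_apply]
    congr 1
    funext l
    have hl : l = 0 ∨ l = 1 ∨ l = 2 ∨ l = 3 := by omega
    rcases hl with rfl | rfl | rfl | rfl
    · simp
    · refine Fin.lastCases ?_ (fun v => ?_) v
      · simp
      · exact (ha.1 v).1.trans (congrArg Prod.fst (hs a v)).symm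
    · simp
    · refine Fin.lastCases ?_ (fun v => ?_) v
      · simp
      · exact (ha.1 v).2.trans (congrArg Prod.snd (hs a v)).symm

end BFLChain

/-! ### The amplitudes of the chains -/

theorem norm_boulatovAmplitude_chain {M m : ℕ} (hn : Even (M * 2)) (hM : 0 < M) (Λ : ℝ)
    (F : CovarianceBasis (Finset.range (⌊2 * Λ⌋₊ + 1)) m) :
    ‖boulatovAmplitude Λ (boulatovChain (M * 2) hn)‖
      = (1 / 8) ^ (M * 2) * |(doubleVertexMatrix (vertexTensor F boulatovPattern) ^ M).trace| := by
  rw [boulatovAmplitude, VacuumGraph.amplitude_eq _ _ _ _ F, Complex.norm_real, Real.norm_eq_abs,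
    sum_labelings_boulatovChain hn hM (vertexTensor F boulatovPattern), abs_mul]
  simp [abs_pow]

theorem norm_bflAmplitude_chain {N m : ℕ} (δ Λ : ℝ)
    (F : CovarianceBasis (Finset.range (⌊2 * Λ⌋₊ + 1)) m) :
    ‖bflAmplitude δ Λ (bflChain (N + 1))‖ = (1 / 8) ^ (N + 1) * |diagonalVector m ⬝ᵥ
      (pillowMatrix (vertexTensor F pillowPattern) ^ (N + 1)).mulVec (diagonalVector m)| := by
  rw [bflAmplitude, VacuumGraph.amplitude_eq _ _ _ _ F, Complex.norm_real, Real.norm_eq_abs]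
  have hk : ∀ v, (bflChain (N + 1)).kind v = BFLVertex.pillow := fun _ => rfl
  simp only [hk, BFLVertex.weight, BFLVertex.pattern]
  rw [sum_labelings_bflChain (vertexTensor F pillowPattern), abs_mul]
  simp [abs_pow]

/-! ### Powers of positive semidefinite matrices -/

section PosSemidef

variable {ι : Type*} [Fintype ι] [DecidableEq ι] {A : Matrix ι ι ℝ}

/-- The spectral decomposition, in the form of formulas for traces and quadratic forms of powers. -/
theorem exists_spectral_sums (hA : A.IsHermitian) (hp : ∀ x : ι → ℝ, 0 ≤ x ⬝ᵥ A.mulVec x) :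
    ∃ lam : ι → ℝ, (∀ i, 0 ≤ lam i) ∧ (∀ n, (A ^ n).trace = ∑ i, lam i ^ n) ∧
      (∀ u : ι → ℝ, ∃ w : ι → ℝ, (∀ i, 0 ≤ w i) ∧
        ∀ n, u ⬝ᵥ (A ^ n).mulVec u = ∑ i, w i * lam i ^ n) ∧
      ∀ D, (∀ x : ι → ℝ, x ⬝ᵥ A.mulVec x ≤ D * (x ⬝ᵥ x)) → ∀ i, lam i ≤ D := by
  set U : Matrix ι ι ℝ := (hA.eigenvectorUnitary : Matrix ι ι ℝ) with hU
  have hUU : star U * U = 1 := Unitary.coe_star_mul_self hA.eigenvectorUnitary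
  set lam := hA.eigenvalues with hlam
  have hpow : ∀ n, A ^ n = U * Matrix.diagonal (fun i => lam i ^ n) * star U := by
    intro n
    have h := hA.spectral_theorem
    have h2 := congrArg (fun B => B ^ n) h
    simp only [← map_pow, Matrix.diagonal_pow] at h2
    rw [h2, Unitary.conjStarAlgAut_apply]
    rfl
  have hquad : ∀ (u : ι → ℝ) n, u ⬝ᵥ (A ^ n).mulVec u
      = ∑ i, ((star U).mulVec u i) ^ 2 * lam i ^ n := by
    intro u n
    rw [hpow, ← Matrix.mulVec_mulVec, ← Matrix.mulVec_mulVec, Matrix.dotProduct_mulVec,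
      ← Matrix.mulVec_transpose]
    have : U.transpose = star U := by
      rw [Matrix.star_eq_conjTranspose, Matrix.conjTranspose_eq_transpose_of_trivial]
    rw [this, dotProduct]
    refine Finset.sum_congr rfl fun i _ => ?_
    rw [Matrix.mulVec_diagonal]
    ring
  -- evaluation on the eigenvectors
  have heig : ∀ i n, (U.mulVec (Pi.single i 1)) ⬝ᵥ (A ^ n).mulVec (U.mulVec (Pi.single i 1))
      = lam i ^ n := by
    intro i n
    rw [hquad, Matrix.mulVec_mulVec, hUU, Matrix.one_mulVec, Finset.sum_eq_single i]
    · simp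
    · intro j _ hj; simp [hj]
    · simp
  refine ⟨lam, fun i => ?_, fun n => ?_, fun u => ⟨_, fun i => sq_nonneg _, hquad u⟩,
    fun D hD i => ?_⟩
  · have := heig i 1
    rw [pow_one, pow_one] at this
    rw [← this]; exact hp _
  · rw [hpow, Matrix.trace_mul_comm, ← Matrix.mul_assoc, hUU, Matrix.one_mul, Matrix.trace_diagonal]
  · have h1 := heig i 1
    have h0 := heig i 0
    rw [pow_one, pow_one] at h1
    rw [pow_zero, pow_zero, Matrix.one_mulVec] at h0
    have := hD (U.mulVec (Pi.single i 1))
    rw [h0, h1, mul_one] at this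
    exact this

theorem trace_pow_le (hA : A.IsHermitian) (hp : ∀ x : ι → ℝ, 0 ≤ x ⬝ᵥ A.mulVec x) {D : ℝ}
    (hD : ∀ x : ι → ℝ, x ⬝ᵥ A.mulVec x ≤ D * (x ⬝ᵥ x)) (n : ℕ) :
    (A ^ n).trace ≤ Fintype.card ι * D ^ n := by
  obtain ⟨lam, h0, htr, -, hle⟩ := exists_spectral_sums hA hp
  rw [htr]
  calc ∑ i, lam i ^ n ≤ ∑ _i : ι, D ^ n :=
        Finset.sum_le_sum fun i _ => pow_le_pow_left₀ (h0 i) (hle D hD i) n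
    _ = _ := by simp

/-- The power mean inequality for the eigenvalues. -/
theorem trace_pow_le_trace_pow (hA : A.IsHermitian) (hp : ∀ x : ι → ℝ, 0 ≤ x ⬝ᵥ A.mulVec x)
    (n : ℕ) : A.trace ^ (n + 1) ≤ (Fintype.card ι : ℝ) ^ n * (A ^ (n + 1)).trace := by
  obtain ⟨lam, h0, htr, -, -⟩ := exists_spectral_sums hA hp
  have h1 := htr 1
  simp only [pow_one] at h1
  rw [htr, h1]
  rcases isEmpty_or_nonempty ι with hι | hι
  · simp
  · have h := pow_sum_div_card_le_sum_pow (s := (Finset.univ : Finset ι)) (f := lam)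
      (fun i _ => h0 i) n
    rw [Finset.card_univ, div_le_iff₀ (by positivity)] at h
    linarith

theorem dotProduct_pow_mulVec_le (hA : A.IsHermitian) (hp : ∀ x : ι → ℝ, 0 ≤ x ⬝ᵥ A.mulVec x)
    {D : ℝ} (hD : ∀ x : ι → ℝ, x ⬝ᵥ A.mulVec x ≤ D * (x ⬝ᵥ x)) (u : ι → ℝ) (n : ℕ) :
    u ⬝ᵥ (A ^ n).mulVec u ≤ D ^ n * (u ⬝ᵥ u) := by
  obtain ⟨lam, h0, -, hq, hle⟩ := exists_spectral_sums hA hp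
  obtain ⟨w, hw, h⟩ := hq u
  have hu := h 0
  simp only [pow_zero, Matrix.one_mulVec, mul_one] at hu
  rw [h, hu, Finset.mul_sum]
  refine Finset.sum_le_sum fun i _ => ?_
  rw [mul_comm]
  exact mul_le_mul_of_nonneg_right (pow_le_pow_left₀ (h0 i) (hle D hD i) n) (hw i)

/-- The power mean inequality for the spectral measure of `u`. -/
theorem dotProduct_mulVec_pow_le (hA : A.IsHermitian) (hp : ∀ x : ι → ℝ, 0 ≤ x ⬝ᵥ A.mulVec x)
    (u : ι → ℝ) (n : ℕ) : (u ⬝ᵥ A.mulVec u) ^ (n + 1)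
      ≤ (u ⬝ᵥ u) ^ n * (u ⬝ᵥ (A ^ (n + 1)).mulVec u) := by
  obtain ⟨lam, h0, -, hq, -⟩ := exists_spectral_sums hA hp
  obtain ⟨w, hw, h⟩ := hq u
  have hu := h 0
  have h1 := h 1
  simp only [pow_zero, pow_one, Matrix.one_mulVec, mul_one] at hu h1
  rw [h, hu, h1]
  rcases (Finset.sum_nonneg fun i _ => hw i : 0 ≤ ∑ i, w i).eq_or_lt with hW | hW
  · have hz : ∀ i, w i = 0 := fun i =>
      (Finset.sum_eq_zero_iff_of_nonneg fun i _ => hw i).1 hW.symm i (Finset.mem_univ i)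
    simp [hz]
  · set W := ∑ i, w i with hWdef
    have hm := Real.pow_arith_mean_le_arith_mean_pow Finset.univ (fun i => w i / W) lam
      (fun i _ => div_nonneg (hw i) hW.le) (by rw [← Finset.sum_div, div_self hW.ne'])
      (fun i _ => h0 i) (n + 1)
    simp only [div_mul_eq_mul_div, ← Finset.sum_div] at hm
    rw [div_pow, div_le_div_iff₀ (by positivity) hW, pow_succ W] at hm
    have : (∑ i, w i * lam i) ^ (n + 1) * W ≤ (W ^ n * ∑ i, w i * lam i ^ (n + 1)) * W := by
      linarith
    exact le_of_mul_le_mul_right this hW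

end PosSemidef

/-! ### Restriction to coinciding arguments -/

/-- The properties of the functions in the range of the covariance used to restrict them to
coinciding arguments: cyclic symmetry, invariance under right translations, band limitation. -/
structure IsBandLimited (S : Finset ℕ) (φ : (Fin 3 → SU2) → ℝ) : Prop where
  continuous : Continuous φ
  shift : ∀ g (c : Fin 3), φ (fun i => g (i + c)) = φ g
  mul_right : ∀ g x, φ (fun i => g i * x) = φ g
  /-- The spins of each argument lie in `S`. -/
  reproduce : ∀ g i, ∫ s, windowDelta S (g i * s⁻¹) * φ (Function.update g i s) ∂haar = φ g

theorem CovarianceBasis.isBandLimited {S : Finset ℕ} {m : ℕ} (F : CovarianceBasis S m)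
    (a : Fin m) : IsBandLimited S (F.toFun a) :=
  ⟨F.continuous_toFun a, F.toFun_shift a, F.toFun_mul_right a,
    F.integral_windowDelta_mul_toFun a⟩

theorem IsBandLimited.sum {S : Finset ℕ} {ι : Type*} [Fintype ι] {φ : ι → (Fin 3 → SU2) → ℝ}
    (h : ∀ a, IsBandLimited S (φ a)) (x : ι → ℝ) :
    IsBandLimited S fun g => ∑ a, x a * φ a g where
  continuous := continuous_finsetSum _ fun a _ => continuous_const.mul (h a).continuous
  shift g c := Finset.sum_congr rfl fun a _ => by rw [(h a).shift]
  mul_right g y := Finset.sum_congr rfl fun a _ => by rw [(h a).mul_right]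
  reproduce g i := by
    have hc := fun a => (h a).continuous
    simp only [Finset.mul_sum, mul_left_comm _ (x _)]
    rw [integral_finsetSum _ fun a _ => integrable_of_continuous (by fun_prop)]
    simp only [integral_const_mul, (h _).reproduce]

section IsBandLimited

variable {S : Finset ℕ} {φ : (Fin 3 → SU2) → ℝ}

/-- Evaluating a band-limited function at a point costs a factor `δ(1)`. -/
theorem IsBandLimited.sq_le (h : IsBandLimited S φ) (g : Fin 3 → SU2) (i : Fin 3) :
    φ g ^ 2 ≤ windowDelta S 1 * ∫ s, φ (Function.update g i s) ^ 2 ∂haar := by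
  have hc := h.continuous
  rw [← h.reproduce g i]
  refine (sq_integral_mul_le (by fun_prop) (by fun_prop)).trans_eq ?_
  congr 1
  rw [← integral_windowDelta_sq S (g i) 1, ← integral_inv_eq_self]
  simp

theorem IsBandLimited.cyclic (h : IsBandLimited S φ) (x y z : SU2) :
    φ ![x, y, z] = φ ![y, z, x] := by
  rw [← h.shift ![x, y, z] 1]
  congr 1
  funext i
  fin_cases i <;> rfl

/-- Fixing one argument costs nothing, by the invariance under right translations. -/
theorem IsBandLimited.integral_fix (h : IsBandLimited S φ) (u : SU2) :
    ∫ s, ∫ t, φ ![u, s, t] ^ 2 ∂haar ∂haar = ∫ g, φ g ^ 2 ∂haarPow (Fin 3) := by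
  have hc := h.continuous
  have key : ∀ u, ∫ s, ∫ t, φ ![u, s, t] ^ 2 ∂haar ∂haar
      = ∫ s, ∫ t, φ ![1, s, t] ^ 2 ∂haar ∂haar := by
    intro u
    rw [← integral_mul_right_eq_self (fun s => ∫ t, φ ![u, s, t] ^ 2 ∂haar) u]
    refine integral_congr_ae (.of_forall fun s => ?_)
    beta_reduce
    rw [← integral_mul_right_eq_self (fun t => φ ![u, s * u, t] ^ 2) u]
    refine integral_congr_ae (.of_forall fun t => ?_)
    beta_reduce
    rw [← h.mul_right ![1, s, t] u]
    congr 2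
    funext i
    fin_cases i <;> simp
  rw [integral_haarPow_three (by fun_prop), key u]
  simp only [key]
  simp

/-- Fixing two arguments costs a factor `δ(1)`. -/
theorem IsBandLimited.integral_fix_fix_le (h : IsBandLimited S φ) (x y : SU2) :
    ∫ b, φ ![x, y, b] ^ 2 ∂haar ≤ windowDelta S 1 * ∫ g, φ g ^ 2 ∂haarPow (Fin 3) := by
  have hc := h.continuous
  have h1 : ∀ b, φ ![x, y, b] ^ 2 ≤ windowDelta S 1 * ∫ s, φ ![y, b, s] ^ 2 ∂haar := by
    intro b
    refine (h.sq_le ![x, y, b] 0).trans_eq ?_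
    congr 2
    funext s
    rw [← h.cyclic]
    congr 2
    funext i
    fin_cases i <;> rfl
  rw [← h.integral_fix y, ← integral_const_mul]
  refine integral_mono (integrable_of_continuous (by fun_prop)) (integrable_of_continuous ?_) h1
  refine continuous_const.mul (continuous_integral_of_continuous ?_)
  fun_prop

end IsBandLimited

theorem integral_haarPow_perm {n : ℕ} (σ : Equiv.Perm (Fin n)) (f : (Fin n → SU2) → ℝ) :
    ∫ g, f (fun i => g (σ i)) ∂haarPow (Fin n) = ∫ g, f g ∂haarPow (Fin n) := by
  have h := measurePreserving_piCongrLeft (fun _ : Fin n => haar) σ.symm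
  have h2 := h.integral_comp (MeasurableEquiv.measurableEmbedding _) f
  rw [← h2]
  congr 1
  funext g
  congr 1
  funext i
  have := Equiv.piCongrLeft_apply_apply (fun _ : Fin n => SU2) σ.symm g (σ i)
  rw [Equiv.symm_apply_apply] at this
  exact this.symm

/-- Parseval's identity for finite combinations of basis functions. -/
theorem CovarianceBasis.integral_sum_sq {S : Finset ℕ} {m : ℕ} (F : CovarianceBasis S m)
    (x : Fin m → ℝ) :
    ∫ g, (∑ a, x a * F.toFun a g) ^ 2 ∂haarPow (Fin 3) = ∑ a, x a ^ 2 := by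
  have h : ∀ g, (∑ a, x a * F.toFun a g) ^ 2
      = ∑ a, ∑ b, x a * x b * (F.toFun a g * F.toFun b g) := by
    intro g
    rw [sq, Finset.sum_mul_sum]
    exact Finset.sum_congr rfl fun a _ => Finset.sum_congr rfl fun b _ => by ring
  simp only [h]
  rw [integral_finsetSum _ fun a _ => integrable_of_continuous (by fun_prop)]
  have i1 : ∀ a b, Integrable (fun g => x a * x b * (F.toFun a g * F.toFun b g))
      (haarPow (Fin 3)) := fun a b => integrable_of_continuous (by fun_prop)
  simp only [integral_finsetSum _ fun b _ => i1 _ b, integral_const_mul, F.integral_mul]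
  simp [sq]

/-! ### The pillow matrix -/

section Pillow

variable {S : Finset ℕ} {m : ℕ} (F : CovarianceBasis S m)

/-- Half of a pillow: two fields sharing two of their arguments. -/
noncomputable def pillowHalf (p : Fin m × Fin m) (a b : SU2) : ℝ :=
  ∫ x, ∫ y, F.toFun p.1 ![x, y, a] * F.toFun p.2 ![x, y, b] ∂haar ∂haar

theorem continuous_pillowHalf (p : Fin m × Fin m) :
    Continuous fun z : SU2 × SU2 => pillowHalf F p z.1 z.2 := by
  unfold pillowHalf
  refine continuous_integral_of_continuous (continuous_integral_of_continuous ?_)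
  fun_prop

/-- A pillow is the `L²` product of its two halves. -/
theorem pillowMatrix_apply (p q : Fin m × Fin m) :
    pillowMatrix (vertexTensor F pillowPattern) p q
      = ∫ a, ∫ b, pillowHalf F p a b * pillowHalf F q a b ∂haar ∂haar := by
  -- the variables are put in the order `g 2, g 5, g 0, g 1, g 3, g 4`
  rw [pillowMatrix, Matrix.of_apply, vertexTensor,
    ← integral_haarPow_perm (⟨![2, 3, 0, 4, 5, 1], ![2, 5, 0, 1, 3, 4], by decide, by decide⟩ :
      Equiv.Perm (Fin 6)), integral_haarPow_six (by fun_prop)]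
  refine integral_congr_ae (.of_forall fun a => integral_congr_ae (.of_forall fun b => ?_))
  beta_reduce
  have h : ∀ x y x' y' : SU2, ∏ l, F.toFun ((![p.1, q.1, p.2, q.2] : Fin 4 → Fin m) l)
        (fun i => (![a, b, x, y, x', y'] : Fin 6 → SU2)
          ((⟨![2, 3, 0, 4, 5, 1], ![2, 5, 0, 1, 3, 4], by decide, by decide⟩ :
            Equiv.Perm (Fin 6)) (pillowPattern l i)))
      = (F.toFun p.1 ![x, y, a] * F.toFun p.2 ![x, y, b])
        * (F.toFun q.1 ![x', y', a] * F.toFun q.2 ![x', y', b]) := by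
    intro x y x' y'
    rw [← (F.isBandLimited q.1).cyclic, ← (F.isBandLimited q.2).cyclic, Fin.prod_univ_four]
    have e0 : (fun i => (![a, b, x, y, x', y'] : Fin 6 → SU2)
          ((⟨![2, 3, 0, 4, 5, 1], ![2, 5, 0, 1, 3, 4], by decide, by decide⟩ :
            Equiv.Perm (Fin 6)) (pillowPattern 0 i))) = ![x, y, a] := by
      funext i; fin_cases i <;> rfl
    have e1 : (fun i => (![a, b, x, y, x', y'] : Fin 6 → SU2)
          ((⟨![2, 3, 0, 4, 5, 1], ![2, 5, 0, 1, 3, 4], by decide, by decide⟩ :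
            Equiv.Perm (Fin 6)) (pillowPattern 1 i))) = ![a, x', y'] := by
      funext i; fin_cases i <;> rfl
    have e2 : (fun i => (![a, b, x, y, x', y'] : Fin 6 → SU2)
          ((⟨![2, 3, 0, 4, 5, 1], ![2, 5, 0, 1, 3, 4], by decide, by decide⟩ :
            Equiv.Perm (Fin 6)) (pillowPattern 2 i))) = ![x, y, b] := by
      funext i; fin_cases i <;> rfl
    have e3 : (fun i => (![a, b, x, y, x', y'] : Fin 6 → SU2)
          ((⟨![2, 3, 0, 4, 5, 1], ![2, 5, 0, 1, 3, 4], by decide, by decide⟩ :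
            Equiv.Perm (Fin 6)) (pillowPattern 3 i))) = ![b, x', y'] := by
      funext i; fin_cases i <;> rfl
    rw [e0, e1, e2, e3]
    simp
    ring
  simp only [h, integral_const_mul, integral_mul_const, pillowHalf]

theorem pillowMatrix_isHermitian :
    (pillowMatrix (vertexTensor F pillowPattern)).IsHermitian := by
  ext p q
  simp only [Matrix.conjTranspose_apply, star_trivial, pillowMatrix_apply, mul_comm]

theorem dotProduct_pillowMatrix_mulVec (x : Fin m × Fin m → ℝ) :
    x ⬝ᵥ (pillowMatrix (vertexTensor F pillowPattern)).mulVec x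
      = ∫ a, ∫ b, (∑ p, x p * pillowHalf F p a b) ^ 2 ∂haar ∂haar := by
  have hc := fun p => continuous_pillowHalf F p
  have hc1 : ∀ (p : Fin m × Fin m) (a : SU2), Continuous fun b => pillowHalf F p a b :=
    fun p a => (hc p).comp (by fun_prop : Continuous fun b => (a, b))
  have h : ∀ a b, (∑ p, x p * pillowHalf F p a b) ^ 2
      = ∑ p, ∑ q, x p * x q * (pillowHalf F p a b * pillowHalf F q a b) := by
    intro a b
    rw [sq, Finset.sum_mul_sum]
    exact Finset.sum_congr rfl fun p _ => Finset.sum_congr rfl fun q _ => by ring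
  have i1 : ∀ a p q, Integrable
      (fun b => x p * x q * (pillowHalf F p a b * pillowHalf F q a b)) haar := fun a p q =>
    integrable_of_continuous (continuous_const.mul ((hc1 p a).mul (hc1 q a)))
  have i2 : ∀ p q, Integrable
      (fun a => x p * x q * ∫ b, pillowHalf F p a b * pillowHalf F q a b ∂haar) haar := fun p q =>
    integrable_of_continuous (continuous_const.mul
      (continuous_integral_of_continuous ((hc p).mul (hc q))))
  simp only [h, integral_finsetSum _ fun p _ => integrable_finsetSum _ fun q _ => i1 _ p q,
    integral_finsetSum _ fun q _ => i1 _ _ q, integral_const_mul]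
  rw [integral_finsetSum _ fun p _ => integrable_finsetSum _ fun q _ => i2 p q]
  simp only [integral_finsetSum _ fun q _ => i2 _ q, integral_const_mul, ← pillowMatrix_apply,
    dotProduct, Matrix.mulVec, Finset.mul_sum]
  exact Finset.sum_congr rfl fun p _ => Finset.sum_congr rfl fun q _ => by ring

theorem dotProduct_pillowMatrix_mulVec_nonneg (x : Fin m × Fin m → ℝ) :
    0 ≤ x ⬝ᵥ (pillowMatrix (vertexTensor F pillowPattern)).mulVec x := by
  rw [dotProduct_pillowMatrix_mulVec]
  exact integral_nonneg fun a => integral_nonneg fun b => sq_nonneg _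

/-- A combination of products of two fields. -/
noncomputable def pairField (x : Fin m × Fin m → ℝ) (z z' : Fin 3 → SU2) : ℝ :=
  ∑ p : Fin m × Fin m, x p * (F.toFun p.1 z * F.toFun p.2 z')

theorem continuous_pairField (x : Fin m × Fin m → ℝ) {X : Type*} [TopologicalSpace X]
    {z z' : X → Fin 3 → SU2} (h : Continuous z) (h' : Continuous z') :
    Continuous fun t => pairField F x (z t) (z' t) := by
  unfold pairField
  fun_prop

theorem isBandLimited_pairField (x : Fin m × Fin m → ℝ) (z : Fin 3 → SU2) :
    IsBandLimited S (pairField F x z) := by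
  have := IsBandLimited.sum (fun p : Fin m × Fin m => F.isBandLimited p.2)
    (fun p => x p * F.toFun p.1 z)
  simp only [mul_assoc] at this
  exact this

theorem pairField_cyclic (x : Fin m × Fin m → ℝ) (w y a : SU2) :
    pairField F x ![w, y, a] = pairField F x ![a, w, y] := by
  funext z'
  simp only [pairField, ← (F.isBandLimited _).cyclic a w y]

theorem integral_pairField_sq (x : Fin m × Fin m → ℝ) :
    ∫ z, ∫ z', pairField F x z z' ^ 2 ∂haarPow (Fin 3) ∂haarPow (Fin 3) = x ⬝ᵥ x := by
  have h1 : ∀ z z', pairField F x z z'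
      = ∑ b, (∑ a, x (a, b) * F.toFun a z) * F.toFun b z' := by
    intro z z'
    simp only [pairField]
    rw [Fintype.sum_prod_type_right]
    simp only [Finset.sum_mul, mul_assoc]
  simp only [h1, F.integral_sum_sq]
  rw [integral_finsetSum _ fun b _ => integrable_of_continuous (by fun_prop)]
  simp only [F.integral_sum_sq]
  rw [dotProduct, Fintype.sum_prod_type_right]
  simp only [sq]

theorem sum_mul_pillowHalf (x : Fin m × Fin m → ℝ) (a b : SU2) :
    ∑ p, x p * pillowHalf F p a b
      = ∫ w, ∫ y, pairField F x ![w, y, a] ![w, y, b] ∂haar ∂haar := by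
  simp only [pairField]
  have i1 : ∀ w (p : Fin m × Fin m), Integrable
      (fun y => x p * (F.toFun p.1 ![w, y, a] * F.toFun p.2 ![w, y, b])) haar := fun w p =>
    integrable_of_continuous (by fun_prop)
  have i2 : ∀ p : Fin m × Fin m, Integrable
      (fun w => x p * ∫ y, F.toFun p.1 ![w, y, a] * F.toFun p.2 ![w, y, b] ∂haar) haar :=
    fun p => integrable_of_continuous (continuous_const.mul
      (continuous_integral_of_continuous (by fun_prop)))
  simp only [integral_finsetSum _ fun p _ => i1 _ p, integral_const_mul]
  rw [integral_finsetSum _ fun p _ => i2 p]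
  simp only [integral_const_mul, pillowHalf]

theorem continuous_pairField_shared (x : Fin m × Fin m → ℝ) {X : Type*} [TopologicalSpace X]
    {w y a b : X → SU2} (hw : Continuous w) (hy : Continuous y) (ha : Continuous a)
    (hb : Continuous b) :
    Continuous fun t => pairField F x ![w t, y t, a t] ![w t, y t, b t] :=
  continuous_pairField F x (by fun_prop) (by fun_prop)

theorem sum_mul_pillowHalf_sq_le (x : Fin m × Fin m → ℝ) (a b : SU2) :
    (∑ p, x p * pillowHalf F p a b) ^ 2
      ≤ ∫ w, ∫ y, pairField F x ![w, y, a] ![w, y, b] ^ 2 ∂haar ∂haar := by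
  have c := @continuous_pairField_shared S m F x
  rw [sum_mul_pillowHalf]
  refine (sq_integral_le (μ := haar) (continuous_integral_of_continuous (ν := haar)
    (c (by fun_prop) (by fun_prop) (by fun_prop) (by fun_prop)))).trans ?_
  refine integral_mono (integrable_of_continuous ((continuous_integral_of_continuous
    (c (by fun_prop) (by fun_prop) (by fun_prop) (by fun_prop))).pow 2))
    (integrable_of_continuous (continuous_integral_of_continuous
      ((c (by fun_prop) (by fun_prop) (by fun_prop) (by fun_prop)).pow 2))) fun w => ?_
  exact sq_integral_le (c (by fun_prop) (by fun_prop) (by fun_prop) (by fun_prop))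

theorem continuous_integral_pairField_sq (x : Fin m × Fin m → ℝ) :
    Continuous fun z => ∫ z', pairField F x z z' ^ 2 ∂haarPow (Fin 3) :=
  continuous_integral_of_continuous
    ((continuous_pairField F x continuous_fst continuous_snd).pow 2)

/-- Of the two coinciding arguments, one is free and the other one costs a factor `δ(1)`. -/
theorem integral_pairField_contracted_le (x : Fin m × Fin m → ℝ) (a : SU2) :
    ∫ b, ∫ w, ∫ y, pairField F x ![w, y, a] ![w, y, b] ^ 2 ∂haar ∂haar ∂haar
      ≤ ∫ w, ∫ y, windowDelta S 1 * ∫ z', pairField F x ![a, w, y] z' ^ 2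
        ∂haarPow (Fin 3) ∂haar ∂haar := by
  have c := @continuous_pairField_shared S m F x
  have c6 := continuous_integral_pairField_sq F x
  rw [integral_swap (continuous_integral_of_continuous
    ((c (by fun_prop) (by fun_prop) (by fun_prop) (by fun_prop)).pow 2))]
  refine integral_mono (integrable_of_continuous (continuous_integral_of_continuous
    (continuous_integral_of_continuous
      ((c (by fun_prop) (by fun_prop) (by fun_prop) (by fun_prop)).pow 2))))
    (integrable_of_continuous (continuous_integral_of_continuous
      (continuous_const.mul (c6.comp (by fun_prop))))) fun w => ?_
  beta_reduce
  rw [integral_swap ((c (by fun_prop) (by fun_prop) (by fun_prop) (by fun_prop)).pow 2)]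
  refine integral_mono (integrable_of_continuous (continuous_integral_of_continuous
      ((c (by fun_prop) (by fun_prop) (by fun_prop) (by fun_prop)).pow 2)))
    (integrable_of_continuous (continuous_const.mul (c6.comp (by fun_prop)))) fun y => ?_
  beta_reduce
  rw [← pairField_cyclic F x w y a]
  exact (isBandLimited_pairField F x _).integral_fix_fix_le w y

/-- The eigenvalues of the pillow are at most `δ(1)`. -/
theorem dotProduct_pillowMatrix_mulVec_le (x : Fin m × Fin m → ℝ) :
    x ⬝ᵥ (pillowMatrix (vertexTensor F pillowPattern)).mulVec x
      ≤ windowDelta S 1 * (x ⬝ᵥ x) := by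
  have c := @continuous_pairField_shared S m F x
  have c6 := continuous_integral_pairField_sq F x
  have cH : Continuous fun z : SU2 × SU2 => (∑ p, x p * pillowHalf F p z.1 z.2) ^ 2 :=
    (continuous_finsetSum _ fun p _ => continuous_const.mul (continuous_pillowHalf F p)).pow 2
  have c7 : Continuous fun t : (SU2 × SU2) × SU2 =>
      ∫ z', pairField F x ![t.1.1, t.1.2, t.2] z' ^ 2 ∂haarPow (Fin 3) :=
    c6.comp (f := fun t : (SU2 × SU2) × SU2 => (![t.1.1, t.1.2, t.2] : Fin 3 → SU2)) (by fun_prop)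
  have c8 : Continuous fun a : SU2 => ∫ w, ∫ y,
      ∫ z', pairField F x ![a, w, y] z' ^ 2 ∂haarPow (Fin 3) ∂haar ∂haar :=
    continuous_integral_of_continuous (continuous_integral_of_continuous
      (f := fun (t : SU2 × SU2) y => ∫ z', pairField F x ![t.1, t.2, y] z' ^ 2
        ∂haarPow (Fin 3)) c7)
  have c9 : ∀ a : SU2, Continuous fun b : SU2 => ∫ w, ∫ y,
      pairField F x ![w, y, a] ![w, y, b] ^ 2 ∂haar ∂haar := fun a =>
    continuous_integral_of_continuous (continuous_integral_of_continuous
      ((c (by fun_prop) (by fun_prop) (by fun_prop) (by fun_prop)).pow 2))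
  have h : ∀ a, ∫ b, (∑ p, x p * pillowHalf F p a b) ^ 2 ∂haar ≤ windowDelta S 1 *
      ∫ w, ∫ y, ∫ z', pairField F x ![a, w, y] z' ^ 2 ∂haarPow (Fin 3) ∂haar ∂haar := by
    intro a
    have e4 := integral_pairField_contracted_le F x a
    simp only [integral_const_mul] at e4
    exact (integral_mono (integrable_of_continuous (cH.comp (Continuous.prodMk_right a)))
      (integrable_of_continuous (c9 a)) fun b => sum_mul_pillowHalf_sq_le F x a b).trans e4
  rw [dotProduct_pillowMatrix_mulVec, ← integral_pairField_sq F x, integral_haarPow_three c6,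
    ← integral_const_mul]
  exact integral_mono (integrable_of_continuous (continuous_integral_of_continuous cH))
    (integrable_of_continuous (continuous_const.mul c8)) h

end Pillow

/-! ### Pairs of Boulatov vertices -/

section Boulatov

variable {S : Finset ℕ} {m : ℕ} (F : CovarianceBasis S m)

theorem sum_fin_three_fun {ι : Type*} [Fintype ι] (f : (Fin 3 → ι) → ℝ) :
    ∑ t, f t = ∑ a, ∑ b, ∑ c, f ![a, b, c] := by
  rw [← (Fin.consEquiv fun _ => ι).sum_comp, Fintype.sum_prod_type]
  refine Finset.sum_congr rfl fun a _ => ?_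
  rw [← (Fin.consEquiv fun _ => ι).sum_comp, Fintype.sum_prod_type]
  refine Finset.sum_congr rfl fun b _ => ?_
  rw [← (Fin.consEquiv fun _ => ι).sum_comp, Fintype.sum_prod_type]
  refine Finset.sum_congr rfl fun c _ => ?_
  rw [Fintype.sum_unique]
  rfl

theorem doubleVertexMatrix_isHermitian {d : ℕ} (V : (Fin 4 → Fin d) → ℝ) :
    (doubleVertexMatrix V).IsHermitian := by
  ext α β
  simp only [Matrix.conjTranspose_apply, star_trivial, doubleVertexMatrix, Matrix.of_apply,
    mul_comm]

theorem dotProduct_doubleVertexMatrix_mulVec {d : ℕ} (V : (Fin 4 → Fin d) → ℝ) (x : Fin d → ℝ) :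
    x ⬝ᵥ (doubleVertexMatrix V).mulVec x = ∑ t, (∑ α, x α * V (Fin.cons α t)) ^ 2 := by
  simp only [dotProduct, Matrix.mulVec, doubleVertexMatrix, Matrix.of_apply, sq,
    Finset.mul_sum, Finset.sum_mul]
  rw [Finset.sum_comm_cycle]
  refine Finset.sum_congr rfl fun t _ => Finset.sum_congr rfl fun α _ =>
    Finset.sum_congr rfl fun β _ => by ring

theorem dotProduct_doubleVertexMatrix_mulVec_nonneg {d : ℕ} (V : (Fin 4 → Fin d) → ℝ)
    (x : Fin d → ℝ) : 0 ≤ x ⬝ᵥ (doubleVertexMatrix V).mulVec x := by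
  rw [dotProduct_doubleVertexMatrix_mulVec]
  positivity

/-- Three fields forming a Boulatov vertex with a fourth one. -/
noncomputable def tripleField (y : (Fin 3 → Fin m) → ℝ) (z₁ z₂ z₃ : Fin 3 → SU2) : ℝ :=
  ∑ t, y t * (F.toFun (t 0) z₁ * F.toFun (t 1) z₂ * F.toFun (t 2) z₃)

theorem integral_tripleField_sq (y : (Fin 3 → Fin m) → ℝ) :
    ∫ z₁, ∫ z₃, ∫ z₂, tripleField F y z₁ z₂ z₃ ^ 2
      ∂haarPow (Fin 3) ∂haarPow (Fin 3) ∂haarPow (Fin 3) = ∑ t, y t ^ 2 := by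
  have h1 : ∀ z₁ z₂ z₃, tripleField F y z₁ z₂ z₃
      = ∑ b, (∑ c, (∑ a, y ![a, b, c] * F.toFun a z₁) * F.toFun c z₃) * F.toFun b z₂ := by
    intro z₁ z₂ z₃
    rw [tripleField, sum_fin_three_fun]
    simp only [Finset.sum_mul]
    rw [Finset.sum_comm]
    refine Finset.sum_congr rfl fun b _ => ?_
    rw [Finset.sum_comm]
    refine Finset.sum_congr rfl fun c _ => Finset.sum_congr rfl fun a _ => ?_
    simp
    ring
  simp only [h1, F.integral_sum_sq]
  have i1 : ∀ z₁ b, Integrable (fun z₃ => (∑ c, (∑ a, y ![a, b, c] * F.toFun a z₁)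
      * F.toFun c z₃) ^ 2) (haarPow (Fin 3)) := fun z₁ b =>
    integrable_of_continuous (by fun_prop)
  simp only [integral_finsetSum _ fun b _ => i1 _ b, F.integral_sum_sq]
  have i2 : ∀ b c, Integrable (fun z₁ => (∑ a, y ![a, b, c] * F.toFun a z₁) ^ 2)
      (haarPow (Fin 3)) := fun b c => integrable_of_continuous (by fun_prop)
  rw [integral_finsetSum _ fun b _ => integrable_finsetSum _ fun c _ => i2 b c]
  simp only [integral_finsetSum _ fun c _ => i2 _ c, F.integral_sum_sq]
  rw [sum_fin_three_fun]
  exact Finset.sum_comm_cycle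

theorem continuous_tripleField (y : (Fin 3 → Fin m) → ℝ) {X : Type*} [TopologicalSpace X]
    {z₁ z₂ z₃ : X → Fin 3 → SU2} (h₁ : Continuous z₁) (h₂ : Continuous z₂) (h₃ : Continuous z₃) :
    Continuous fun t => tripleField F y (z₁ t) (z₂ t) (z₃ t) := by
  unfold tripleField
  fun_prop

theorem isBandLimited_tripleField_two (y : (Fin 3 → Fin m) → ℝ) (z₁ z₃ : Fin 3 → SU2) :
    IsBandLimited S fun z₂ => tripleField F y z₁ z₂ z₃ := by
  have := IsBandLimited.sum (fun t : Fin 3 → Fin m => F.isBandLimited (t 1))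
    (fun t => y t * F.toFun (t 0) z₁ * F.toFun (t 2) z₃)
  convert this using 2 with z₂
  exact Finset.sum_congr rfl fun t _ => by ring

theorem isBandLimited_tripleField_three (y : (Fin 3 → Fin m) → ℝ) (z₁ z₂ : Fin 3 → SU2) :
    IsBandLimited S fun z₃ => tripleField F y z₁ z₂ z₃ := by
  have := IsBandLimited.sum (fun t : Fin 3 → Fin m => F.isBandLimited (t 2))
    (fun t => y t * F.toFun (t 0) z₁ * F.toFun (t 1) z₂)
  convert this using 2 with z₃
  exact Finset.sum_congr rfl fun t _ => by ring

theorem integral_tripleField_last_le (y : (Fin 3 → Fin m) → ℝ) (z₁ : Fin 3 → SU2)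
    (b c u : SU2) :
    ∫ v, ∫ w, tripleField F y z₁ ![c, u, v] ![v, b, w] ^ 2 ∂haar ∂haar
      ≤ windowDelta S 1 * ∫ v, ∫ z₃, tripleField F y z₁ ![c, u, v] z₃ ^ 2
        ∂haarPow (Fin 3) ∂haar := by
  have cT := @continuous_tripleField S m F y
  have c1 : Continuous fun v => ∫ w, tripleField F y z₁ ![c, u, v] ![v, b, w] ^ 2 ∂haar :=
    continuous_integral_of_continuous
      (f := fun v w => tripleField F y z₁ ![c, u, v] ![v, b, w] ^ 2)
      ((cT (by fun_prop) (by fun_prop) (by fun_prop)).pow 2)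
  have c2 : Continuous fun v => ∫ z₃, tripleField F y z₁ ![c, u, v] z₃ ^ 2 ∂haarPow (Fin 3) :=
    continuous_integral_of_continuous
      (f := fun v z₃ => tripleField F y z₁ ![c, u, v] z₃ ^ 2)
      ((cT (by fun_prop) (by fun_prop) (by fun_prop)).pow 2)
  rw [← integral_const_mul]
  exact integral_mono (integrable_of_continuous c1)
    (integrable_of_continuous (continuous_const.mul c2)) fun v =>
      (isBandLimited_tripleField_three F y z₁ ![c, u, v]).integral_fix_fix_le v b

theorem integral_tripleField_middle (y : (Fin 3 → Fin m) → ℝ) (z₁ : Fin 3 → SU2) (c : SU2) :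
    ∫ u, ∫ v, ∫ z₃, tripleField F y z₁ ![c, u, v] z₃ ^ 2 ∂haarPow (Fin 3) ∂haar ∂haar
      = ∫ z₃, ∫ z₂, tripleField F y z₁ z₂ z₃ ^ 2 ∂haarPow (Fin 3) ∂haarPow (Fin 3) := by
  have cT := @continuous_tripleField S m F y
  have h2 : ∀ u, ∫ v, ∫ z₃, tripleField F y z₁ ![c, u, v] z₃ ^ 2 ∂haarPow (Fin 3) ∂haar
      = ∫ z₃, ∫ v, tripleField F y z₁ ![c, u, v] z₃ ^ 2 ∂haar ∂haarPow (Fin 3) :=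
    fun u => integral_swap (f := fun v z₃ => tripleField F y z₁ ![c, u, v] z₃ ^ 2)
      ((cT (by fun_prop) (by fun_prop) (by fun_prop)).pow 2)
  have c3 : Continuous fun p : SU2 × (Fin 3 → SU2) =>
      ∫ v, tripleField F y z₁ ![c, p.1, v] p.2 ^ 2 ∂haar :=
    continuous_integral_of_continuous
      (f := fun (p : SU2 × (Fin 3 → SU2)) v => tripleField F y z₁ ![c, p.1, v] p.2 ^ 2)
      ((cT (by fun_prop) (by fun_prop) (by fun_prop)).pow 2)
  simp only [h2]
  rw [integral_swap (f := fun u z₃ => ∫ v, tripleField F y z₁ ![c, u, v] z₃ ^ 2 ∂haar) c3]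
  exact integral_congr_ae (.of_forall fun z₃ =>
    (isBandLimited_tripleField_two F y z₁ z₃).integral_fix c)

theorem integral_tripleField_two_le (y : (Fin 3 → Fin m) → ℝ) (z₁ : Fin 3 → SU2) (b c : SU2) :
    ∫ u, ∫ v, ∫ w, tripleField F y z₁ ![c, u, v] ![v, b, w] ^ 2 ∂haar ∂haar ∂haar
      ≤ windowDelta S 1 * ∫ z₃, ∫ z₂, tripleField F y z₁ z₂ z₃ ^ 2
        ∂haarPow (Fin 3) ∂haarPow (Fin 3) := by
  have cT := @continuous_tripleField S m F y
  have c1 : Continuous fun p : SU2 × SU2 =>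
      ∫ w, tripleField F y z₁ ![c, p.1, p.2] ![p.2, b, w] ^ 2 ∂haar :=
    continuous_integral_of_continuous
      (f := fun (p : SU2 × SU2) w => tripleField F y z₁ ![c, p.1, p.2] ![p.2, b, w] ^ 2)
      ((cT (by fun_prop) (by fun_prop) (by fun_prop)).pow 2)
  have c2 : Continuous fun p : SU2 × SU2 =>
      ∫ z₃, tripleField F y z₁ ![c, p.1, p.2] z₃ ^ 2 ∂haarPow (Fin 3) :=
    continuous_integral_of_continuous
      (f := fun (p : SU2 × SU2) z₃ => tripleField F y z₁ ![c, p.1, p.2] z₃ ^ 2)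
      ((cT (by fun_prop) (by fun_prop) (by fun_prop)).pow 2)
  rw [← integral_tripleField_middle F y z₁ c, ← integral_const_mul]
  exact integral_mono (integrable_of_continuous (continuous_integral_of_continuous c1))
    (integrable_of_continuous (continuous_const.mul (continuous_integral_of_continuous c2)))
    (integral_tripleField_last_le F y z₁ b c)

theorem continuous_integral_three {Z : Type*} [TopologicalSpace Z] [FirstCountableTopology Z]
    [LocallyCompactSpace Z] {f : Z → SU2 → SU2 → SU2 → ℝ}
    (hf : Continuous fun p : ((Z × SU2) × SU2) × SU2 => f p.1.1.1 p.1.1.2 p.1.2 p.2) :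
    Continuous fun z => ∫ u, ∫ v, ∫ w, f z u v w ∂haar ∂haar ∂haar :=
  continuous_integral_of_continuous (continuous_integral_of_continuous
    (f := fun (p : Z × SU2) v => ∫ w, f p.1 p.2 v w ∂haar)
    (continuous_integral_of_continuous
      (f := fun (p : (Z × SU2) × SU2) w => f p.1.1 p.1.2 p.2 w) hf))

theorem integral_three_mono {f g : (Fin 3 → SU2) → ℝ} (hf : Continuous f) (hg : Continuous g)
    (h : ∀ z, f z ≤ g z) :
    ∫ a, ∫ b, ∫ c, f ![a, b, c] ∂haar ∂haar ∂haar ≤ ∫ z, g z ∂haarPow (Fin 3) := by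
  rw [← integral_haarPow_three hf]
  exact integral_mono (integrable_of_continuous hf) (integrable_of_continuous hg) h

/-- Contracting three fields along their three common variables in a Boulatov vertex: one of the
variables of the second field is identified for free, and the two of the third field cost a factor
`δ(1)`. -/
theorem integral_tripleField_contracted_le (y : (Fin 3 → Fin m) → ℝ) :
    ∫ g, tripleField F y ![g 2, g 3, g 4] ![g 4, g 1, g 5] ![g 5, g 3, g 0] ^ 2 ∂haarPow (Fin 6)
      ≤ windowDelta S 1 * ∑ t, y t ^ 2 := by
  have cT := @continuous_tripleField S m F y
  rw [← integral_haarPow_perm (⟨![5, 3, 0, 1, 2, 4], ![2, 3, 4, 1, 5, 0], by decide, by decide⟩ :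
      Equiv.Perm (Fin 6))]
  -- the variables are now in the order `g 2, g 3, g 4, g 1, g 5, g 0`
  refine (integral_haarPow_six (f := fun g => tripleField F y ![g 0, g 1, g 2]
    ![g 2, g 3, g 4] ![g 4, g 1, g 5] ^ 2) ((cT (by fun_prop) (by fun_prop)
      (by fun_prop)).pow 2)).trans_le ?_
  have c1 : Continuous fun p : (Fin 3 → SU2) × (Fin 3 → SU2) =>
      ∫ z₂, tripleField F y p.1 z₂ p.2 ^ 2 ∂haarPow (Fin 3) :=
    continuous_integral_of_continuous
      (f := fun (p : (Fin 3 → SU2) × (Fin 3 → SU2)) z₂ => tripleField F y p.1 z₂ p.2 ^ 2)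
      ((cT (by fun_prop) (by fun_prop) (by fun_prop)).pow 2)
  have c2 : Continuous fun z₁ => ∫ z₃, ∫ z₂, tripleField F y z₁ z₂ z₃ ^ 2
      ∂haarPow (Fin 3) ∂haarPow (Fin 3) := continuous_integral_of_continuous c1
  have c3 : Continuous fun p : (((Fin 3 → SU2) × SU2) × SU2) × SU2 => tripleField F y
      p.1.1.1 ![p.1.1.1 2, p.1.1.2, p.1.2] ![p.1.2, p.1.1.1 1, p.2] ^ 2 :=
    (cT (by fun_prop) (by fun_prop) (by fun_prop)).pow 2
  have c4 := continuous_integral_three (f := fun z₁ u v w =>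
    tripleField F y z₁ ![z₁ 2, u, v] ![v, z₁ 1, w] ^ 2) c3
  have h := integral_three_mono c4 (c2.const_mul (windowDelta S 1))
    fun z₁ => integral_tripleField_two_le F y z₁ (z₁ 1) (z₁ 2)
  rw [integral_const_mul, integral_tripleField_sq] at h
  exact h

theorem sum_vertexTensor_cons (x : Fin m → ℝ) (y : (Fin 3 → Fin m) → ℝ) :
    ∑ t, y t * ∑ α, x α * vertexTensor F boulatovPattern (Fin.cons α t)
      = ∫ g, (∑ α, x α * F.toFun α ![g 0, g 1, g 2])
        * tripleField F y ![g 2, g 3, g 4] ![g 4, g 1, g 5] ![g 5, g 3, g 0] ∂haarPow (Fin 6) := by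
  have h : ∀ g : Fin 6 → SU2, (∑ α, x α * F.toFun α ![g 0, g 1, g 2])
        * tripleField F y ![g 2, g 3, g 4] ![g 4, g 1, g 5] ![g 5, g 3, g 0]
      = ∑ t, ∑ α, y t * x α * ∏ l, F.toFun ((Fin.cons α t : Fin 4 → Fin m) l)
          (fun i => g (boulatovPattern l i)) := by
    intro g
    rw [tripleField, Finset.sum_mul_sum, Finset.sum_comm]
    refine Finset.sum_congr rfl fun t _ => Finset.sum_congr rfl fun α _ => ?_
    have e0 : (fun i => g (boulatovPattern 0 i)) = ![g 0, g 1, g 2] := by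
      funext i; fin_cases i <;> rfl
    have e1 : (fun i => g (boulatovPattern 1 i)) = ![g 2, g 3, g 4] := by
      funext i; fin_cases i <;> rfl
    have e2 : (fun i => g (boulatovPattern 2 i)) = ![g 4, g 1, g 5] := by
      funext i; fin_cases i <;> rfl
    have e3 : (fun i => g (boulatovPattern 3 i)) = ![g 5, g 3, g 0] := by
      funext i; fin_cases i <;> rfl
    have f1 : (Fin.cons α t : Fin 4 → Fin m) 1 = t 0 := rfl
    have f2 : (Fin.cons α t : Fin 4 → Fin m) 2 = t 1 := rfl
    have f3 : (Fin.cons α t : Fin 4 → Fin m) 3 = t 2 := rfl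
    rw [Fin.prod_univ_four, e0, e1, e2, e3, f1, f2, f3, Fin.cons_zero]
    ring
  have i1 : ∀ t α, Integrable (fun g : Fin 6 → SU2 => y t * x α *
      ∏ l, F.toFun ((Fin.cons α t : Fin 4 → Fin m) l) (fun i => g (boulatovPattern l i)))
      (haarPow (Fin 6)) := fun t α => integrable_of_continuous (by fun_prop)
  simp only [h]
  rw [integral_finsetSum _ fun t _ => integrable_finsetSum _ fun α _ => i1 t α]
  simp only [integral_finsetSum _ fun α _ => i1 _ α, integral_const_mul, vertexTensor,
    Finset.mul_sum]
  simp only [mul_assoc]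

theorem integral_sum_sq_three_of_six (x : Fin m → ℝ) :
    ∫ g, (∑ α, x α * F.toFun α ![g 0, g 1, g 2]) ^ 2 ∂haarPow (Fin 6) = x ⬝ᵥ x := by
  rw [integral_haarPow_six (by fun_prop)]
  have h := F.integral_sum_sq x
  rw [integral_haarPow_three (by fun_prop)] at h
  simp only [dotProduct, ← sq]
  rw [← h]
  simp

/-- The eigenvalues of a pair of Boulatov vertices are at most `δ(1)`. With `y` the contraction of `x`
with the vertex, `|y|²` is the `L²` product of the field `x` with three fields in the state `y`, so
that the Cauchy-Schwarz inequality bounds `|y|⁴` by a multiple of `|x|² |y|²`. -/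
theorem dotProduct_doubleVertexMatrix_mulVec_le (x : Fin m → ℝ) :
    x ⬝ᵥ (doubleVertexMatrix (vertexTensor F boulatovPattern)).mulVec x
      ≤ windowDelta S 1 * (x ⬝ᵥ x) := by
  set y : (Fin 3 → Fin m) → ℝ :=
    fun t => ∑ α, x α * vertexTensor F boulatovPattern (Fin.cons α t) with hy
  have h0 := dotProduct_doubleVertexMatrix_mulVec (vertexTensor F boulatovPattern) x
  have h1 := sum_vertexTensor_cons F x y
  have h2 := integral_tripleField_contracted_le F y
  have h3 := integral_sum_sq_three_of_six F x
  have cT := @continuous_tripleField S m F y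
  have h4 := sq_integral_mul_le (μ := haarPow (Fin 6))
    (f := fun g => ∑ α, x α * F.toFun α ![g 0, g 1, g 2])
    (g := fun g => tripleField F y ![g 2, g 3, g 4] ![g 4, g 1, g 5] ![g 5, g 3, g 0])
    (by fun_prop) (cT (by fun_prop) (by fun_prop) (by fun_prop))
  have hyy : ∑ t, y t * ∑ α, x α * vertexTensor F boulatovPattern (Fin.cons α t)
      = ∑ t, y t ^ 2 := Finset.sum_congr rfl fun t _ => by rw [sq]
  rw [← h1, h3, hyy] at h4
  change _ = ∑ t, y t ^ 2 at h0
  rw [h0]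
  have hx : 0 ≤ x ⬝ᵥ x := Finset.sum_nonneg fun i _ => mul_self_nonneg _
  have hD : 0 ≤ windowDelta S 1 := windowDelta_one_nonneg S
  have hs : 0 ≤ ∑ t, y t ^ 2 := Finset.sum_nonneg fun t _ => sq_nonneg _
  have h5 := h4.trans (mul_le_mul_of_nonneg_left h2 hx)
  rcases hs.eq_or_lt with h | h
  · rw [← h]; positivity
  · nlinarith

end Boulatov

/-! ### The ends of the chain of pillows -/

section Ends

variable {S : Finset ℕ} {m : ℕ} (F : CovarianceBasis S m)

theorem integral_windowDelta_mul_pillowHalf (p : Fin m × Fin m) (a b : SU2) :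
    ∫ s, windowDelta S (b * s⁻¹) * pillowHalf F p a s ∂haar = pillowHalf F p a b := by
  have c3 : Continuous fun q : (SU2 × SU2) × SU2 => windowDelta S (b * q.1.1⁻¹) *
      (F.toFun p.1 ![q.1.2, q.2, a] * F.toFun p.2 ![q.1.2, q.2, q.1.1]) := by fun_prop
  have c2 : Continuous fun q : SU2 × SU2 => ∫ y, windowDelta S (b * q.1⁻¹) *
      (F.toFun p.1 ![q.2, y, a] * F.toFun p.2 ![q.2, y, q.1]) ∂haar :=
    continuous_integral_of_continuous (f := fun (q : SU2 × SU2) y => windowDelta S (b * q.1⁻¹) *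
      (F.toFun p.1 ![q.2, y, a] * F.toFun p.2 ![q.2, y, q.1])) c3
  have c1 : ∀ x, Continuous fun q : SU2 × SU2 => windowDelta S (b * q.1⁻¹) *
      (F.toFun p.1 ![x, q.2, a] * F.toFun p.2 ![x, q.2, q.1]) := fun x => by fun_prop
  simp only [pillowHalf, ← integral_const_mul]
  rw [integral_swap (f := fun s x => ∫ y, windowDelta S (b * s⁻¹) *
      (F.toFun p.1 ![x, y, a] * F.toFun p.2 ![x, y, s]) ∂haar) c2]
  refine integral_congr_ae (.of_forall fun x => ?_)
  beta_reduce
  rw [integral_swap (f := fun s y => windowDelta S (b * s⁻¹) *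
      (F.toFun p.1 ![x, y, a] * F.toFun p.2 ![x, y, s])) (c1 x)]
  refine integral_congr_ae (.of_forall fun y => ?_)
  beta_reduce
  simp only [mul_left_comm (windowDelta S _)]
  rw [integral_const_mul]
  congr 1
  have h := F.integral_windowDelta_mul_toFun p.2 ![x, y, b] 2
  have e : ∀ s, Function.update ![x, y, b] 2 s = ![x, y, s] := by
    intro s
    funext i
    fin_cases i <;> rfl
  simp only [e] at h
  exact h

theorem integral_pillowHalf_diagonal :
    ∫ a, ∑ p, diagonalVector m p * pillowHalf F p a a ∂haar = m := by
  have h1 : ∀ a, ∑ p, diagonalVector m p * pillowHalf F p a a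
      = ∑ α, pillowHalf F (α, α) a a := by
    intro a
    rw [Fintype.sum_prod_type]
    simp [diagonalVector]
  have hc : ∀ α : Fin m, Continuous fun a => pillowHalf F (α, α) a a := fun α =>
    (continuous_pillowHalf F (α, α)).comp (by fun_prop : Continuous fun a => (a, a))
  have h2 : ∀ α, ∫ a, pillowHalf F (α, α) a a ∂haar = 1 := by
    intro α
    have h3 := F.integral_mul α α
    rw [if_pos rfl] at h3
    rw [← h3, integral_haarPow_three (by fun_prop)]
    refine integral_congr_ae (.of_forall fun a => ?_)
    refine integral_congr_ae (.of_forall fun x => ?_)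
    refine integral_congr_ae (.of_forall fun y => ?_)
    beta_reduce
    rw [← (F.isBandLimited α).cyclic a x y]
  simp only [h1]
  rw [integral_finsetSum _ fun α _ => integrable_of_continuous (hc α)]
  simp [h2]

theorem sum_pillowHalf_eq_integral (x : Fin m × Fin m → ℝ) (a b : SU2) :
    ∑ p, x p * pillowHalf F p a b
      = ∫ s, windowDelta S (b * s⁻¹) * ∑ p, x p * pillowHalf F p a s ∂haar := by
  have cd : Continuous fun s : SU2 => windowDelta S (b * s⁻¹) := by fun_prop
  have i1 : ∀ p, Integrable (fun s => x p *
      (windowDelta S (b * s⁻¹) * pillowHalf F p a s)) haar := fun p =>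
    integrable_of_continuous (continuous_const.mul (cd.mul
      ((continuous_pillowHalf F p).comp (Continuous.prodMk_right a))))
  simp only [Finset.mul_sum, mul_left_comm (windowDelta S _)]
  rw [integral_finsetSum _ fun p _ => i1 p]
  simp only [integral_const_mul, integral_windowDelta_mul_pillowHalf]

theorem continuous_sum_pillowHalf (x : Fin m × Fin m → ℝ) :
    Continuous fun z : SU2 × SU2 => ∑ p, x p * pillowHalf F p z.1 z.2 :=
  continuous_finsetSum _ fun p _ => continuous_const.mul (continuous_pillowHalf F p)

theorem sum_pillowHalf_sq_le (x : Fin m × Fin m → ℝ) (a b : SU2) :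
    (∑ p, x p * pillowHalf F p a b) ^ 2
      ≤ windowDelta S 1 * ∫ s, (∑ p, x p * pillowHalf F p a s) ^ 2 ∂haar := by
  have cd : Continuous fun s : SU2 => windowDelta S (b * s⁻¹) := by fun_prop
  have c1 : Continuous fun s => ∑ p, x p * pillowHalf F p a s :=
    (continuous_sum_pillowHalf F x).comp (Continuous.prodMk_right a)
  rw [sum_pillowHalf_eq_integral]
  refine (sq_integral_mul_le cd c1).trans_eq ?_
  congr 1
  rw [← integral_windowDelta_sq S b 1, ← integral_inv_eq_self]
  simp

/-- The amplitude of the chain with a single pillow. The dimension `m` is the integral over the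
diagonal of a band-limited kernel, whose square norm is this amplitude. -/
theorem sq_card_le_dotProduct_pillowMatrix :
    (m : ℝ) ^ 2 ≤ windowDelta S 1 * (diagonalVector m ⬝ᵥ
      (pillowMatrix (vertexTensor F pillowPattern)).mulVec (diagonalVector m)) := by
  have c := continuous_sum_pillowHalf F (diagonalVector m)
  have cd : Continuous fun a => ∑ p, diagonalVector m p * pillowHalf F p a a :=
    c.comp (by fun_prop : Continuous fun a => (a, a))
  have h := sq_integral_le (μ := haar) cd
  rw [integral_pillowHalf_diagonal] at h
  refine h.trans ?_
  rw [dotProduct_pillowMatrix_mulVec, ← integral_const_mul]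
  exact integral_mono (integrable_of_continuous (cd.pow 2)) (integrable_of_continuous
    (continuous_const.mul (continuous_integral_of_continuous (c.pow 2))))
    fun a => sum_pillowHalf_sq_le F (diagonalVector m) a a

theorem dotProduct_diagonalVector (m : ℕ) : diagonalVector m ⬝ᵥ diagonalVector m = m := by
  rw [dotProduct, Fintype.sum_prod_type]
  simp [diagonalVector]

end Ends

/-! ### Windowed vertices -/

section Windowed

variable {S : Finset ℕ} {m : ℕ} (F : CovarianceBasis S m)

/-- The projection of a basis function onto the spins `A i` in its `i`-th argument. -/
noncomputable def windowedField (A : Fin 3 → Finset ℕ) (α : Fin m) (g : Fin 3 → SU2) : ℝ :=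
  ∫ x, invKernel A g x * F.toFun α x ∂haarPow (Fin 3)

@[fun_prop]
theorem continuous_windowedField (A : Fin 3 → Finset ℕ) (α : Fin m) :
    Continuous (windowedField F A α) := by
  unfold windowedField
  exact continuous_integral_of_continuous (by fun_prop)

theorem sum_windowedField_mul_toFun {A : Fin 3 → Finset ℕ} (hA : ∀ i, A i ⊆ S)
    (g k : Fin 3 → SU2) :
    ∑ α, windowedField F A α g * F.toFun α k
      = (1 / 3) * ∑ c : Fin 3, invKernel A g (fun i => k (i + c)) := by
  rw [← integral_invKernel_mul_realCovariance S A hA]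
  have i1 : ∀ α, Integrable (fun x => invKernel A g x * (F.toFun α x * F.toFun α k))
      (haarPow (Fin 3)) := fun α => integrable_of_continuous (by fun_prop)
  simp only [F.kernel_eq, Finset.mul_sum]
  rw [integral_finsetSum _ fun α _ => i1 α]
  simp only [← mul_assoc, integral_mul_const, windowedField]

theorem sum_windowedField_mul_self {A : Fin 3 → Finset ℕ} (hA : ∀ i, A i ⊆ S)
    (g k : Fin 3 → SU2) :
    ∑ α, windowedField F A α g * windowedField F A α k
      = (1 / 3) * ∑ c : Fin 3, invKernel (fun i => A i ∩ A (i - c)) k (fun i => g (i - c)) := by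
  have i1 : ∀ α, Integrable (fun x => invKernel A k x * (windowedField F A α g * F.toFun α x))
      (haarPow (Fin 3)) := fun α => integrable_of_continuous (by fun_prop)
  have h1 : ∀ α, windowedField F A α g * windowedField F A α k
      = ∫ x, invKernel A k x * (windowedField F A α g * F.toFun α x) ∂haarPow (Fin 3) := by
    intro α
    conv_lhs => rw [windowedField.eq_def F A α k, ← integral_const_mul]
    simp only [mul_left_comm]
  simp only [h1]
  rw [← integral_finsetSum _ fun α _ => i1 α]
  simp only [← Finset.mul_sum, sum_windowedField_mul_toFun F hA]
  have h2 : ∀ (x : Fin 3 → SU2) (c : Fin 3), invKernel A g (fun i => x (i + c))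
      = invKernel (fun i => A (i - c)) x (fun i => g (i - c)) := by
    intro x c
    rw [invKernel_comm, invKernel_shift_left]
  have i2 : ∀ c : Fin 3, Integrable (fun x => invKernel A k x
      * invKernel (fun i => A (i - c)) x (fun i => g (i - c))) (haarPow (Fin 3)) := fun c =>
    integrable_of_continuous (by fun_prop)
  simp only [h2, mul_left_comm _ (1 / 3 : ℝ), Finset.mul_sum]
  rw [integral_finsetSum _ fun c _ => (i2 c).const_mul _]
  simp only [integral_const_mul, integral_invKernel_mul]

/-- Disjoint windows leave only the trivial cyclic permutation. -/
theorem sum_windowedField_mul_self_of_disjoint {A : Fin 3 → Finset ℕ} (hA : ∀ i, A i ⊆ S)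
    (hd : ∀ i j, i ≠ j → Disjoint (A i) (A j)) (g k : Fin 3 → SU2) :
    ∑ α, windowedField F A α g * windowedField F A α k = (1 / 3) * invKernel A g k := by
  rw [sum_windowedField_mul_self F hA, Fintype.sum_eq_single 0]
  · simp [invKernel_comm]
  · intro c hc
    refine invKernel_eq_zero _ (i := 0) ?_ _ _
    exact Finset.disjoint_iff_inter_eq_empty.1 (hd _ _ fun h => hc (by simpa using h.symm))

/-- The Boulatov vertex with its six variables restricted to spins in the windows `J`. -/
noncomputable def windowedTensor (J : Fin 6 → Finset ℕ) (a : Fin 4 → Fin m) : ℝ :=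
  ∫ g, ∏ l, windowedField F (fun i => J (boulatovPattern l i)) (a l)
    (fun i => g (boulatovPattern l i)) ∂haarPow (Fin 6)

/-- Two families of fields, with their variables identified according to the pattern, summed over
the states of the lines joining them. -/
theorem sum_integral_prod_mul_integral_prod {φ ψ : Fin 4 → Fin m → (Fin 3 → SU2) → ℝ}
    (hφ : ∀ l α, Continuous (φ l α)) (hψ : ∀ l α, Continuous (ψ l α)) (s : Pattern) :
    ∑ a : Fin 4 → Fin m, (∫ g, ∏ l, φ l (a l) (fun i => g (s l i)) ∂haarPow (Fin 6))
        * ∫ k, ∏ l, ψ l (a l) (fun i => k (s l i)) ∂haarPow (Fin 6)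
      = ∫ g, ∫ k, ∏ l, ∑ α, φ l α (fun i => g (s l i)) * ψ l α (fun i => k (s l i))
        ∂haarPow (Fin 6) ∂haarPow (Fin 6) := by
  have h : ∀ g k : Fin 6 → SU2, ∏ l, ∑ α, φ l α (fun i => g (s l i)) * ψ l α (fun i => k (s l i))
      = ∑ a : Fin 4 → Fin m, (∏ l, φ l (a l) (fun i => g (s l i)))
        * ∏ l, ψ l (a l) (fun i => k (s l i)) := by
    intro g k
    rw [Fintype.prod_sum]
    simp only [Finset.prod_mul_distrib]
  have c1 : ∀ a : Fin 4 → Fin m, Continuous fun g : Fin 6 → SU2 =>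
      ∏ l, φ l (a l) (fun i => g (s l i)) := fun a => by fun_prop
  have c2 : ∀ a : Fin 4 → Fin m, Continuous fun g : Fin 6 → SU2 =>
      ∏ l, ψ l (a l) (fun i => g (s l i)) := fun a => by fun_prop
  have i1 : ∀ (g : Fin 6 → SU2) (a : Fin 4 → Fin m), Integrable (fun k : Fin 6 → SU2 =>
      (∏ l, φ l (a l) (fun i => g (s l i))) * ∏ l, ψ l (a l) (fun i => k (s l i)))
      (haarPow (Fin 6)) := fun g a => (integrable_of_continuous (c2 a)).const_mul _
  simp only [h, integral_finsetSum _ fun a _ => i1 _ a, integral_const_mul]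
  rw [integral_finsetSum _ fun a _ => (integrable_of_continuous (c1 a)).mul_const _]
  simp only [integral_mul_const]

/-- The trace of the pair of vertices is the square norm of the vertex tensor. -/
theorem trace_doubleVertexMatrix {d : ℕ} (V : (Fin 4 → Fin d) → ℝ) :
    (doubleVertexMatrix V).trace = ∑ a, V a * V a := by
  rw [← (Fin.consEquiv fun _ => Fin d).sum_comp, Fintype.sum_prod_type]
  rfl

/-- Testing the vertex tensor against another one. -/
theorem le_trace_doubleVertexMatrix {d : ℕ} (V U : (Fin 4 → Fin d) → ℝ) {r : ℝ}
    (h : ∑ a, U a * V a = r) (h' : ∑ a, U a * U a = r) : r ≤ (doubleVertexMatrix V).trace := by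
  have h0 := Finset.sum_nonneg fun a (_ : a ∈ Finset.univ) => mul_self_nonneg (V a - U a)
  have h1 : ∑ a, (V a - U a) * (V a - U a)
      = ∑ a, V a * V a - 2 * ∑ a, U a * V a + ∑ a, U a * U a := by
    rw [Finset.mul_sum, ← Finset.sum_sub_distrib, ← Finset.sum_add_distrib]
    exact Finset.sum_congr rfl fun a _ => by ring
  rw [trace_doubleVertexMatrix]
  linarith

/-- The overlap of two windowed vertices, with the arguments of the fields permuted cyclically. -/
noncomputable def vertexOverlap (J : Fin 6 → Finset ℕ) (σ : Fin 4 → Fin 3) : ℝ :=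
  ∫ g, ∫ k, ∏ l, invKernel (fun i => J (boulatovPattern l i)) (fun i => g (boulatovPattern l i))
    (fun i => k (boulatovPattern l (i + σ l))) ∂haarPow (Fin 6) ∂haarPow (Fin 6)

theorem sum_windowedTensor_mul_vertexTensor {J : Fin 6 → Finset ℕ} (hJ : ∀ e, J e ⊆ S) :
    ∑ a, windowedTensor F J a * vertexTensor F boulatovPattern a
      = (1 / 81) * ∑ σ, vertexOverlap J σ := by
  unfold windowedTensor vertexTensor vertexOverlap
  rw [sum_integral_prod_mul_integral_prod (by fun_prop) (by fun_prop)]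
  have h : ∀ g k : Fin 6 → SU2, ∏ l, (1 / 3) * ∑ c : Fin 3,
      invKernel (fun i => J (boulatovPattern l i)) (fun i => g (boulatovPattern l i))
        (fun i => k (boulatovPattern l (i + c)))
      = ∑ σ : Fin 4 → Fin 3, (1 / 81) * ∏ l, invKernel (fun i => J (boulatovPattern l i))
        (fun i => g (boulatovPattern l i)) (fun i => k (boulatovPattern l (i + σ l))) := by
    intro g k
    rw [Finset.prod_mul_distrib, Fintype.prod_sum, Finset.mul_sum]
    norm_num
  have c1 : ∀ σ : Fin 4 → Fin 3, Continuous fun p : (Fin 6 → SU2) × (Fin 6 → SU2) =>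
      (1 / 81 : ℝ) * ∏ l, invKernel (fun i => J (boulatovPattern l i))
        (fun i => p.1 (boulatovPattern l i)) (fun i => p.2 (boulatovPattern l (i + σ l))) :=
    fun σ => by fun_prop
  have i1 : ∀ g : Fin 6 → SU2, ∀ σ : Fin 4 → Fin 3, Integrable (fun k : Fin 6 → SU2 =>
      (1 / 81 : ℝ) * ∏ l, invKernel (fun i => J (boulatovPattern l i))
        (fun i => g (boulatovPattern l i)) (fun i => k (boulatovPattern l (i + σ l))))
      (haarPow (Fin 6)) :=
    fun g σ => integrable_of_continuous ((c1 σ).comp (Continuous.prodMk_right g))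
  simp only [sum_windowedField_mul_toFun F (fun i => hJ _)]
  simp only [h, integral_finsetSum _ fun σ _ => i1 _ σ]
  rw [integral_finsetSum _ fun σ _ => integrable_of_continuous
    (continuous_integral_of_continuous (c1 σ))]
  simp only [integral_const_mul, Finset.mul_sum]

theorem boulatovPattern_injective : ∀ l, Function.Injective (boulatovPattern l) := by decide

theorem sum_windowedTensor_mul_self {J : Fin 6 → Finset ℕ} (hJ : ∀ e, J e ⊆ S)
    (hd : ∀ e f, e ≠ f → Disjoint (J e) (J f)) :
    ∑ a, windowedTensor F J a * windowedTensor F J a = (1 / 81) * vertexOverlap J 0 := by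
  unfold windowedTensor vertexOverlap
  rw [sum_integral_prod_mul_integral_prod (by fun_prop) (by fun_prop)]
  have h : ∀ l, ∀ g k : Fin 3 → SU2, ∑ α,
      windowedField F (fun i => J (boulatovPattern l i)) α g
        * windowedField F (fun i => J (boulatovPattern l i)) α k
      = (1 / 3) * invKernel (fun i => J (boulatovPattern l i)) g k := fun l g k =>
    sum_windowedField_mul_self_of_disjoint F (fun i => hJ _)
      (fun i j hij => hd _ _ ((boulatovPattern_injective l).ne hij)) g k
  simp only [h, Finset.prod_mul_distrib, integral_const_mul]
  norm_num

end Windowed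

/-! ### The overlap of windowed vertices -/

/-- The two occurrences of a variable in Boulatov's interaction, as (field, argument). -/
def boulatovOccurrence : Fin 6 → Fin 2 → Fin 4 × Fin 3 :=
  ![![(0, 0), (3, 2)], ![(0, 1), (2, 1)], ![(0, 2), (1, 0)], ![(1, 1), (3, 1)], ![(1, 2), (2, 0)],
    ![(2, 2), (3, 0)]]

theorem boulatovPattern_occurrence : ∀ e f,
    boulatovPattern (boulatovOccurrence e f).1 (boulatovOccurrence e f).2 = e := by decide

theorem prod_boulatovOccurrence (G : Fin 4 → Fin 3 → ℝ) :
    ∏ l, ∏ i, G l i = ∏ e, (G (boulatovOccurrence e 0).1 (boulatovOccurrence e 0).2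
      * G (boulatovOccurrence e 1).1 (boulatovOccurrence e 1).2) := by
  simp only [Fin.prod_univ_four, Fin.prod_univ_three, Fin.prod_univ_six, boulatovOccurrence]
  simp
  ring

/-- Integrating out the variables of a Boulatov vertex. -/
theorem integral_prod_windowDelta (T : Fin 4 → Fin 3 → Finset ℕ) (x : Fin 4 → Fin 3 → SU2) :
    ∫ k, ∏ l, ∏ i, windowDelta (T l i) (x l i * (k (boulatovPattern l i))⁻¹) ∂haarPow (Fin 6)
      = ∏ e, windowDelta
        (T (boulatovOccurrence e 0).1 (boulatovOccurrence e 0).2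
          ∩ T (boulatovOccurrence e 1).1 (boulatovOccurrence e 1).2)
        (x (boulatovOccurrence e 0).1 (boulatovOccurrence e 0).2
          * (x (boulatovOccurrence e 1).1 (boulatovOccurrence e 1).2)⁻¹) := by
  simp only [prod_boulatovOccurrence, boulatovPattern_occurrence]
  refine (integral_fintype_prod_eq_prod (f := fun e (k : SU2) =>
    windowDelta (T (boulatovOccurrence e 0).1 (boulatovOccurrence e 0).2)
      (x (boulatovOccurrence e 0).1 (boulatovOccurrence e 0).2 * k⁻¹)
    * windowDelta (T (boulatovOccurrence e 1).1 (boulatovOccurrence e 1).2)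
      (x (boulatovOccurrence e 1).1 (boulatovOccurrence e 1).2 * k⁻¹))).trans ?_
  refine Finset.prod_congr rfl fun e _ => ?_
  rw [← integral_windowDelta_conv']
  refine integral_congr_ae (.of_forall fun k => ?_)
  beta_reduce
  congr 1
  rw [← windowDelta_inv]
  simp

/-- The overlap with the variables of one of the two vertices integrated out. -/
theorem vertexOverlap_eq (J : Fin 6 → Finset ℕ) (σ : Fin 4 → Fin 3) :
    vertexOverlap J σ = ∫ g, ∫ h : Fin 4 → SU2, ∏ e, windowDelta
        (J (boulatovPattern (boulatovOccurrence e 0).1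
            ((boulatovOccurrence e 0).2 - σ (boulatovOccurrence e 0).1))
          ∩ J (boulatovPattern (boulatovOccurrence e 1).1
            ((boulatovOccurrence e 1).2 - σ (boulatovOccurrence e 1).1)))
        (g (boulatovPattern (boulatovOccurrence e 0).1
            ((boulatovOccurrence e 0).2 - σ (boulatovOccurrence e 0).1))
            * h (boulatovOccurrence e 0).1
          * (g (boulatovPattern (boulatovOccurrence e 1).1
            ((boulatovOccurrence e 1).2 - σ (boulatovOccurrence e 1).1))
            * h (boulatovOccurrence e 1).1)⁻¹) ∂haarPow (Fin 4) ∂haarPow (Fin 6) := by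
  unfold vertexOverlap
  refine integral_congr_ae (.of_forall fun g => ?_)
  beta_reduce
  have h1 : ∀ k : Fin 6 → SU2, ∏ l, invKernel (fun i => J (boulatovPattern l i))
        (fun i => g (boulatovPattern l i)) (fun i => k (boulatovPattern l (i + σ l)))
      = ∫ h : Fin 4 → SU2, ∏ l, ∏ i, windowDelta (J (boulatovPattern l (i - σ l)))
        (g (boulatovPattern l (i - σ l)) * h l * (k (boulatovPattern l i))⁻¹)
        ∂haarPow (Fin 4) := by
    intro k
    refine Eq.trans ?_ (integral_fintype_prod_eq_prod (f := fun l (h : SU2) =>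
      ∏ i, windowDelta (J (boulatovPattern l (i - σ l)))
        (g (boulatovPattern l (i - σ l)) * h * (k (boulatovPattern l i))⁻¹))).symm
    refine Finset.prod_congr rfl fun l _ => ?_
    rw [invKernel.eq_def]
    refine integral_congr_ae (.of_forall fun h => ?_)
    beta_reduce
    rw [← (Equiv.subRight (σ l)).prod_comp]
    simp
  simp only [h1]
  rw [integral_swap (f := fun (k : Fin 6 → SU2) (h : Fin 4 → SU2) =>
    ∏ l, ∏ i, windowDelta (J (boulatovPattern l (i - σ l)))
        (g (boulatovPattern l (i - σ l)) * h l * (k (boulatovPattern l i))⁻¹)) (by fun_prop)]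
  refine integral_congr_ae (.of_forall fun h => ?_)
  exact integral_prod_windowDelta (fun l i => J (boulatovPattern l (i - σ l)))
    fun l i => g (boulatovPattern l (i - σ l)) * h l

/-- Two fields of Boulatov's interaction share a single variable, so that a nontrivial cyclic
permutation of the arguments of one of them separates its two occurrences. -/
theorem boulatovOccurrence_shift : ∀ (e : Fin 6) (a b : Fin 3),
    boulatovPattern (boulatovOccurrence e 0).1 ((boulatovOccurrence e 0).2 - a)
      = boulatovPattern (boulatovOccurrence e 1).1 ((boulatovOccurrence e 1).2 - b) →
    a = 0 ∧ b = 0 := by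
  decide

theorem exists_occurrence_ne (σ : Fin 4 → Fin 3) (hσ : σ ≠ 0) : ∃ e,
    boulatovPattern (boulatovOccurrence e 0).1
        ((boulatovOccurrence e 0).2 - σ (boulatovOccurrence e 0).1)
      ≠ boulatovPattern (boulatovOccurrence e 1).1
        ((boulatovOccurrence e 1).2 - σ (boulatovOccurrence e 1).1) := by
  by_contra! h
  have h0 := boulatovOccurrence_shift 0 _ _ (h 0)
  have h4 := boulatovOccurrence_shift 4 _ _ (h 4)
  refine hσ (funext fun l => ?_)
  fin_cases l
  exacts [h0.1, h4.1, h4.2, h0.2]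

theorem vertexOverlap_eq_zero {J : Fin 6 → Finset ℕ}
    (hd : ∀ e f, e ≠ f → Disjoint (J e) (J f)) {σ : Fin 4 → Fin 3} (hσ : σ ≠ 0) :
    vertexOverlap J σ = 0 := by
  obtain ⟨e, he⟩ := exists_occurrence_ne σ hσ
  rw [vertexOverlap_eq]
  refine integral_eq_zero_of_ae (.of_forall fun g => ?_)
  refine integral_eq_zero_of_ae (.of_forall fun h => ?_)
  refine Finset.prod_eq_zero (Finset.mem_univ e) ?_
  rw [Finset.disjoint_iff_inter_eq_empty.1 (hd _ _ he), windowDelta_empty]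

/-- The trivial permutation gives the integral of the windowed delta functions along the edges of the
tetrahedron whose vertices are the four fields. -/
theorem vertexOverlap_zero (J : Fin 6 → Finset ℕ) :
    vertexOverlap J 0 = ∫ h : Fin 4 → SU2, ∏ e, windowDelta (J e)
      (h (boulatovOccurrence e 0).1 * (h (boulatovOccurrence e 1).1)⁻¹) ∂haarPow (Fin 4) := by
  have h1 : ∀ (e : Fin 6) (g x y : SU2), windowDelta (J e) (g * x * (g * y)⁻¹)
      = windowDelta (J e) (x * y⁻¹) := by
    intro e g x y
    rw [mul_inv_rev, ← mul_assoc, windowDelta_mul_comm]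
    simp [mul_assoc]
  rw [vertexOverlap_eq]
  simp only [Pi.zero_apply, sub_zero, boulatovPattern_occurrence, Finset.inter_self, h1]
  simp

variable {S : Finset ℕ} {m : ℕ} (F : CovarianceBasis S m)

theorem vertexOverlap_le_trace {J : Fin 6 → Finset ℕ} (hJ : ∀ e, J e ⊆ S)
    (hd : ∀ e f, e ≠ f → Disjoint (J e) (J f)) :
    (1 / 81) * vertexOverlap J 0 ≤ (doubleVertexMatrix (vertexTensor F boulatovPattern)).trace := by
  refine le_trace_doubleVertexMatrix _ (windowedTensor F J) ?_
    (sum_windowedTensor_mul_self F hJ hd)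
  rw [sum_windowedTensor_mul_vertexTensor F hJ, Fintype.sum_eq_single 0]
  exact fun σ hσ => vertexOverlap_eq_zero hd hσ

theorem windowDelta_zero_singleton (g : SU2) : windowDelta {0} g = 1 := by
  rw [windowDelta.eq_def]
  simp [realCharacter_zero]

theorem invKernel_zero_singleton (g g' : Fin 3 → SU2) : invKernel (fun _ => {0}) g g' = 1 := by
  rw [invKernel.eq_def]
  simp [windowDelta_zero_singleton]

/-- The constant functions contribute `1` to the trace. -/
theorem one_le_trace_doubleVertexMatrix (hS : 0 ∈ S) :
    1 ≤ (doubleVertexMatrix (vertexTensor F boulatovPattern)).trace := by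
  have hJ : ∀ e : Fin 6, (fun _ => {0} : Fin 6 → Finset ℕ) e ⊆ S := fun e => by simpa using hS
  refine le_trace_doubleVertexMatrix _ (windowedTensor F fun _ => {0}) ?_ ?_
  · rw [sum_windowedTensor_mul_vertexTensor F hJ]
    simp [vertexOverlap, invKernel_zero_singleton]
  · unfold windowedTensor
    rw [sum_integral_prod_mul_integral_prod (by fun_prop) (by fun_prop)]
    have h : ∀ g k, ∑ α, windowedField F (fun _ => {0}) α g * windowedField F (fun _ => {0}) α k
        = 1 := by
      intro g k
      rw [sum_windowedField_mul_self F fun i => hJ 0]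
      simp [invKernel_zero_singleton]
    simp [h]

/-! ### The tetrahedral integral -/

/-- If the Gram kernel of a family of functions `φ · h` is reproduced by `u`, so is the family. -/
theorem integral_mul_eq_of_gram {X Y : Type*} [TopologicalSpace X] [CompactSpace X]
    [LocallyCompactSpace X] [MeasurableSpace X] [BorelSpace X] [SecondCountableTopology X]
    [TopologicalSpace Y] [CompactSpace Y] [LocallyCompactSpace Y] [MeasurableSpace Y]
    [BorelSpace Y] [SecondCountableTopology Y] {μ : Measure X} {ν : Measure Y}
    [IsFiniteMeasure μ] [μ.IsOpenPosMeasure] [IsFiniteMeasure ν] {φ : X → Y → ℝ}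
    (hφ : Continuous fun p : X × Y => φ p.1 p.2) {u : Y → ℝ} (hu : Continuous u) (z : Y)
    (h : ∀ y, ∫ k, (∫ x, φ x k * φ x y ∂μ) * u k ∂ν = ∫ x, φ x z * φ x y ∂μ) (x : X) :
    ∫ k, φ x k * u k ∂ν = φ x z := by
  set E : X → ℝ := fun x => ∫ k, φ x k * u k ∂ν - φ x z with hE
  have c1 : Continuous fun x => ∫ k, φ x k * u k ∂ν :=
    continuous_integral_of_continuous (f := fun x k => φ x k * u k) (by fun_prop)
  have c2 : ∀ y, Continuous fun x => φ x y := fun y => hφ.comp (Continuous.prodMk_left y)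
  have cE : Continuous E := c1.sub (c2 z)
  have c3 : ∀ y, Continuous fun p : X × Y => φ p.1 y := fun y => (c2 y).comp continuous_fst
  -- the defect is orthogonal to the whole family
  have ho : ∀ y, ∫ x, E x * φ x y ∂μ = 0 := by
    intro y
    have cy := c2 y
    have cy3 := c3 y
    have h1 : ∫ x, (∫ k, φ x k * u k ∂ν) * φ x y ∂μ = ∫ k, (∫ x, φ x k * φ x y ∂μ) * u k ∂ν := by
      simp only [← integral_mul_const]
      rw [integral_swap (f := fun x k => φ x k * u k * φ x y) (by fun_prop)]
      simp only [mul_right_comm]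
    simp only [hE, sub_mul]
    have i1 : Integrable (fun x => (∫ k, φ x k * u k ∂ν) * φ x y) μ :=
      integrable_of_continuous (c1.mul (c2 y))
    have i2 : Integrable (fun x => φ x z * φ x y) μ :=
      integrable_of_continuous ((c2 z).mul (c2 y))
    rw [integral_sub i1 i2, h1, h, sub_self]
  have h0 : ∫ x, E x ^ 2 ∂μ = 0 := by
    have h1 : ∀ x, E x ^ 2 = (∫ k, E x * φ x k * u k ∂ν) - E x * φ x z := by
      intro x
      simp only [mul_assoc, integral_const_mul]
      rw [← mul_sub, sq]
    simp only [h1]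
    have cE3 : Continuous fun p : X × Y => E p.1 := cE.comp continuous_fst
    have i1 : Integrable (fun x => ∫ k, E x * φ x k * u k ∂ν) μ :=
      integrable_of_continuous (continuous_integral_of_continuous
        (f := fun x k => E x * φ x k * u k) (by fun_prop))
    have i2 : Integrable (fun x => E x * φ x z) μ := integrable_of_continuous (cE.mul (c2 z))
    rw [integral_sub i1 i2, ho,
      integral_swap (f := fun x k => E x * φ x k * u k) (by fun_prop)]
    simp only [integral_mul_const, ho]
    simp
  have h2 := (integral_eq_zero_iff_of_nonneg (fun x => sq_nonneg (E x))
    (integrable_of_continuous (cE.pow 2))).1 h0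
  have h3 := Continuous.ae_eq_iff_eq μ (cE.pow 2) continuous_const |>.1 h2
  have h4 : E x ^ 2 = 0 := congrFun h3 x
  exact sub_eq_zero.1 (pow_eq_zero_iff two_ne_zero |>.1 h4)

theorem integral_realCharacter_mul_windowDelta {S : Finset ℕ} {c : ℕ} (hc : c ∈ S) (x y : SU2) :
    ∫ h, realCharacter c (x * h) * windowDelta S (h⁻¹ * y) ∂haar = realCharacter c (x * y) := by
  have h1 := continuous_realCharacter
  have i1 : ∀ k : ℕ, Integrable (fun h : SU2 => ((k : ℝ) + 1) *
      (realCharacter c (x * h) * realCharacter k (h⁻¹ * y))) haar := fun k =>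
    integrable_of_continuous (by fun_prop)
  simp only [windowDelta.eq_def, Finset.mul_sum, mul_left_comm (realCharacter c _)]
  rw [integral_finsetSum _ fun k _ => i1 k]
  simp only [integral_const_mul, integral_realCharacter_conv, mul_ite, mul_zero]
  rw [Finset.sum_ite_eq, if_pos hc]
  field_simp

theorem integral_realCharacter_mul_right (k : ℕ) (x y : SU2) :
    ∫ h, realCharacter k (h * x) * realCharacter k (h * y) ∂haar
      = realCharacter k (x * y⁻¹) / ((k : ℝ) + 1) := by
  have h := integral_realCharacter_conv k k x y⁻¹
  rw [if_pos rfl] at h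
  rw [← h]
  refine integral_congr_ae (.of_forall fun h => ?_)
  beta_reduce
  rw [realCharacter_mul_comm k x h, ← mul_inv_rev, realCharacter_inv, realCharacter_mul_comm k y h,
    realCharacter_mul_comm k h y]

/-- The products of matrix coefficients of two representations are reproduced by a window that
contains all the spins of the tensor product. -/
theorem integral_mul_windowDelta_of_clebschGordan {S : Finset ℕ} {a b : ℕ} (hba : b ≤ a)
    (hS : ∀ i ≤ b, a - b + 2 * i ∈ S) (x y z : SU2) :
    ∫ h, realCharacter b (x * h) * realCharacter a (y * h) * windowDelta S (h⁻¹ * z) ∂haar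
      = realCharacter b (x * z) * realCharacter a (y * z) := by
  have hca := continuous_realCharacter a
  have hcb := continuous_realCharacter b
  have hκ : ∀ g, realCharacter b g * realCharacter a g
      = ∑ i ∈ Finset.range (b + 1), realCharacter (a - b + 2 * i) g := by
    intro g
    rw [mul_comm, ← realCharacter_mul, Nat.sub_add_cancel hba]
  -- the Gram kernel is a class function with spins in `S`
  have hM : ∀ h k : SU2, ∫ p : SU2 × SU2, realCharacter b (p.1 * h) * realCharacter a (p.2 * h)
        * (realCharacter b (p.1 * k) * realCharacter a (p.2 * k)) ∂(haar.prod haar)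
      = (((b : ℝ) + 1) * ((a : ℝ) + 1))⁻¹
        * (realCharacter b (k⁻¹ * h) * realCharacter a (k⁻¹ * h)) := by
    intro h k
    have h1 := integral_prod_mul (μ := haar) (ν := haar)
      (fun x : SU2 => realCharacter b (x * h) * realCharacter b (x * k))
      (fun y : SU2 => realCharacter a (y * h) * realCharacter a (y * k))
    rw [integral_realCharacter_mul_right, integral_realCharacter_mul_right] at h1
    rw [realCharacter_mul_comm b k⁻¹, realCharacter_mul_comm a k⁻¹]
    refine (integral_congr_ae (.of_forall fun p => ?_)).trans (h1.trans ?_)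
    · ring
    · field_simp
  refine integral_mul_eq_of_gram (X := SU2 × SU2) (μ := haar.prod haar) (ν := haar)
    (φ := fun p h => realCharacter b (p.1 * h) * realCharacter a (p.2 * h))
    (u := fun h => windowDelta S (h⁻¹ * z)) (by fun_prop) (by fun_prop) z ?_ (x, y)
  intro k
  simp only [hM, mul_assoc _ _ (windowDelta S _), integral_const_mul]
  congr 1
  simp only [← mul_assoc, hκ, Finset.sum_mul]
  have hc := continuous_realCharacter
  rw [integral_finsetSum _ fun i _ => integrable_of_continuous (by fun_prop)]
  refine Finset.sum_congr rfl fun i hi => ?_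
  exact integral_realCharacter_mul_windowDelta
    (hS i (Nat.lt_succ_iff.1 (Finset.mem_range.1 hi))) k⁻¹ z

theorem integral_windowDelta_mul_mul {S A B : Finset ℕ}
    (h : ∀ a ∈ A, ∀ b ∈ B, b ≤ a ∧ ∀ i ≤ b, a - b + 2 * i ∈ S) (x y z : SU2) :
    ∫ v, windowDelta B (x * v⁻¹) * windowDelta A (y * v⁻¹) * windowDelta S (v * z⁻¹) ∂haar
      = windowDelta B (x * z⁻¹) * windowDelta A (y * z⁻¹) := by
  have hc := continuous_realCharacter
  have i1 : ∀ b a : ℕ, Integrable (fun v : SU2 => ((b : ℝ) + 1) * ((a : ℝ) + 1) *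
      (realCharacter b (x * v) * realCharacter a (y * v) * windowDelta S (v⁻¹ * z⁻¹))) haar :=
    fun b a => integrable_of_continuous (by fun_prop)
  have e : ∀ u v w : SU2, windowDelta B u * windowDelta A v * windowDelta S w
      = ∑ b ∈ B, ∑ a ∈ A, ((b : ℝ) + 1) * ((a : ℝ) + 1) *
        (realCharacter b u * realCharacter a v * windowDelta S w) := by
    intro u v w
    rw [windowDelta.eq_def B, windowDelta.eq_def A, Finset.sum_mul_sum, Finset.sum_mul]
    refine Finset.sum_congr rfl fun b _ => ?_
    rw [Finset.sum_mul]
    exact Finset.sum_congr rfl fun a _ => by ring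
  rw [← integral_inv_eq_self]
  simp only [inv_inv, e]
  rw [integral_finsetSum _ fun b _ => integrable_finsetSum _ fun a _ => i1 b a]
  rw [windowDelta.eq_def B, windowDelta.eq_def A, Finset.sum_mul_sum]
  refine Finset.sum_congr rfl fun b hb => ?_
  rw [integral_finsetSum _ fun a _ => i1 b a]
  refine Finset.sum_congr rfl fun a ha => ?_
  rw [integral_const_mul, integral_mul_windowDelta_of_clebschGordan (h a ha b hb).1 (h a ha b hb).2]
  ring

/-- Each spin of the tensor product occurs once in the product of two characters. -/
theorem integral_realCharacter_clebschGordan {a b c : ℕ} (hba : b ≤ a)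
    (hc : ∃ i ≤ b, a - b + 2 * i = c) (x : SU2) :
    ∫ h, realCharacter c (x * h⁻¹) * (realCharacter a h * realCharacter b h) ∂haar
      = realCharacter c x / ((c : ℝ) + 1) := by
  obtain ⟨j, hj, rfl⟩ := hc
  have hcc := continuous_realCharacter
  have hκ : ∀ g, realCharacter a g * realCharacter b g
      = ∑ i ∈ Finset.range (b + 1), realCharacter (a - b + 2 * i) g := by
    intro g
    rw [← realCharacter_mul, Nat.sub_add_cancel hba]
  have h1 : ∀ i, ∫ h, realCharacter (a - b + 2 * j) (x * h⁻¹) * realCharacter (a - b + 2 * i) h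
      ∂haar = if j = i then realCharacter (a - b + 2 * j) x / (((a - b + 2 * j : ℕ) : ℝ) + 1)
        else 0 := by
    intro i
    have h2 := integral_realCharacter_conv (a - b + 2 * j) (a - b + 2 * i) x 1
    simp only [mul_one] at h2
    rw [← integral_inv_eq_self]
    simp only [inv_inv, h2]
    congr 1
    simp
  simp only [hκ, Finset.mul_sum]
  rw [integral_finsetSum _ fun i _ => integrable_of_continuous (by fun_prop)]
  simp only [h1]
  rw [Finset.sum_ite_eq, if_pos (Finset.mem_range.2 (Nat.lt_succ_of_le hj))]

theorem integral_realCharacter_mul_windowDelta_mul {A B : Finset ℕ} {c : ℕ}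
    (h : ∀ a ∈ A, ∀ b ∈ B, b ≤ a ∧ ∃ i ≤ b, a - b + 2 * i = c) (x : SU2) :
    ∫ y, realCharacter c (x * y⁻¹) * (windowDelta A y * windowDelta B y) ∂haar
      = (∑ a ∈ A, ((a : ℝ) + 1)) * (∑ b ∈ B, ((b : ℝ) + 1)) * (realCharacter c x / ((c : ℝ) + 1)) := by
  have hc := continuous_realCharacter
  have i1 : ∀ a b : ℕ, Integrable (fun y : SU2 => ((a : ℝ) + 1) * ((b : ℝ) + 1) *
      (realCharacter c (x * y⁻¹) * (realCharacter a y * realCharacter b y))) haar :=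
    fun a b => integrable_of_continuous (by fun_prop)
  have e : ∀ y : SU2, realCharacter c (x * y⁻¹) * (windowDelta A y * windowDelta B y)
      = ∑ a ∈ A, ∑ b ∈ B, ((a : ℝ) + 1) * ((b : ℝ) + 1) *
        (realCharacter c (x * y⁻¹) * (realCharacter a y * realCharacter b y)) := by
    intro y
    rw [windowDelta.eq_def B, windowDelta.eq_def A, Finset.sum_mul_sum, Finset.mul_sum]
    refine Finset.sum_congr rfl fun b _ => ?_
    rw [Finset.mul_sum]
    exact Finset.sum_congr rfl fun a _ => by ring
  simp only [e]
  rw [integral_finsetSum _ fun a _ => integrable_finsetSum _ fun b _ => i1 a b,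
    Finset.sum_mul_sum, Finset.sum_mul]
  refine Finset.sum_congr rfl fun a ha => ?_
  rw [integral_finsetSum _ fun b _ => i1 a b, Finset.sum_mul]
  refine Finset.sum_congr rfl fun b hb => ?_
  rw [integral_const_mul, integral_realCharacter_clebschGordan (h a ha b hb).1 (h a ha b hb).2]

theorem integral_haarPow_four {f : (Fin 4 → SU2) → ℝ} (hf : Continuous f) :
    ∫ g, f g ∂haarPow (Fin 4) = ∫ w, ∫ x, ∫ y, ∫ v, f ![w, x, y, v] ∂haar ∂haar ∂haar ∂haar := by
  rw [integral_haarPow_succ hf]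
  refine integral_congr_ae (.of_forall fun w => ?_)
  beta_reduce
  rw [integral_haarPow_three (by fun_prop)]
  rfl

/-- The window `J 5` acts as a delta function and identifies two of the four group elements. -/
theorem vertexOverlap_zero_eq_integral (J : Fin 6 → Finset ℕ)
    (h5 : ∀ a ∈ J 4, ∀ b ∈ J 1, b ≤ a ∧ ∀ i ≤ b, a - b + 2 * i ∈ J 5) :
    vertexOverlap J 0 = ∫ x, windowDelta (J 0) x * windowDelta (J 1) x *
      ∫ y, windowDelta (J 2) (x * y⁻¹) * (windowDelta (J 4) y * windowDelta (J 3) y) ∂haar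
      ∂haar := by
  -- the variables are put in the order `h 3, h 0, h 1, h 2`
  rw [vertexOverlap_zero, ← integral_haarPow_perm (⟨![1, 2, 3, 0], ![3, 0, 1, 2], by decide,
    by decide⟩ : Equiv.Perm (Fin 4))]
  have e : ∀ h : Fin 4 → SU2, ∏ e, windowDelta (J e)
      ((fun i => h ((⟨![1, 2, 3, 0], ![3, 0, 1, 2], by decide, by decide⟩ :
          Equiv.Perm (Fin 4)) i)) (boulatovOccurrence e 0).1
        * ((fun i => h ((⟨![1, 2, 3, 0], ![3, 0, 1, 2], by decide, by decide⟩ :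
          Equiv.Perm (Fin 4)) i)) (boulatovOccurrence e 1).1)⁻¹)
      = windowDelta (J 0) (h 1 * (h 0)⁻¹) * windowDelta (J 2) (h 1 * (h 2)⁻¹)
        * windowDelta (J 3) (h 2 * (h 0)⁻¹)
        * (windowDelta (J 1) (h 1 * (h 3)⁻¹) * windowDelta (J 4) (h 2 * (h 3)⁻¹)
        * windowDelta (J 5) (h 3 * (h 0)⁻¹)) := by
    intro h
    rw [Fin.prod_univ_six]
    change windowDelta (J 0) (h 1 * (h 0)⁻¹) * windowDelta (J 1) (h 1 * (h 3)⁻¹)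
      * windowDelta (J 2) (h 1 * (h 2)⁻¹) * windowDelta (J 3) (h 2 * (h 0)⁻¹)
      * windowDelta (J 4) (h 2 * (h 3)⁻¹) * windowDelta (J 5) (h 3 * (h 0)⁻¹) = _
    ring
  rw [integral_congr_ae (.of_forall e)]
  refine (integral_haarPow_four (by fun_prop)).trans ?_
  change ∫ w, ∫ x, ∫ y, ∫ v, windowDelta (J 0) (x * w⁻¹) * windowDelta (J 2) (x * y⁻¹)
    * windowDelta (J 3) (y * w⁻¹) * (windowDelta (J 1) (x * v⁻¹) * windowDelta (J 4) (y * v⁻¹)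
    * windowDelta (J 5) (v * w⁻¹)) ∂haar ∂haar ∂haar ∂haar = _
  simp only [integral_const_mul, integral_windowDelta_mul_mul h5]
  have h1 : ∀ w : SU2, ∫ x, ∫ y, windowDelta (J 0) (x * w⁻¹) * windowDelta (J 2) (x * y⁻¹)
      * windowDelta (J 3) (y * w⁻¹) * (windowDelta (J 1) (x * w⁻¹) * windowDelta (J 4) (y * w⁻¹))
      ∂haar ∂haar = ∫ x, windowDelta (J 0) x * windowDelta (J 1) x *
      ∫ y, windowDelta (J 2) (x * y⁻¹) * (windowDelta (J 4) y * windowDelta (J 3) y) ∂haar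
      ∂haar := by
    intro w
    rw [← integral_mul_right_eq_self (fun x : SU2 => ∫ y, windowDelta (J 0) (x * w⁻¹)
      * windowDelta (J 2) (x * y⁻¹) * windowDelta (J 3) (y * w⁻¹)
      * (windowDelta (J 1) (x * w⁻¹) * windowDelta (J 4) (y * w⁻¹)) ∂haar) w]
    refine integral_congr_ae (.of_forall fun x => ?_)
    beta_reduce
    rw [← integral_mul_right_eq_self (fun y : SU2 => windowDelta (J 0) (x * w * w⁻¹)
      * windowDelta (J 2) (x * w * y⁻¹) * windowDelta (J 3) (y * w⁻¹)
      * (windowDelta (J 1) (x * w * w⁻¹) * windowDelta (J 4) (y * w⁻¹))) w,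
      ← integral_const_mul]
    refine integral_congr_ae (.of_forall fun y => ?_)
    beta_reduce
    rw [mul_inv_cancel_right, mul_inv_cancel_right, mul_inv_rev, mul_assoc x w,
      mul_inv_cancel_left]
    ring
  simp only [h1]
  simp

/-- The tetrahedral integral in closed form. Each spin in `J 2` is coupled to each pair of spins in
`J 0 × J 1` and in `J 4 × J 3`. -/
theorem vertexOverlap_zero_eq (J : Fin 6 → Finset ℕ)
    (h5 : ∀ a ∈ J 4, ∀ b ∈ J 1, b ≤ a ∧ ∀ i ≤ b, a - b + 2 * i ∈ J 5)
    (h01 : ∀ c ∈ J 2, ∀ a ∈ J 0, ∀ b ∈ J 1, b ≤ a ∧ ∃ i ≤ b, a - b + 2 * i = c)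
    (h43 : ∀ c ∈ J 2, ∀ a ∈ J 4, ∀ b ∈ J 3, b ≤ a ∧ ∃ i ≤ b, a - b + 2 * i = c) :
    vertexOverlap J 0 = (∑ a ∈ J 0, ((a : ℝ) + 1)) * (∑ a ∈ J 1, ((a : ℝ) + 1))
      * ((∑ a ∈ J 4, ((a : ℝ) + 1)) * ∑ a ∈ J 3, ((a : ℝ) + 1)) * (J 2).card := by
  set N := (∑ a ∈ J 4, ((a : ℝ) + 1)) * ∑ a ∈ J 3, ((a : ℝ) + 1) with hN
  have hc := continuous_realCharacter
  have h1 : ∀ x : SU2, ∫ y, windowDelta (J 2) (x * y⁻¹)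
        * (windowDelta (J 4) y * windowDelta (J 3) y) ∂haar = ∑ c ∈ J 2, N * realCharacter c x := by
    intro x
    have i1 : ∀ c : ℕ, Integrable (fun y : SU2 => ((c : ℝ) + 1) * (realCharacter c (x * y⁻¹)
        * (windowDelta (J 4) y * windowDelta (J 3) y))) haar := fun c =>
      integrable_of_continuous (by fun_prop)
    have e : ∀ y : SU2, windowDelta (J 2) (x * y⁻¹) * (windowDelta (J 4) y * windowDelta (J 3) y)
        = ∑ c ∈ J 2, ((c : ℝ) + 1) * (realCharacter c (x * y⁻¹)
          * (windowDelta (J 4) y * windowDelta (J 3) y)) := by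
      intro y
      rw [windowDelta.eq_def (J 2), Finset.sum_mul]
      exact Finset.sum_congr rfl fun c _ => mul_assoc _ _ _
    simp only [e]
    rw [integral_finsetSum _ fun c _ => i1 c]
    refine Finset.sum_congr rfl fun c hcJ => ?_
    rw [integral_const_mul, integral_realCharacter_mul_windowDelta_mul (h43 c hcJ), ← hN]
    field_simp
  set M := (∑ a ∈ J 0, ((a : ℝ) + 1)) * ∑ a ∈ J 1, ((a : ℝ) + 1) with hM
  have h2 : ∀ c ∈ J 2, ∫ x, windowDelta (J 0) x * windowDelta (J 1) x * (N * realCharacter c x)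
      ∂haar = M * N := by
    intro c hcJ
    have h3 := integral_realCharacter_mul_windowDelta_mul (h01 c hcJ) 1
    rw [realCharacter_apply_one, div_self (by positivity), mul_one, ← hM] at h3
    rw [← h3, ← integral_mul_const]
    refine integral_congr_ae (.of_forall fun x => ?_)
    beta_reduce
    rw [one_mul, realCharacter_inv]
    ring
  have i2 : ∀ c : ℕ, Integrable (fun x => windowDelta (J 0) x * windowDelta (J 1) x
      * (N * realCharacter c x)) haar := fun c => integrable_of_continuous (by fun_prop)
  rw [vertexOverlap_zero_eq_integral J h5]
  simp only [h1, Finset.mul_sum]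
  rw [integral_finsetSum _ fun c _ => i2 c, Finset.sum_congr rfl h2, Finset.sum_const,
    nsmul_eq_mul]
  ring

/-! ### Spin windows -/

/-- The `L` spins `b / 2, b / 2 + 1, …`. -/
def spinWindow (b L : ℕ) : Finset ℕ := (Finset.range L).image fun i => b + 2 * i

theorem mem_spinWindow {b L c : ℕ} : c ∈ spinWindow b L ↔ ∃ i < L, b + 2 * i = c := by
  simp [spinWindow]

theorem card_spinWindow (b L : ℕ) : (spinWindow b L).card = L := by
  rw [spinWindow, Finset.card_image_of_injective _ fun i j h => by
    simpa using h, Finset.card_range]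

theorem le_sum_spinWindow (b L : ℕ) : (b : ℝ) * L ≤ ∑ a ∈ spinWindow b L, ((a : ℝ) + 1) := by
  have h : ∀ a ∈ spinWindow b L, (b : ℝ) ≤ (a : ℝ) + 1 := by
    intro a ha
    obtain ⟨i, -, rfl⟩ := mem_spinWindow.1 ha
    push_cast
    linarith [(Nat.cast_nonneg i : (0 : ℝ) ≤ i)]
  have h1 := Finset.card_nsmul_le_sum _ _ _ h
  rw [card_spinWindow, nsmul_eq_mul] at h1
  linarith

/-- Pairwise disjoint windows for the six edges of a tetrahedron. The triangle inequalities hold at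
each of its four vertices, and the last window contains all the spins coupled to the second and the
fifth one. -/
def tetrahedronWindows (L : ℕ) : Fin 6 → Finset ℕ :=
  ![spinWindow (40 * L) L, spinWindow (8 * L + 1) L, spinWindow (40 * L + 1) L,
    spinWindow (46 * L + 1) L, spinWindow (60 * L) L,
    (Finset.Icc (50 * L) (72 * L)).filter fun k => k % 2 = 1]

theorem tetrahedronWindows_subset {L N : ℕ} (hN : 72 * L ≤ N) (e : Fin 6) :
    tetrahedronWindows L e ⊆ Finset.range (N + 1) := by
  intro k hk
  rw [Finset.mem_range]
  fin_cases e <;> simp [tetrahedronWindows, mem_spinWindow] at hk <;>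
    first
      | (obtain ⟨i, hi, rfl⟩ := hk; omega)
      | omega

theorem tetrahedronWindows_disjoint (L : ℕ) (e f : Fin 6) (h : e ≠ f) :
    Disjoint (tetrahedronWindows L e) (tetrahedronWindows L f) := by
  have key : ∀ e f : Fin 6, e < f →
      Disjoint (tetrahedronWindows L e) (tetrahedronWindows L f) := by
    intro e f hef
    rw [Finset.disjoint_left]
    intro k he hf
    fin_cases e <;> fin_cases f <;> first
      | exact absurd hef (by decide)
      | (simp [tetrahedronWindows, mem_spinWindow] at he hf
         obtain ⟨i, hi, rfl⟩ := he
         first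
          | (obtain ⟨j, hj, hij⟩ := hf; omega)
          | omega)
  rcases lt_or_gt_of_ne h with h | h
  · exact key _ _ h
  · exact (key _ _ h).symm

theorem pow_nine_le_vertexOverlap (L : ℕ) :
    81 * (L : ℝ) ^ 9 ≤ vertexOverlap (tetrahedronWindows L) 0 := by
  have h0 : tetrahedronWindows L 0 = spinWindow (40 * L) L := rfl
  have h1 : tetrahedronWindows L 1 = spinWindow (8 * L + 1) L := rfl
  have h2 : tetrahedronWindows L 2 = spinWindow (40 * L + 1) L := rfl
  have h3 : tetrahedronWindows L 3 = spinWindow (46 * L + 1) L := rfl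
  have h4 : tetrahedronWindows L 4 = spinWindow (60 * L) L := rfl
  have h5 : tetrahedronWindows L 5
    = (Finset.Icc (50 * L) (72 * L)).filter fun k => k % 2 = 1 := rfl
  rw [vertexOverlap_zero_eq, h0, h1, h2, h3, h4, card_spinWindow]
  · have s0 := le_sum_spinWindow (40 * L) L
    have s1 := le_sum_spinWindow (8 * L + 1) L
    have s3 := le_sum_spinWindow (46 * L + 1) L
    have s4 := le_sum_spinWindow (60 * L) L
    have hL : (0 : ℝ) ≤ L := Nat.cast_nonneg L
    have r0 : 3 * (L : ℝ) ^ 2 ≤ ∑ a ∈ spinWindow (40 * L) L, ((a : ℝ) + 1) := by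
      push_cast at s0; nlinarith
    have r1 : 3 * (L : ℝ) ^ 2 ≤ ∑ a ∈ spinWindow (8 * L + 1) L, ((a : ℝ) + 1) := by
      push_cast at s1; nlinarith
    have r3 : 3 * (L : ℝ) ^ 2 ≤ ∑ a ∈ spinWindow (46 * L + 1) L, ((a : ℝ) + 1) := by
      push_cast at s3; nlinarith
    have r4 : 3 * (L : ℝ) ^ 2 ≤ ∑ a ∈ spinWindow (60 * L) L, ((a : ℝ) + 1) := by
      push_cast at s4; nlinarith
    calc 81 * (L : ℝ) ^ 9 = 3 * (L : ℝ) ^ 2 * (3 * (L : ℝ) ^ 2)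
          * (3 * (L : ℝ) ^ 2 * (3 * (L : ℝ) ^ 2)) * L := by ring
      _ ≤ _ := by gcongr
  · rw [h1, h4, h5]
    intro a ha b hb
    obtain ⟨i, hi, rfl⟩ := mem_spinWindow.1 ha
    obtain ⟨j, hj, rfl⟩ := mem_spinWindow.1 hb
    refine ⟨by omega, fun k hk => ?_⟩
    rw [Finset.mem_filter, Finset.mem_Icc]
    omega
  · rw [h0, h1, h2]
    intro c hc a ha b hb
    obtain ⟨k, hk, rfl⟩ := mem_spinWindow.1 hc
    obtain ⟨i, hi, rfl⟩ := mem_spinWindow.1 ha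
    obtain ⟨j, hj, rfl⟩ := mem_spinWindow.1 hb
    exact ⟨by omega, (40 * L + 1 + 2 * k - (40 * L + 2 * i - (8 * L + 1 + 2 * j))) / 2, by omega,
      by omega⟩
  · rw [h2, h3, h4]
    intro c hc a ha b hb
    obtain ⟨k, hk, rfl⟩ := mem_spinWindow.1 hc
    obtain ⟨i, hi, rfl⟩ := mem_spinWindow.1 ha
    obtain ⟨j, hj, rfl⟩ := mem_spinWindow.1 hb
    exact ⟨by omega, (40 * L + 1 + 2 * k - (60 * L + 2 * i - (46 * L + 1 + 2 * j))) / 2, by omega,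
      by omega⟩

/-! ### Dependence on the cutoff -/

theorem windowDelta_range_le {Λ : ℝ} (hΛ : 1 ≤ Λ) :
    windowDelta (Finset.range (⌊2 * Λ⌋₊ + 1)) 1 ≤ 27 * Λ ^ 3 := by
  have h := Nat.floor_le (by linarith : (0 : ℝ) ≤ 2 * Λ)
  rw [windowDelta_one]
  have h1 : ∀ k ∈ Finset.range (⌊2 * Λ⌋₊ + 1), ((k : ℝ) + 1) ^ 2 ≤ ((⌊2 * Λ⌋₊ : ℝ) + 1) ^ 2 := by
    intro k hk
    have : (k : ℝ) ≤ ⌊2 * Λ⌋₊ := by exact_mod_cast Nat.lt_succ_iff.1 (Finset.mem_range.1 hk)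
    gcongr
  refine (Finset.sum_le_card_nsmul _ _ _ h1).trans ?_
  rw [Finset.card_range, nsmul_eq_mul]
  push_cast
  calc ((⌊2 * Λ⌋₊ : ℝ) + 1) * ((⌊2 * Λ⌋₊ : ℝ) + 1) ^ 2 = ((⌊2 * Λ⌋₊ : ℝ) + 1) ^ 3 := by ring
    _ ≤ (3 * Λ) ^ 3 := by gcongr; linarith
    _ = 27 * Λ ^ 3 := by ring

theorem le_trace_doubleVertexMatrix_range {Λ : ℝ} (hΛ : 1 ≤ Λ) {m : ℕ}
    (F : CovarianceBasis (Finset.range (⌊2 * Λ⌋₊ + 1)) m) :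
    (Λ / 72) ^ 9 ≤ (doubleVertexMatrix (vertexTensor F boulatovPattern)).trace := by
  set L := ⌊2 * Λ⌋₊ / 72 with hL
  have h1 := one_le_trace_doubleVertexMatrix F (by simp)
  have h2 : (L : ℝ) ^ 9 ≤ (doubleVertexMatrix (vertexTensor F boulatovPattern)).trace := by
    have h3 := vertexOverlap_le_trace F
      (tetrahedronWindows_subset (L := L) (N := ⌊2 * Λ⌋₊) (by omega))
      (tetrahedronWindows_disjoint L)
    have h4 := pow_nine_le_vertexOverlap L
    linarith
  have h5 : 2 * Λ < 72 * ((L : ℝ) + 1) := by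
    refine (Nat.lt_floor_add_one (2 * Λ)).trans_le ?_
    have : ⌊2 * Λ⌋₊ + 1 ≤ 72 * (L + 1) := by omega
    exact_mod_cast this
  -- for a small cutoff the windows are empty, and the constant functions are used instead
  rcases Nat.eq_zero_or_pos L with h0 | h0
  · refine le_trans (pow_le_one₀ (by positivity) ?_) h1
    rw [h0, Nat.cast_zero] at h5
    linarith
  · refine le_trans (pow_le_pow_left₀ (by positivity) ?_ 9) h2
    have : (1 : ℝ) ≤ L := by exact_mod_cast h0
    linarith

/-! ### The powers of the cutoff -/

/-- The closed chain: `T` stands for `tr X`, `t` for `tr X ^ (M + 1)` and `m` for the dimension. -/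
theorem chain_lower_bound {c Λ T m t : ℝ} (M : ℕ) (hc : 0 < c) (hΛ : 1 ≤ Λ) (hm : 0 < m)
    (hT : c * Λ ^ 9 ≤ T) (hm' : m ≤ 729 * Λ ^ 6) (h : T ^ (M + 1) ≤ m ^ M * t) :
    (c / 729) ^ (M + 1) * Λ ^ (9 + 3 * M) ≤ t := by
  have hΛ0 : 0 < Λ := by linarith
  have h1 : (c * Λ ^ 9) ^ (M + 1) ≤ m ^ M * t :=
    (pow_le_pow_left₀ (by positivity) hT _).trans h
  have ht : 0 < t := pos_of_mul_pos_right ((by positivity : 0 < (c * Λ ^ 9) ^ (M + 1)).trans_le h1)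
    (by positivity)
  have h2 : (c * Λ ^ 9) ^ (M + 1) ≤ (729 * Λ ^ 6) ^ M * t :=
    h1.trans (by gcongr)
  refine le_of_mul_le_mul_left (le_trans ?_ h2) (by positivity : 0 < (729 * Λ ^ 6) ^ M)
  have e : (729 * Λ ^ 6) ^ M * ((c / 729) ^ (M + 1) * Λ ^ (9 + 3 * M))
      = (c * Λ ^ 9) ^ (M + 1) / 729 := by
    rw [div_pow, mul_pow, mul_pow, ← pow_mul, ← pow_mul, pow_succ (729 : ℝ)]
    field_simp
    ring
  rw [e]
  exact div_le_self (by positivity) (by norm_num)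

/-- The open chain: `q` stands for `⟨u, Y u⟩`, `t` for `⟨u, Y ^ (N + 1) u⟩`, and `T` for `tr X`, which
serves to bound the dimension `m` from below. -/
theorem open_chain_lower_bound {c Λ D T m q t : ℝ} (N : ℕ) (hc : 0 < c) (hc1 : c ≤ 1) (hΛ : 1 ≤ Λ)
    (hm : 0 < m) (hD : D ≤ 27 * Λ ^ 3) (hT : c * Λ ^ 9 ≤ T) (hT' : T ≤ m * D)
    (hq : m ^ 2 ≤ D * q) (h : q ^ (N + 1) ≤ m ^ N * t) :
    (c ^ 2 / 27 ^ 3) ^ (N + 1) * Λ ^ (9 + 3 * N) ≤ t := by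
  have hΛ0 : 0 < Λ := by linarith
  have hD0 : 0 < D := pos_of_mul_pos_right
    ((by positivity : 0 < c * Λ ^ 9).trans_le (hT.trans hT')) hm.le
  have h1 : c / 27 * Λ ^ 6 ≤ m := by
    have h2 : c * Λ ^ 9 ≤ m * (27 * Λ ^ 3) := (hT.trans hT').trans (by gcongr)
    have h3 : c / 27 * Λ ^ 6 * (27 * Λ ^ 3) ≤ m * (27 * Λ ^ 3) := by
      refine le_trans (le_of_eq ?_) h2
      ring
    exact le_of_mul_le_mul_right h3 (by positivity)
  have h4 : m ^ 2 / D ≤ q := (div_le_iff₀' hD0).2 hq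
  have h5 : (m ^ 2 / D) ^ (N + 1) ≤ m ^ N * t := (pow_le_pow_left₀ (by positivity) h4 _).trans h
  have h6 : m * (m / D) ^ (N + 1) ≤ t := by
    refine le_of_mul_le_mul_left (le_trans (le_of_eq ?_) h5) (by positivity : 0 < m ^ N)
    rw [div_pow, div_pow]
    field_simp
    ring
  refine le_trans ?_ h6
  have h7 : c / 27 ^ 2 * Λ ^ 3 ≤ m / D := by
    rw [le_div_iff₀ hD0]
    calc c / 27 ^ 2 * Λ ^ 3 * D ≤ c / 27 ^ 2 * Λ ^ 3 * (27 * Λ ^ 3) := by gcongr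
      _ = c / 27 * Λ ^ 6 := by ring
      _ ≤ m := h1
  have h8 : (c / 27) ^ (N + 1) ≤ c / 27 :=
    pow_le_of_le_one (by positivity) (by linarith) (by omega)
  calc (c ^ 2 / 27 ^ 3) ^ (N + 1) * Λ ^ (9 + 3 * N)
      = (c / 27) ^ (N + 1) * Λ ^ 6 * (c / 27 ^ 2 * Λ ^ 3) ^ (N + 1) := by
        rw [show c ^ 2 / 27 ^ 3 = (c / 27) * (c / 27 ^ 2) by ring, mul_pow, mul_pow _ (Λ ^ 3),
          ← pow_mul]
        ring
    _ ≤ c / 27 * Λ ^ 6 * (m / D) ^ (N + 1) := by gcongr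
    _ ≤ m * (m / D) ^ (N + 1) := by gcongr

theorem chain_upper_bound {Λ D m t : ℝ} (N : ℕ) (hΛ : 1 ≤ Λ) (hD0 : 0 ≤ D) (hD : D ≤ 27 * Λ ^ 3)
    (hm : m ≤ 729 * Λ ^ 6) (h : t ≤ m * D ^ (N + 1)) :
    t ≤ 19683 ^ (N + 1) * Λ ^ (9 + 3 * N) := by
  have hΛ0 : 0 < Λ := by linarith
  calc t ≤ m * D ^ (N + 1) := h
    _ ≤ 729 * Λ ^ 6 * (27 * Λ ^ 3) ^ (N + 1) := by gcongr
    _ = 729 * (27 ^ (N + 1) * Λ ^ (9 + 3 * N)) := by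
        rw [mul_pow, ← pow_mul]; ring
    _ ≤ 729 ^ (N + 1) * (27 ^ (N + 1) * Λ ^ (9 + 3 * N)) := by
        gcongr; exact le_self_pow₀ (by norm_num) (by omega)
    _ = 19683 ^ (N + 1) * Λ ^ (9 + 3 * N) := by
        rw [← mul_assoc, ← mul_pow]; norm_num

section Bounds

variable {Λ : ℝ} {m : ℕ}

theorem card_covarianceBasis_le (hΛ : 1 ≤ Λ)
    (F : CovarianceBasis (Finset.range (⌊2 * Λ⌋₊ + 1)) m) : (m : ℝ) ≤ 729 * Λ ^ 6 := by
  have hD := windowDelta_range_le hΛ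
  calc (m : ℝ) ≤ windowDelta (Finset.range (⌊2 * Λ⌋₊ + 1)) 1 ^ 2 := F.card_le
    _ ≤ (27 * Λ ^ 3) ^ 2 := pow_le_pow_left₀ (windowDelta_one_nonneg _) hD 2
    _ = 729 * Λ ^ 6 := by ring

theorem card_covarianceBasis_pos (hΛ : 1 ≤ Λ)
    (F : CovarianceBasis (Finset.range (⌊2 * Λ⌋₊ + 1)) m) : (0 : ℝ) < m := by
  rcases Nat.eq_zero_or_pos m with rfl | h
  · have h1 := le_trace_doubleVertexMatrix_range hΛ F
    rw [Matrix.trace, Finset.univ_eq_empty, Finset.sum_empty] at h1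
    have : 0 < (Λ / 72) ^ 9 := by positivity
    linarith
  · exact_mod_cast h

theorem boulatovAmplitude_chain_bounds (hΛ : 1 ≤ Λ) (M : ℕ) (hn : Even ((M + 1) * 2)) :
    (1 / 8 : ℝ) ^ ((M + 1) * 2) * (((1 / 72) ^ 9 / 729) ^ (M + 1) * Λ ^ (9 + 3 * M))
        ≤ ‖boulatovAmplitude Λ (boulatovChain ((M + 1) * 2) hn)‖ ∧
      ‖boulatovAmplitude Λ (boulatovChain ((M + 1) * 2) hn)‖
        ≤ (1 / 8 : ℝ) ^ ((M + 1) * 2) * (19683 ^ (M + 1) * Λ ^ (9 + 3 * M)) := by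
  obtain ⟨m, ⟨F⟩⟩ := exists_covarianceBasis (Finset.range (⌊2 * Λ⌋₊ + 1))
  have hH := doubleVertexMatrix_isHermitian (vertexTensor F boulatovPattern)
  have hp := dotProduct_doubleVertexMatrix_mulVec_nonneg (vertexTensor F boulatovPattern)
  have hm := card_covarianceBasis_le hΛ F
  have hT : (1 / 72) ^ 9 * Λ ^ 9 ≤ (doubleVertexMatrix (vertexTensor F boulatovPattern)).trace := by
    refine le_trans (le_of_eq ?_) (le_trace_doubleVertexMatrix_range hΛ F)
    ring
  have hl := trace_pow_le_trace_pow hH hp M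
  have hu := trace_pow_le hH hp (dotProduct_doubleVertexMatrix_mulVec_le F) (M + 1)
  rw [Fintype.card_fin] at hl hu
  have h1 := chain_lower_bound M (by norm_num) hΛ (card_covarianceBasis_pos hΛ F) hT hm hl
  have h2 := chain_upper_bound M hΛ (windowDelta_one_nonneg _) (windowDelta_range_le hΛ) hm hu
  have h0 : 0 ≤ (doubleVertexMatrix (vertexTensor F boulatovPattern) ^ (M + 1)).trace :=
    le_trans (by positivity) h1
  rw [norm_boulatovAmplitude_chain hn M.succ_pos Λ F, abs_of_nonneg h0]
  constructor <;> gcongr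

theorem bflAmplitude_chain_bounds (hΛ : 1 ≤ Λ) (δ : ℝ) (N : ℕ) :
    (1 / 8 : ℝ) ^ (N + 1) * ((((1 / 72) ^ 9) ^ 2 / 27 ^ 3) ^ (N + 1) * Λ ^ (9 + 3 * N))
        ≤ ‖bflAmplitude δ Λ (bflChain (N + 1))‖ ∧
      ‖bflAmplitude δ Λ (bflChain (N + 1))‖
        ≤ (1 / 8 : ℝ) ^ (N + 1) * (19683 ^ (N + 1) * Λ ^ (9 + 3 * N)) := by
  obtain ⟨m, ⟨F⟩⟩ := exists_covarianceBasis (Finset.range (⌊2 * Λ⌋₊ + 1))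
  have hX := trace_pow_le (doubleVertexMatrix_isHermitian (vertexTensor F boulatovPattern))
    (dotProduct_doubleVertexMatrix_mulVec_nonneg _) (dotProduct_doubleVertexMatrix_mulVec_le F) 1
  rw [pow_one, pow_one, Fintype.card_fin] at hX
  have hH := pillowMatrix_isHermitian F
  have hp := dotProduct_pillowMatrix_mulVec_nonneg F
  have hm := card_covarianceBasis_le hΛ F
  have hT : (1 / 72) ^ 9 * Λ ^ 9 ≤ (doubleVertexMatrix (vertexTensor F boulatovPattern)).trace := by
    refine le_trans (le_of_eq ?_) (le_trace_doubleVertexMatrix_range hΛ F)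
    ring
  have hl := dotProduct_mulVec_pow_le hH hp (diagonalVector m) N
  have hu := dotProduct_pow_mulVec_le hH hp (dotProduct_pillowMatrix_mulVec_le F)
    (diagonalVector m) (N + 1)
  rw [dotProduct_diagonalVector] at hl hu
  have h1 := open_chain_lower_bound N (by norm_num) (by norm_num) hΛ
    (card_covarianceBasis_pos hΛ F) (windowDelta_range_le hΛ) hT hX
    (sq_card_le_dotProduct_pillowMatrix F) hl
  have h2 := chain_upper_bound N hΛ (windowDelta_one_nonneg _) (windowDelta_range_le hΛ) hm
    (hu.trans_eq (mul_comm _ _))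
  have h0 := le_trans (by positivity) h1
  rw [norm_bflAmplitude_chain δ Λ F, abs_of_nonneg h0]
  constructor <;> gcongr

end Bounds

end GFT

theorem theorem3 :
    ∃ k K : ℝ, 0 < k ∧ 0 < K ∧
      (∀ (n : ℕ) (hn : Even n), 0 < n →
        (GFT.boulatovChain n hn).IsConnected ∧
        ∀ Λ : ℝ, 1 ≤ Λ →
          k ^ n * Λ ^ (6 + 3 * (n : ℝ) / 2) ≤
              ‖GFT.boulatovAmplitude Λ (GFT.boulatovChain n hn)‖ ∧
            ‖GFT.boulatovAmplitude Λ (GFT.boulatovChain n hn)‖ ≤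
              K ^ n * Λ ^ (6 + 3 * (n : ℝ) / 2)) ∧
      (∀ n : ℕ, 0 < n →
        (GFT.bflChain n).IsConnected ∧
        ∀ δ : ℝ, |δ| ≤ 1 → ∀ Λ : ℝ, 1 ≤ Λ →
          k ^ n * Λ ^ (6 + 3 * (n : ℝ)) ≤ ‖GFT.bflAmplitude δ Λ (GFT.bflChain n)‖ ∧
            ‖GFT.bflAmplitude δ Λ (GFT.bflChain n)‖ ≤ K ^ n * Λ ^ (6 + 3 * (n : ℝ))) := by
  refine ⟨1 / 8 * (((1 / 72) ^ 9) ^ 2 / 27 ^ 3), 19683, by positivity, by norm_num,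
    fun n hn h0 => ⟨GFT.boulatovChain_isConnected hn h0, fun Λ hΛ => ?_⟩,
    fun n h0 => ⟨GFT.bflChain_isConnected h0, fun δ _ Λ hΛ => ?_⟩⟩
  · obtain ⟨M, rfl⟩ : ∃ M, n = (M + 1) * 2 := by
      obtain ⟨r, hr⟩ := hn
      exact ⟨r - 1, by omega⟩
    have e : Λ ^ (6 + 3 * (((M + 1) * 2 : ℕ) : ℝ) / 2) = Λ ^ (9 + 3 * M) := by
      rw [← Real.rpow_natCast]
      congr 1
      push_cast
      ring
    have hΛ0 : 0 < Λ := by linarith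
    rw [e]
    obtain ⟨h1, h2⟩ := GFT.boulatovAmplitude_chain_bounds hΛ M hn
    constructor
    · refine le_trans ?_ h1
      rw [mul_pow, mul_assoc]
      gcongr
      rw [mul_comm (M + 1) 2, pow_mul]
      gcongr
      norm_num
    · refine h2.trans ?_
      rw [← mul_assoc]
      gcongr
      calc (1 / 8 : ℝ) ^ ((M + 1) * 2) * 19683 ^ (M + 1) ≤ 1 * 19683 ^ ((M + 1) * 2) := by
            gcongr
            · exact pow_le_one₀ (by norm_num) (by norm_num)
            · norm_num
            · omega
        _ = _ := one_mul _
  · obtain ⟨N, rfl⟩ : ∃ N, n = N + 1 := ⟨n - 1, by omega⟩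
    have e : Λ ^ (6 + 3 * ((N + 1 : ℕ) : ℝ)) = Λ ^ (9 + 3 * N) := by
      rw [← Real.rpow_natCast]
      congr 1
      push_cast
      ring
    have hΛ0 : 0 < Λ := by linarith
    rw [e]
    obtain ⟨h1, h2⟩ := GFT.bflAmplitude_chain_bounds hΛ δ N
    constructor
    · rw [mul_pow, mul_assoc]
      exact h1
    · refine h2.trans ?_
      exact mul_le_of_le_one_left (by positivity) (pow_le_one₀ (by norm_num) (by norm_num))
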